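/- **Setting.** A monotone CNF formula $C$ in variables $x_1,\dots,x_n$ is a finite conjunction of clauses, each clause being a nonempty set of variables (read as their disjunction; no negations). It is *read-5* if every variable appears in at most $5$ clauses. Let $Z(C)$ be the number of assignments in $\{0,1\}^n$ that satisfy $C$. *Pinning* $x$ to $1$ removes all clauses that contain $x$; pinning $x$ to $0$ deletes $x$ from all clauses. **Truncated recursion.** For a variable $x$ of $C$ let $c_1,\dots,c_d$ be the clauses of $C$ that contain $x$, let $w_j=|c_j|-1$, and let $x_{j,1},\dots,x_{j,w_j}$ be the variables of $c_j$ other than $x$ (enumerations are taken in the order in which clauses and variables are listed). Let $C_{j,i}$ be obtained from $C$ by removing $c_1,\dots,c_d$, adding the clauses $c_k\setminus\{x\}$ for $k=j+1,\dots,d$, and pinning $x_{j,1},\dots,x_{j,i-1}$ to $0$. For integers $L\ge 0$ put $R(C,x,L)=0$ if some $w_j=0$; otherwise $R(C,x,L)=1$ if $d=0$ or $L=0$; and otherwise $$R(C,x,L)=\prod_{j=1}^{d}\Bigl(1-\prod_{i=1}^{w_j}\frac{R(C_{j,i},x_{j,i},L_j)}{1+R(C_{j,i},x_{j,i},L_j)}\Bigr),\qquad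 L_j=\max\bigl(0,\,L-\lceil\log_4(w_j+1)\rceil\bigr).$$ Let $C_1=C$, let $C_{i+1}$ be $C_i$ with $x_i$ pinned to $1$, and put $$Z(C,L)=\prod_{i=1}^{n}\bigl(1+R(C_i,x_i,L)\bigr).$$ **Theorem.** Let $\alpha=0.981$. For $n\ge 1$ and $0<\varepsilon<1$ let $L=L(n,\varepsilon)=\bigl\lceil\log_\alpha\bigl(\tfrac{\varepsilon}{10\sqrt6\,n}\bigr)\bigr\rceil$. 1. For every read-5 monotone CNF formula $C$ with $n\ge1$ variables and every real $0<\varepsilon<1$, $$(1-\varepsilon)\,Z(C)\le Z(C,L)\le(1+\varepsilon)\,Z(C).$$ 2. There is a deterministic algorithm which, given such a formula $C$ and a rational $0<\varepsilon<1$, outputs $Z(C,L)$ in time $$O\Bigl(n^2\,(n/\varepsilon)^{\log_{1/\alpha}16}\Bigr).$$ Here the algorithm is a single program for a random access machine that operates on natural and rational numbers (arithmetic, comparisons, indirect addressing, recursive calls), one step per operation; the constant in the $O$ is absolute; and all numbers that occur have a number of binary digits that is bounded by a polynomial in $n$, $1/\varepsilon$ and the number of digits of $\varepsilon$. In particular,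 this is a deterministic FPTAS for $Z(C)$. 3. Counting set covers is a case of this: if $S_1,\dots,S_n$ are sets with at most $5$ elements each and $\{1,\dots,m\}$ is their union, then the formula with the clauses $\{x_i : e\in S_i\}$, $1\le e\le m$, is a read-5 monotone CNF formula, and $Z$ of it is the number of subfamilies that cover $\{1,\dots,m\}$. -/

import Mathlib

/-! ### Monotone CNF formulas -/

/-- A monotone CNF formula in the variables `x_0, …, x_{n-1}`: the list of its clauses, each clause
being the list of the variables that occur (positively) in it. -/
abbrev MonCNF (n : ℕ) := List (List (Fin n))

namespace MonCNF

variable {n : ℕ}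

/-- The clauses of `C` that contain `x`. -/
def clausesWith (C : MonCNF n) (x : Fin n) : MonCNF n := C.filter (fun c => x ∈ c)

/-- The clauses of `C` that do not contain `x`; this is `C` with `x` pinned to `1`. -/
def clausesWithout (C : MonCNF n) (x : Fin n) : MonCNF n := C.filter (fun c => x ∉ c)

/-- `C - x`, that is, `C` with `x` pinned to `0`: the variable is deleted from every clause. -/
def pinZero (C : MonCNF n) (x : Fin n) : MonCNF n := C.map (fun c => c.filter (fun y => y ≠ x))

/-- Read-`d` monotone CNF formulas: a clause is a nonempty set of variables, and every variable
appears in at most `d` clauses. -/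
structure IsRead (d : ℕ) (C : MonCNF n) : Prop where
  nonempty : ∀ c ∈ C, c ≠ []
  nodup : ∀ c ∈ C, c.Nodup
  read : ∀ x, (C.clausesWith x).length ≤ d

/-- The assignment `a` satisfies `C`. -/
def Sat (C : MonCNF n) (a : Fin n → Bool) : Prop := ∀ c ∈ C, ∃ x ∈ c, a x = true

/-- The number `Z(C)` of satisfying assignments of `C`. -/
noncomputable def numSat (C : MonCNF n) : ℕ := Nat.card {a : Fin n → Bool // C.Sat a}

/-! ### The truncated recursion -/

/-- The list of the variables other than `x` of the `j`-th clause `c_j` that contains `x`. Its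
length is `w_j = |c_j| - 1`. -/
def others (C : MonCNF n) (x : Fin n) (j : Fin (C.clausesWith x).length) : List (Fin n) :=
  ((C.clausesWith x).get j).filter (fun y => y ≠ x)

/-- The formula `C_{j,i}`: let `c_1, …, c_d` be the clauses of `C` that contain `x`. Remove them all,
put back `c_k - x` for `k > j`, and pin to `0` the variables that precede the `i`-th one
in `c_j - x`. -/
def sub (C : MonCNF n) (x : Fin n) (j : Fin (C.clausesWith x).length)
    (i : Fin (C.others x j).length) : MonCNF n :=
  ((C.others x j).take i).foldl pinZero
    (C.clausesWithout x ++ pinZero ((C.clausesWith x).drop (j + 1)) x)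

/-- The truncated ratio `R(C, x, L)`. Here `Nat.clog 4 (w + 1) = ⌈log₄ (w + 1)⌉`, and the
subtraction of natural numbers is `max (0, L - ⌈log₄ (w + 1)⌉)`. -/
def ratio (C : MonCNF n) (x : Fin n) (L : ℕ) : ℚ :=
  if ∃ j, C.others x j = [] then 0
  else if (C.clausesWith x).length = 0 ∨ L = 0 then 1
  else ∏ j : Fin (C.clausesWith x).length, (1 - ∏ i : Fin (C.others x j).length,
    (ratio (C.sub x j i) ((C.others x j).get i) (L - Nat.clog 4 ((C.others x j).length + 1)) /
      (1 + ratio (C.sub x j i) ((C.others x j).get i)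
        (L - Nat.clog 4 ((C.others x j).length + 1)))))
termination_by L
decreasing_by
  all_goals
    have hi : 0 < (C.others x j).length := Nat.lt_of_le_of_lt (Nat.zero_le _) i.isLt
    have := Nat.clog_pos (b := 4) (n := (C.others x j).length + 1) (by norm_num) (by omega)
    omega

/-- `C` with the variables `x_0, …, x_{i-1}` pinned to `1`. -/
def pinPrefix (C : MonCNF n) (i : Fin n) : MonCNF n :=
  (List.finRange n |>.take i).foldl clausesWithout C

/-- The estimator `Z(C, L) = ∏ i, (1 + R(C_i, x_i, L))`. -/
def estimate (C : MonCNF n) (L : ℕ) : ℚ := ∏ i : Fin n, (1 + ratio (C.pinPrefix i) i L)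

/-- The recursion depth: `log_α (ε / (10 √6 n))` with `α = 0.981`, rounded up to an integer. -/
noncomputable def depth (n : ℕ) (ε : ℝ) : ℕ :=
  ⌈Real.logb 0.981 (ε / (10 * Real.sqrt 6 * n))⌉₊

/-! ### Set covers -/

/-- The formula of a set system `S_0, …, S_{n-1}` of subsets of `{0, …, m-1}`: a variable for
each set and, for each element, the clause of the sets that contain it. -/
def ofSets {m : ℕ} (S : Fin n → Finset (Fin m)) : MonCNF n :=
  (List.finRange m).map (fun e => (List.finRange n).filter (fun i => e ∈ S i))

end MonCNF

/-! ### Random access machine with step count -/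

namespace RAM

/-- A state of the machine: registers and an indirectly addressed memory for natural numbers, and
the same for rational numbers. -/
structure State where
  reg : ℕ → ℕ
  mem : ℕ → ℕ
  rreg : ℕ → ℚ
  rmem : ℕ → ℚ

/-- Arithmetic operations on natural numbers (`sub` is truncated at `0`). -/
inductive NatOp
  | add | sub | mul

def NatOp.eval : NatOp → ℕ → ℕ → ℕ
  | add, a, b => a + b
  | sub, a, b => a - b
  | mul, a, b => a * b

/-- Arithmetic operations on rational numbers. -/
inductive RatOp
  | add | sub | mul | div

def RatOp.eval : RatOp → ℚ → ℚ → ℚ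
  | add, a, b => a + b
  | sub, a, b => a - b
  | mul, a, b => a * b
  | div, a, b => a / b

/-- Elementary instructions; each of them takes one step. -/
inductive Instr
  /-- `reg x := v` -/
  | const (x v : ℕ)
  /-- `reg x := reg y o reg z` -/
  | op (o : NatOp) (x y z : ℕ)
  /-- `reg x := mem (reg y)` -/
  | load (x y : ℕ)
  /-- `mem (reg x) := reg y` -/
  | store (x y : ℕ)
  /-- `rreg u := q` -/
  | rconst (u : ℕ) (q : ℚ)
  /-- `rreg u := reg x` -/
  | rcast (u x : ℕ)
  /-- `rreg u := rreg v o rreg w` -/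
  | rop (o : RatOp) (u v w : ℕ)
  /-- `rreg u := rmem (reg x)` -/
  | rload (u x : ℕ)
  /-- `rmem (reg x) := rreg u` -/
  | rstore (x u : ℕ)

def Instr.exec : Instr → State → State
  | const x v, s => { s with reg := Function.update s.reg x v }
  | op o x y z, s => { s with reg := Function.update s.reg x (o.eval (s.reg y) (s.reg z)) }
  | load x y, s => { s with reg := Function.update s.reg x (s.mem (s.reg y)) }
  | store x y, s => { s with mem := Function.update s.mem (s.reg x) (s.reg y) }
  | rconst u q, s => { s with rreg := Function.update s.rreg u q }
  | rcast u x, s => { s with rreg := Function.update s.rreg u (s.reg x) }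
  | rop o u v w, s => { s with rreg := Function.update s.rreg u (o.eval (s.rreg v) (s.rreg w)) }
  | rload u x, s => { s with rreg := Function.update s.rreg u (s.rmem (s.reg x)) }
  | rstore x u, s => { s with rmem := Function.update s.rmem (s.reg x) (s.rreg u) }

/-- Tests; each of them takes one step. -/
inductive Test
  /-- `reg x < reg y` -/
  | lt (x y : ℕ)
  /-- `rreg u < rreg v` -/
  | rlt (u v : ℕ)

def Test.holds : Test → State → Prop
  | lt x y, s => s.reg x < s.reg y
  | rlt u v, s => s.rreg u < s.rreg v

/-- Commands: instructions, control structures, and calls of (possibly recursive) procedures, which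
have no parameters and no local variables of their own. -/
inductive Cmd
  | instr (i : Instr)
  | seq (c d : Cmd)
  | ite (b : Test) (c d : Cmd)
  | while (b : Test) (c : Cmd)
  | call (p : ℕ)

/-- A program is a finite list of procedures; the one with index `0` is the main procedure. -/
abbrev Program := List Cmd

/-- The number of binary digits of a rational number, numerator and denominator together. -/
def bits (q : ℚ) : ℕ := Nat.size q.num.natAbs + Nat.size q.den

/-- Every number stored in the state has at most `B` binary digits. -/
structure State.Fits (s : State) (B : ℕ) : Prop where
  reg : ∀ a, Nat.size (s.reg a) ≤ B
  mem : ∀ a, Nat.size (s.mem a) ≤ B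
  rreg : ∀ a, bits (s.rreg a) ≤ B
  rmem : ∀ a, bits (s.rmem a) ≤ B

/-- `Exec P B c s k t`: in the program `P`, the command `c`, started in the state `s`, halts in the
state `t` after `k` steps, and numbers of more than `B` binary digits never occur on the way. -/
inductive Exec (P : Program) (B : ℕ) : Cmd → State → ℕ → State → Prop
  | instr {i : Instr} {s : State} :
      (i.exec s).Fits B → Exec P B (.instr i) s 1 (i.exec s)
  | seq {c d : Cmd} {s t u : State} {k l : ℕ} :
      Exec P B c s k t → Exec P B d t l u → Exec P B (.seq c d) s (k + l) u
  | iteTrue {b : Test} {c d : Cmd} {s t : State} {k : ℕ} :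
      b.holds s → Exec P B c s k t → Exec P B (.ite b c d) s (k + 1) t
  | iteFalse {b : Test} {c d : Cmd} {s t : State} {k : ℕ} :
      ¬ b.holds s → Exec P B d s k t → Exec P B (.ite b c d) s (k + 1) t
  | whileTrue {b : Test} {c : Cmd} {s t u : State} {k l : ℕ} :
      b.holds s → Exec P B c s k t → Exec P B (.while b c) t l u →
        Exec P B (.while b c) s (k + l + 1) u
  | whileFalse {b : Test} {c : Cmd} {s : State} :
      ¬ b.holds s → Exec P B (.while b c) s 1 s
  | call {p : ℕ} {c : Cmd} {s t : State} {k : ℕ} :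
      P[p]? = some c → Exec P B c s k t → Exec P B (.call p) s (k + 1) t

/-- The input format of formulas: the number of variables, the number of clauses, and then for each
clause its length followed by the indices of its variables. -/
def encode {n : ℕ} (C : MonCNF n) : List ℕ :=
  n :: C.length :: C.flatMap (fun c => c.length :: c.map Fin.val)

/-- The initial state on input `(C, ε)`: the code of `C` is at the beginning of the memory, `ε` is
in the rational register `0`, and everything else is `0`. -/
def init {n : ℕ} (C : MonCNF n) (ε : ℚ) : State where
  reg := fun _ => 0
  mem := fun a => (encode C).getD a 0
  rreg := fun u => if u = 0 then ε else 0
  rmem := fun _ => 0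

/-- On input `(C, ε)` the program `P` halts after `k` steps with the output `q` in the rational
register `0`, and numbers of more than `B` binary digits never occur. -/
def Computes {n : ℕ} (P : Program) (B : ℕ) (C : MonCNF n) (ε : ℚ) (k : ℕ) (q : ℚ) : Prop :=
  ∃ t : State, Exec P B (.call 0) (init C ε) k t ∧ t.rreg 0 = q

end RAM

/-! Exactness. Let `A` be the clauses without `x`. The number of solutions with `x = 0` over the
number with `x = 1` equals the number of solutions of `A` together with all `c_j - x`, divided by
the number of solutions of `A`. Adding the clauses `c_j - x` back one at a time makes this a product
of probabilities that `c_j - x` holds. The chain rule expands the complementary event, all variables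
of `c_j - x` being `0`, into a product of terms `R/(1+R)`. Hence the recursion without truncation is
exact (`exactRatio_eq_nodeProd`), and pinning the variables to `1` in turn makes `Z(C)` telescope
into the product of the `1 + R` (`numSat_eq_pinProd`). What remains is the truncation error and the
cost.

Error. Measure a ratio by the potential `φ = arsinh √R`; then `R/(1+R) = tanh² φ` and `1 + R = cosh²
φ`. Move all children of a node from their truncated to their exact potentials along segments and
bound the speed of the potential of the node. Since `tanh' = 1 - tanh²`, a clause with `w` variables
damps the speed by `0.981 ^ (⌈log₄(w+1)⌉ - 1)`: this is `sens_le`, proved by halving the clause, and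
it pays for the larger loss of depth at long clauses. If `A_j` is the product of the `tanh` values
of a clause and `V = ∏ (1 - A_j²)`, the node contributes the factor `(∑ A_j) √(V/(1+V))`. For at
most four clauses this is at most `0.981` (`contraction_four`); the constant is just above the
maximum, attained at equal `A_j`. Four clauses suffice below the root, because the clause through
which a variable is reached has been removed (`ReadFive.of_cons`). The error at depth `L` is
therefore at most `0.981 ^ L` (`potential_error_le`), with a further constant at the root, where
five clauses are possible. As `cosh` changes by at most a factor `exp |Δφ|`, the `n` factors of the
estimator give a total factor `exp (0.255 ε)`.

Cost. A node has at most four clauses, and a clause of `w` variables makes `w ≤ 3 · 13 ^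
(⌈log₄(w+1)⌉ - 1)` calls at a level lower by `⌈log₄(w+1)⌉`. So each level costs a factor of about `4
· 3 = 12`, and base `13` absorbs the overhead (`nodeCost_le_ratCost`). With formulas of length
`O(n)` the total is `O(n³ 13 ^ L)`; since `13 / 0.981 < 16`, one factor `n` disappears in the
exponent `log 16` (`exists_mul_pow_le`).

Machine. Formulas are token lists, and a single filter loop copies, pins and splits them
(`sieveCmd_spec`). Recursion uses frames in memory. Natural numbers gain at most eight digits per
step, so their size follows from the running time (`Run.exec`); the denominators of rational numbers
are at most `2 ^ N` for the same `N` that bounds the steps (`RatPost`). -/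

namespace MonCNF

variable {n : ℕ}

/-! ### The recursion on lists -/

/-- The product over the variables of a clause, where every variable is pinned to `0` after it has
been processed. -/
def clauseProd (t : MonCNF n → Fin n → ℚ) : MonCNF n → List (Fin n) → ℚ
  | _, [] => 1
  | D, v :: vs => t D v * clauseProd t (pinZero D v) vs

/-- The product over the clauses in `W`, where `A` are the clauses that are always present. -/
def nodeProd (t : ℕ → MonCNF n → Fin n → ℚ) (A : MonCNF n) : MonCNF n → ℚ
  | [] => 1
  | c :: cs => (1 - clauseProd (t c.length) (A ++ cs) c) * nodeProd t A cs

/-- The truncated conditional probability that `v` is `0`. -/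
def truncProb (L w : ℕ) (D : MonCNF n) (v : Fin n) : ℚ :=
  if L = 0 then 0
  else ratio D v (L - Nat.clog 4 (w + 1)) / (1 + ratio D v (L - Nat.clog 4 (w + 1)))

/-- Replaces the indexed product by a structural recursion on the clause, in which the formula is
updated along the way; all later inductions use this form. -/
theorem prod_get_eq_clauseProd (t : MonCNF n → Fin n → ℚ) (D : MonCNF n) (vs : List (Fin n)) :
    ∏ i : Fin vs.length, t ((vs.take i).foldl pinZero D) (vs.get i) = clauseProd t D vs := by
  induction vs generalizing D with
  | nil => simp [clauseProd]
  | cons v vs ih =>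
    rw [clauseProd, ← ih]
    exact Fin.prod_univ_succ (n := vs.length) _

theorem prod_get_eq_nodeProd (t : ℕ → MonCNF n → Fin n → ℚ) (A cs : MonCNF n) (x : Fin n) :
    ∏ j : Fin cs.length, (1 - clauseProd (t ((cs.get j).filter (fun y => y ≠ x)).length)
      (A ++ pinZero (cs.drop (j + 1)) x) ((cs.get j).filter (fun y => y ≠ x))) =
    nodeProd t A (pinZero cs x) := by
  induction cs with
  | nil => simp [nodeProd, pinZero]
  | cons c cs ih =>
    have h : pinZero (c :: cs) x = c.filter (fun y => y ≠ x) :: pinZero cs x := rfl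
    rw [h, nodeProd, ← ih]
    exact Fin.prod_univ_succ (n := cs.length) _

theorem nodeProd_eq_zero (t : ℕ → MonCNF n → Fin n → ℚ) (A W : MonCNF n) (h : [] ∈ W) :
    nodeProd t A W = 0 := by
  induction W with
  | nil => simp at h
  | cons c cs ih =>
    rcases List.mem_cons.1 h with h | h
    · subst h; simp [nodeProd, clauseProd]
    · simp [nodeProd, ih h]

theorem nodeProd_zero (A W : MonCNF n) (h : [] ∉ W) :
    nodeProd (fun _ _ _ => 0) A W = 1 := by
  induction W with
  | nil => rfl
  | cons c cs ih =>
    simp only [List.mem_cons, not_or] at h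
    obtain ⟨v, vs, rfl⟩ := List.exists_cons_of_ne_nil (Ne.symm h.1)
    simp [nodeProd, ih h.2, clauseProd]

theorem exists_others_eq_nil (C : MonCNF n) (x : Fin n) :
    (∃ j, C.others x j = []) ↔ [] ∈ pinZero (C.clausesWith x) x := by
  constructor
  · rintro ⟨j, hj⟩
    exact List.mem_map.2 ⟨_, List.get_mem _ j, hj⟩
  · intro h
    obtain ⟨c, hc, h⟩ := List.mem_map.1 h
    obtain ⟨j, rfl⟩ := List.get_of_mem hc
    exact ⟨j, h⟩

/-- One formula covers all cases of the definition: an empty `c_j - x` gives a factor `1 - 1 = 0`,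
the case `d = 0` is an empty product, and for `L = 0` the value `0` of `truncProb` makes every
factor of a nonempty clause equal to `1`. -/
theorem ratio_eq_nodeProd (C : MonCNF n) (x : Fin n) (L : ℕ) :
    ratio C x L =
      nodeProd (truncProb L) (C.clausesWithout x) (pinZero (C.clausesWith x) x) := by
  rw [ratio]
  split_ifs with h1 h2
  · rw [nodeProd_eq_zero _ _ _ ((exists_others_eq_nil C x).1 h1)]
  · rw [exists_others_eq_nil] at h1
    rcases h2 with h2 | h2
    · rw [List.length_eq_zero_iff] at h2
      simp [h2, pinZero, nodeProd]
    · have : truncProb (n := n) L = fun _ _ _ => 0 := by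
        funext w D v; simp [truncProb, h2]
      rw [this, nodeProd_zero _ _ h1]
  · push Not at h2
    rw [← prod_get_eq_nodeProd]
    refine Finset.prod_congr rfl fun j _ => ?_
    rw [← prod_get_eq_clauseProd]
    congr 1
    refine Finset.prod_congr rfl fun i _ => ?_
    simp only [truncProb, h2.2, if_false]
    rfl

/-! ### Counting assignments -/

/-- The number of assignments with the property `Q`. -/
noncomputable def count (Q : (Fin n → Bool) → Prop) : ℚ := (Nat.card {a // Q a} : ℚ)

theorem count_congr {Q R : (Fin n → Bool) → Prop} (h : ∀ a, Q a ↔ R a) : count Q = count R := by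
  rw [show Q = R from funext fun a => propext (h a)]

theorem count_nonneg (Q : (Fin n → Bool) → Prop) : 0 ≤ count Q := Nat.cast_nonneg _

theorem count_le_of_injective {Q R : (Fin n → Bool) → Prop} (f : (Fin n → Bool) → (Fin n → Bool))
    (hf : ∀ a, Q a → R (f a)) (hi : ∀ a b, Q a → Q b → f a = f b → a = b) : count Q ≤ count R := by
  unfold count
  exact_mod_cast Nat.card_le_card_of_injective
    (fun a : {a // Q a} => (⟨f a.1, hf a.1 a.2⟩ : {a // R a}))
    (fun a b h => Subtype.ext (hi _ _ a.2 b.2 (by simpa using h)))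

theorem count_mono {Q R : (Fin n → Bool) → Prop} (h : ∀ a, Q a → R a) : count Q ≤ count R :=
  count_le_of_injective id h (fun _ _ _ _ h => h)

theorem count_pos {Q : (Fin n → Bool) → Prop} (a : Fin n → Bool) (h : Q a) : 0 < count Q := by
  unfold count
  have : Nonempty {a // Q a} := ⟨⟨a, h⟩⟩
  exact_mod_cast Nat.card_pos

theorem count_add_count_not (Q R : (Fin n → Bool) → Prop) :
    count (fun a => Q a ∧ R a) + count (fun a => Q a ∧ ¬ R a) = count Q := by
  classical
  unfold count
  simp only [Nat.card_eq_fintype_card, Fintype.card_subtype]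
  rw [← Finset.card_filter_add_card_filter_not (s := Finset.univ.filter Q) R]
  simp only [Finset.filter_filter]
  push_cast
  rfl

theorem count_add (Q : (Fin n → Bool) → Prop) (x : Fin n) :
    count (fun a => Q a ∧ a x = false) + count (fun a => Q a ∧ a x = true) = count Q := by
  rw [← count_add_count_not Q (fun a => a x = false)]
  simp

/-- A property that ignores the value at `x` is shared equally by the assignments with `x = 0` and
those with `x = 1`. -/
theorem two_mul_count (Q : (Fin n → Bool) → Prop) (x : Fin n) (b : Bool)
    (h : ∀ a c, Q a → Q (Function.update a x c)) :
    2 * count (fun a => Q a ∧ a x = b) = count Q := by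
  -- Overwriting the value at `x` injects each half into the other; the two inequalities together
  -- give equality.
  have key : ∀ b, count (fun a => Q a ∧ a x = b) ≤ count (fun a => Q a ∧ a x = !b) := by
    intro b
    refine count_le_of_injective (fun a => Function.update a x (!b))
      (fun a ha => ⟨h _ _ ha.1, by simp⟩) ?_
    intro a c ha hc hac
    have : ∀ y, y ≠ x → a y = c y := fun y hy => by simpa [hy] using congrFun hac y
    funext y
    by_cases hy : y = x
    · subst hy; rw [ha.2, hc.2]
    · exact this y hy
  have h1 := key true
  have h2 := key false
  have h3 := count_add Q x
  simp only [Bool.not_true, Bool.not_false] at h1 h2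
  cases b <;> linarith

theorem sat_append (C D : MonCNF n) (a : Fin n → Bool) : Sat (C ++ D) a ↔ C.Sat a ∧ D.Sat a := by
  simp only [Sat, List.mem_append, or_imp, forall_and]

theorem sat_update_of_forall_notMem {C : MonCNF n} {x : Fin n} (h : ∀ c ∈ C, x ∉ c)
    (a : Fin n → Bool) (b : Bool) (ha : C.Sat a) : C.Sat (Function.update a x b) := by
  intro c hc
  obtain ⟨y, hy, hay⟩ := ha c hc
  refine ⟨y, hy, ?_⟩
  rw [Function.update_of_ne (ne_of_mem_of_not_mem hy (h c hc)), hay]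

theorem notMem_of_mem_pinZero {C : MonCNF n} {x : Fin n} : ∀ c ∈ pinZero C x, x ∉ c := by
  intro c hc
  obtain ⟨c', -, rfl⟩ := List.mem_map.1 hc
  simp

theorem notMem_of_mem_clausesWithout {C : MonCNF n} {x : Fin n} :
    ∀ c ∈ clausesWithout C x, x ∉ c := by
  intro c hc
  simpa using (List.mem_filter.1 hc).2

theorem sat_pinZero {C : MonCNF n} {x : Fin n} {a : Fin n → Bool} (hx : a x = false) :
    Sat (pinZero C x) a ↔ C.Sat a := by
  simp only [Sat, pinZero, List.forall_mem_map]
  refine forall₂_congr fun c _ => exists_congr fun y => ?_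
  simp only [List.mem_filter, decide_eq_true_eq, ne_eq]
  constructor
  · tauto
  · rintro ⟨h1, h2⟩
    exact ⟨⟨h1, fun e => by simp [e, hx] at h2⟩, h2⟩

theorem sat_clausesWithout {C : MonCNF n} {x : Fin n} {a : Fin n → Bool} (hx : a x = true) :
    Sat (clausesWithout C x) a ↔ C.Sat a := by
  simp only [Sat, clausesWithout, List.mem_filter, decide_eq_true_eq]
  refine ⟨fun h c hc => ?_, fun h c hc => h c hc.1⟩
  by_cases hxc : x ∈ c
  · exact ⟨x, hxc, hx⟩
  · exact h c ⟨hc, hxc⟩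

theorem mem_iff_clauses (C : MonCNF n) (x : Fin n) (c : List (Fin n)) :
    c ∈ C ↔ c ∈ clausesWithout C x ∨ c ∈ clausesWith C x := by
  simp only [clausesWithout, clausesWith, List.mem_filter, decide_eq_true_eq]
  tauto

theorem sat_iff_clauses (C : MonCNF n) (x : Fin n) (a : Fin n → Bool) :
    C.Sat a ↔ Sat (clausesWithout C x) a ∧ Sat (clausesWith C x) a := by
  rw [← sat_append]
  simp only [Sat, List.mem_append, mem_iff_clauses C x]

/-- The ratio of the numbers of satisfying assignments with `x = 0` and with `x = 1`. -/
noncomputable def exactRatio (C : MonCNF n) (x : Fin n) : ℚ :=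
  count (fun a => C.Sat a ∧ a x = false) / count (fun a => C.Sat a ∧ a x = true)

/-- The probability that `v = 0` in a random satisfying assignment of `D`. -/
noncomputable def exactProb (D : MonCNF n) (v : Fin n) : ℚ :=
  count (fun a => D.Sat a ∧ a v = false) / count D.Sat

theorem sat_true {C : MonCNF n} (h : [] ∉ C) : C.Sat (fun _ => true) := by
  intro c hc
  obtain ⟨v, vs, rfl⟩ := List.exists_cons_of_ne_nil (show c ≠ [] from fun e => h (e ▸ hc))
  exact ⟨v, by simp, rfl⟩

theorem count_sat_pos {C : MonCNF n} (h : [] ∉ C) : 0 < count C.Sat := count_pos _ (sat_true h)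

theorem count_sat_true_pos {C : MonCNF n} (h : [] ∉ C) (x : Fin n) :
    0 < count (fun a => C.Sat a ∧ a x = true) := count_pos _ ⟨sat_true h, rfl⟩

theorem exactRatio_nonneg (C : MonCNF n) (x : Fin n) : 0 ≤ exactRatio C x :=
  div_nonneg (count_nonneg _) (count_nonneg _)

/-- Monotonicity: switching `x` from `0` to `1` keeps all clauses satisfied and is injective on
assignments with `x = 0`. This bound keeps all potentials below `arsinh 1`. -/
theorem exactRatio_le_one (C : MonCNF n) (x : Fin n) : exactRatio C x ≤ 1 := by
  refine div_le_one_of_le₀ ?_ (count_nonneg _)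
  refine count_le_of_injective (fun a => Function.update a x true) (fun a ha => ⟨?_, by simp⟩) ?_
  · intro c hc
    obtain ⟨y, hy, hay⟩ := ha.1 c hc
    refine ⟨y, hy, ?_⟩
    by_cases h : y = x
    · simp [h]
    · simp [h, hay]
  · intro a c ha hc hac
    funext y
    by_cases hy : y = x
    · subst hy; rw [ha.2, hc.2]
    · simpa [hy] using congrFun hac y

/-- The factor `2` arises because `x` stays a free variable after its clauses have been removed: the
count of `clausesWithout` is twice the number of solutions of `C` with `x = 1`. -/
theorem one_add_exactRatio {C : MonCNF n} (h : [] ∉ C) (x : Fin n) :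
    (1 + exactRatio C x) * count (clausesWithout C x).Sat = 2 * count C.Sat := by
  have h1 := (count_sat_true_pos h x).ne'
  have h2 := two_mul_count (clausesWithout C x).Sat x true
    (fun a b ha => sat_update_of_forall_notMem notMem_of_mem_clausesWithout a b ha)
  have h3 : count (fun a => (clausesWithout C x).Sat a ∧ a x = true) =
      count (fun a => C.Sat a ∧ a x = true) :=
    count_congr fun a => and_congr_left fun hx => sat_clausesWithout hx
  rw [← h2, h3, exactRatio, ← count_add C.Sat x]
  field_simp
  ring

theorem exactProb_eq {C : MonCNF n} (h : [] ∉ C) (x : Fin n) :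
    exactProb C x = exactRatio C x / (1 + exactRatio C x) := by
  have h1 := (count_sat_true_pos h x).ne'
  have h2 := count_sat_pos h
  rw [exactProb, exactRatio]
  rw [← count_add C.Sat x] at h2 ⊢
  rw [add_comm] at h2 ⊢
  have h3 := h2.ne'
  field_simp

/-- The chain rule for the event that all variables of a clause are `0`: conditioning on `v = 0`
amounts to replacing the formula by `pinZero D v`. -/
theorem clauseProd_exactProb (D : MonCNF n) (vs : List (Fin n)) (hv : vs.Nodup) :
    clauseProd exactProb D vs * count D.Sat = count (fun a => D.Sat a ∧ ∀ v ∈ vs, a v = false) := by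
  induction vs generalizing D with
  | nil => simp [clauseProd]
  | cons v vs ih =>
    rw [List.nodup_cons] at hv
    have e : count (fun a => D.Sat a ∧ ∀ y ∈ v :: vs, a y = false) =
        count (fun a => ((pinZero D v).Sat a ∧ ∀ y ∈ vs, a y = false) ∧ a v = false) := by
      refine count_congr fun a => ?_
      simp only [List.forall_mem_cons]
      constructor
      · rintro ⟨h1, h2, h3⟩; exact ⟨⟨(sat_pinZero h2).2 h1, h3⟩, h2⟩
      · rintro ⟨⟨h1, h3⟩, h2⟩; exact ⟨(sat_pinZero h2).1 h1, h2, h3⟩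
    -- Pinning may have produced an empty clause. Then `D` has no solutions, the probability is not
    -- meaningful, and both sides are `0`.
    by_cases h0 : count D.Sat = 0
    · rw [h0, mul_zero]
      refine le_antisymm (count_nonneg _) ?_
      rw [← h0]
      exact count_mono fun a ha => ha.1
    have h2 := two_mul_count (pinZero D v).Sat v false
      (fun a b ha => sat_update_of_forall_notMem notMem_of_mem_pinZero a b ha)
    have h3 : count (fun a => (pinZero D v).Sat a ∧ a v = false) =
        count (fun a => D.Sat a ∧ a v = false) :=
      count_congr fun a => and_congr_left fun hx => sat_pinZero hx
    have h4 := two_mul_count (fun a => (pinZero D v).Sat a ∧ ∀ y ∈ vs, a y = false) v false (by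
      rintro a b ⟨h1, h2⟩
      refine ⟨sat_update_of_forall_notMem notMem_of_mem_pinZero a b h1, fun y hy => ?_⟩
      rw [Function.update_of_ne (ne_of_mem_of_not_mem hy hv.1), h2 y hy])
    rw [e, clauseProd, exactProb]
    have h5 := ih (pinZero D v) hv.2
    rw [← h3]
    have h6 : count (fun a => (pinZero D v).Sat a ∧ a v = false) = count (pinZero D v).Sat / 2 := by
      linarith
    rw [h6]
    field_simp
    linarith

/-- Telescoping: the factor of `c` is the probability that `c` holds in a random solution of the
formula with the clauses after it, that is, the quotient of the counts with and without `c`. -/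
theorem nodeProd_exactProb (A W : MonCNF n) (hA : [] ∉ A) (hW : [] ∉ W) (hn : ∀ c ∈ W, c.Nodup) :
    nodeProd (fun _ => exactProb) A W * count A.Sat = count (Sat (A ++ W)) := by
  induction W with
  | nil => simp [nodeProd]
  | cons c cs ih =>
    simp only [List.mem_cons, not_or] at hW
    simp only [List.forall_mem_cons] at hn
    have hpos : 0 < count (Sat (A ++ cs)) :=
      count_sat_pos (by simp only [List.mem_append]; tauto)
    have h1 := clauseProd_exactProb (A ++ cs) c hn.1
    have h2 := count_add_count_not (Sat (A ++ cs)) (fun a => ∀ v ∈ c, a v = false)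
    have h3 : count (Sat (A ++ c :: cs)) =
        count (fun a => Sat (A ++ cs) a ∧ ¬ ∀ v ∈ c, a v = false) := by
      refine count_congr fun a => ?_
      rw [sat_append, sat_append]
      simp only [Sat, List.forall_mem_cons]
      push Not
      simp only [ne_eq, Bool.not_eq_false]
      tauto
    rw [h3, nodeProd, mul_assoc, ih hW.2 hn.2]
    linarith

/-- With `x = 1` only the clauses without `x` remain, with `x = 0` the shortened clauses remain as
well. Both conditions ignore `x`, so the halves cancel in the quotient. -/
theorem exactRatio_eq_nodeProd {C : MonCNF n} (hC : [] ∉ C) (hn : ∀ c ∈ C, c.Nodup) (x : Fin n) :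
    exactRatio C x =
      nodeProd (fun _ => exactProb) (C.clausesWithout x) (pinZero (C.clausesWith x) x) := by
  have hA : [] ∉ clausesWithout C x := fun h => hC (List.mem_filter.1 h).1
  have e1 : count (fun a => C.Sat a ∧ a x = true) = count (clausesWithout C x).Sat / 2 := by
    have h2 := two_mul_count (clausesWithout C x).Sat x true
      (fun a b ha => sat_update_of_forall_notMem notMem_of_mem_clausesWithout a b ha)
    have h3 : count (fun a => (clausesWithout C x).Sat a ∧ a x = true) =
        count (fun a => C.Sat a ∧ a x = true) :=
      count_congr fun a => and_congr_left fun hx => sat_clausesWithout hx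
    linarith
  have e2 : count (fun a => C.Sat a ∧ a x = false) =
      count (Sat (clausesWithout C x ++ pinZero (clausesWith C x) x)) / 2 := by
    have h2 := two_mul_count (Sat (clausesWithout C x ++ pinZero (clausesWith C x) x)) x false
      (fun a b ha => by
        refine sat_update_of_forall_notMem ?_ a b ha
        intro c hc
        rcases List.mem_append.1 hc with hc | hc
        · exact notMem_of_mem_clausesWithout c hc
        · exact notMem_of_mem_pinZero c hc)
    have h3 : count
        (fun a => Sat (clausesWithout C x ++ pinZero (clausesWith C x) x) a ∧ a x = false)
        = count (fun a => C.Sat a ∧ a x = false) := by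
      refine count_congr fun a => and_congr_left fun hx => ?_
      rw [sat_append, sat_pinZero hx, ← sat_iff_clauses]
    linarith
  have hpos := count_sat_pos hA
  by_cases hW : [] ∈ pinZero (clausesWith C x) x
  · rw [nodeProd_eq_zero _ _ _ hW, exactRatio, e2]
    have : count (Sat (clausesWithout C x ++ pinZero (clausesWith C x) x)) ≤ 0 := by
      have : count (fun _ : Fin n → Bool => False) = 0 := by simp [count]
      rw [← this]
      refine count_mono fun a ha => ?_
      obtain ⟨y, hy, -⟩ := ha [] (List.mem_append_right _ hW)
      simp at hy
    rw [le_antisymm this (count_nonneg _)]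
    simp
  · have h := nodeProd_exactProb (clausesWithout C x) (pinZero (clausesWith C x) x) hA hW (by
      intro c hc
      obtain ⟨c', hc', rfl⟩ := List.mem_map.1 hc
      exact (hn c' (List.mem_filter.1 hc').1).filter _)
    rw [exactRatio, e1, e2, ← h]
    field_simp

end MonCNF

/-! ### Analytic estimates -/

namespace CorrelationDecay

open Real

theorem hasDerivAt_tanh (x : ℝ) : HasDerivAt tanh (1 - tanh x ^ 2) x := by
  have h := (hasDerivAt_sinh x).div (hasDerivAt_cosh x) (cosh_pos x).ne'
  have e : (sinh / cosh) = tanh := by funext y; exact (tanh_eq_sinh_div_cosh y).symm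
  rw [e] at h
  have := (cosh_pos x).ne'
  have e2 : (cosh x * cosh x - sinh x * sinh x) / cosh x ^ 2 = 1 - tanh x ^ 2 := by
    rw [tanh_eq_sinh_div_cosh]
    field_simp
  exact e2 ▸ h

/-! ### Sensitivity of a product of hyperbolic tangents -/

/-- The sum over all positions of `1 - s²` times the product of the other entries. -/
def sens : List ℝ → ℝ
  | [] => 0
  | s :: l => (1 - s ^ 2) * l.prod + s * sens l

theorem sens_append (l l' : List ℝ) :
    sens (l ++ l') = sens l * l'.prod + l.prod * sens l' := by
  induction l with
  | nil => simp [sens]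
  | cons s l ih => simp only [List.cons_append, sens, ih, List.prod_append, List.prod_cons]; ring

theorem prod_mem_Icc {b : ℝ} (hb : b ≤ 1) (l : List ℝ) (hne : l ≠ [])
    (h : ∀ s ∈ l, 0 ≤ s ∧ s ≤ b) : 0 ≤ l.prod ∧ l.prod ≤ b := by
  induction l with
  | nil => exact absurd rfl hne
  | cons s l ih =>
    simp only [List.forall_mem_cons] at h
    rcases eq_or_ne l [] with rfl | hl
    · simpa using h.1
    · have := ih hl h.2
      rw [List.prod_cons]
      exact ⟨mul_nonneg h.1.1 this.1, by nlinarith [h.1.1, h.1.2, this.1, this.2]⟩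

/-- Halving a clause, rounded down, lowers `⌈log₄(w+1)⌉` by at most one, so one factor `0.981` per
halving is enough. -/
theorem clog_half_le (m : ℕ) : Nat.clog 4 (m + 1) ≤ Nat.clog 4 (m / 2 + 1) + 1 := by
  rw [Nat.clog_le_iff_le_pow (by norm_num), pow_succ]
  have := Nat.le_pow_clog (b := 4) (by norm_num) (m / 2 + 1)
  omega

/-- Split the list into halves with products `A` and `B`. The induction hypotheses combine to `(1 -
A²) B + A (1 - B²) = (A + B) (1 - A B)`, and `A + B ≤ 0.981 (1 + A B)` turns this into `0.981 (1 -
(A B)²)`. The factor `0.981` on the left makes a single entry an equality, since `⌈log₄ 2⌉ = 1`. -/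
theorem sens_le (l : List ℝ) (hne : l ≠ []) (h : ∀ s ∈ l, 0 ≤ s ∧ s ≤ 0.7072) :
    0.981 * sens l ≤ 0.981 ^ Nat.clog 4 (l.length + 1) * (1 - l.prod ^ 2) := by
  induction hk : l.length using Nat.strong_induction_on generalizing l with
  | _ k ih =>
    subst hk
    by_cases h1 : l.length = 1
    · obtain ⟨s, rfl⟩ := List.length_eq_one_iff.1 h1
      have : Nat.clog 4 2 = 1 := Nat.clog_eq_one le_rfl (by norm_num)
      simp [sens, this]
    · have h0 : 0 < l.length := List.length_pos_iff.2 hne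
      set m := l.length / 2 with hm
      have hl := List.take_append_drop m l
      set l1 := l.take m with hl1
      set l2 := l.drop m with hl2
      have e1 : l1.length = m := by rw [hl1, List.length_take]; omega
      have e2 : l2.length = l.length - m := by rw [hl2, List.length_drop]
      have n1 : l1 ≠ [] := by rw [← List.length_pos_iff]; omega
      have n2 : l2 ≠ [] := by rw [← List.length_pos_iff]; omega
      have b1 : ∀ s ∈ l1, 0 ≤ s ∧ s ≤ 0.7072 := fun s hs => h s (List.mem_of_mem_take hs)
      have b2 : ∀ s ∈ l2, 0 ≤ s ∧ s ≤ 0.7072 := fun s hs => h s (List.mem_of_mem_drop hs)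
      have i1 := ih l1.length (by omega) l1 n1 b1 rfl
      have i2 := ih l2.length (by omega) l2 n2 b2 rfl
      obtain ⟨A0, A1⟩ := prod_mem_Icc (by norm_num) l1 n1 b1
      obtain ⟨B0, B1⟩ := prod_mem_Icc (by norm_num) l2 n2 b2
      have c1 : (0.981 : ℝ) ^ Nat.clog 4 (l2.length + 1) ≤ 0.981 ^ Nat.clog 4 (m + 1) :=
        pow_le_pow_of_le_one (by norm_num) (by norm_num) (Nat.clog_mono_right _ (by omega))
      have c2 : (0.981 : ℝ) ^ (Nat.clog 4 (m + 1) + 1) ≤ 0.981 ^ Nat.clog 4 (l.length + 1) :=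
        pow_le_pow_of_le_one (by norm_num) (by norm_num) (clog_half_le _)
      rw [e1] at i1
      have i2' := i2.trans (mul_le_mul_of_nonneg_right c1 (by nlinarith))
      rw [← hl, sens_append, List.prod_append, hl]
      generalize l1.prod = A at *
      generalize l2.prod = B at *
      generalize sens l1 = S at *
      generalize sens l2 = T at *
      rw [pow_succ] at c2
      have hq : 0 ≤ (0.981 : ℝ) ^ Nat.clog 4 (m + 1) := by positivity
      generalize (0.981 : ℝ) ^ Nat.clog 4 (m + 1) = q at *
      have hAB : A * B ≤ 0.5002 := by nlinarith
      -- Here the bound `0.7072 ≈ 1/√2` is used: by the addition theorem of `tanh`, two entries of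
      -- that size give about `0.943`, which is below `0.981`.
      have hs : A + B ≤ 0.981 * (1 + A * B) := by
        nlinarith [mul_nonneg (sub_nonneg.2 A1) (sub_nonneg.2 B1), mul_nonneg A0 B0]
      calc 0.981 * (S * B + A * T) = (0.981 * S) * B + A * (0.981 * T) := by ring
        _ ≤ (q * (1 - A ^ 2)) * B + A * (q * (1 - B ^ 2)) := by gcongr
        _ = q * ((1 - A * B) * (A + B)) := by ring
        _ ≤ q * ((1 - A * B) * (0.981 * (1 + A * B))) := by
          gcongr; linarith
        _ = (q * 0.981) * (1 - (A * B) ^ 2) := by ring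
        _ ≤ _ := by
          apply mul_le_mul_of_nonneg_right c2
          nlinarith [mul_nonneg A0 B0]

/-! ### Interpolation between truncated and exact potentials -/

/-- The point at time `z` on the segment between the two components of `p`. -/
def segPt (p : ℝ × ℝ) (z : ℝ) : ℝ := p.1 + z * (p.2 - p.1)

/-- The values of `tanh` at time `z` on a list of segments. -/
noncomputable def tanhs (l : List (ℝ × ℝ)) (z : ℝ) : List ℝ := l.map fun p => tanh (segPt p z)

/-- The value of the recursion at time `z` on a list of lists of segments. -/
noncomputable def nodeVal (W : List (List (ℝ × ℝ))) (z : ℝ) : ℝ :=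
  (W.map fun l => 1 - (tanhs l z).prod ^ 2).prod

theorem tanh_nonneg {x : ℝ} (h : 0 ≤ x) : 0 ≤ tanh x := by
  rw [tanh_eq_sinh_div_cosh]
  exact div_nonneg (sinh_nonneg_iff.2 h) (cosh_pos x).le

/-- The value of `tanh` at `arsinh 1` is `1/√2`, which corresponds to conditional probabilities of
at most `1/2`. -/
theorem tanh_le_of_le_arsinh_one {x : ℝ} (h0 : 0 ≤ x) (h : x ≤ arsinh 1) : tanh x ≤ 0.7072 := by
  rw [tanh_eq_sinh_div_cosh, div_le_iff₀ (cosh_pos x)]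
  have h1 : sinh x ≤ 1 := by rw [← sinh_arsinh 1]; exact sinh_le_sinh.2 h
  have h2 := sinh_nonneg_iff.2 h0
  have h3 := cosh_sq x
  have h4 := cosh_pos x
  by_contra hc
  push Not at hc
  nlinarith

theorem segPt_mem {p : ℝ × ℝ} {b z : ℝ} (hz : 0 ≤ z ∧ z ≤ 1) (h1 : 0 ≤ p.1 ∧ p.1 ≤ b)
    (h2 : 0 ≤ p.2 ∧ p.2 ≤ b) : 0 ≤ segPt p z ∧ segPt p z ≤ b := by
  unfold segPt
  constructor <;> nlinarith [mul_nonneg hz.1 h2.1, mul_nonneg (sub_nonneg.2 hz.2) h1.1,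
    mul_nonneg hz.1 (sub_nonneg.2 h2.2), mul_nonneg (sub_nonneg.2 hz.2) (sub_nonneg.2 h1.2)]

/-- Chain and product rule; as `tanh' = 1 - tanh²`, the weights that appear are exactly those in
`sens`. -/
theorem hasDerivAt_tanhs_prod (l : List (ℝ × ℝ)) (z δ : ℝ)
    (hs : ∀ p ∈ l, 0 ≤ segPt p z) (hδ : ∀ p ∈ l, |p.2 - p.1| ≤ δ) :
    ∃ D, HasDerivAt (fun z => (tanhs l z).prod) D z ∧ |D| ≤ δ * sens (tanhs l z) := by
  induction l with
  | nil => exact ⟨0, by simpa [tanhs] using hasDerivAt_const z (1 : ℝ), by simp [sens, tanhs]⟩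
  | cons p l ih =>
    simp only [List.forall_mem_cons] at hs hδ
    obtain ⟨D, hD, hDb⟩ := ih hs.2 hδ.2
    have h1 : HasDerivAt (fun z => segPt p z) (p.2 - p.1) z := by
      simpa [segPt] using ((hasDerivAt_id z).mul_const (p.2 - p.1)).const_add p.1
    have h2 := (hasDerivAt_tanh (segPt p z)).comp z h1
    refine ⟨_, h2.mul hD, ?_⟩
    have hprod : 0 ≤ (tanhs l z).prod := List.prod_nonneg (by
      intro s hs'
      obtain ⟨q, hq, rfl⟩ := List.mem_map.1 hs'
      exact tanh_nonneg (hs.2 q hq))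
    have ht := tanh_nonneg hs.1
    have ht1 : 0 ≤ 1 - tanh (segPt p z) ^ 2 := by
      have := Real.tanh_sq_lt_one (segPt p z)
      linarith
    have e : tanhs (p :: l) z = tanh (segPt p z) :: tanhs l z := rfl
    rw [e, sens]
    simp only [Function.comp]
    calc |(1 - tanh (segPt p z) ^ 2) * (p.2 - p.1) * (tanhs l z).prod + tanh (segPt p z) * D|
        ≤ |(1 - tanh (segPt p z) ^ 2) * (p.2 - p.1) * (tanhs l z).prod| + |tanh (segPt p z) * D| :=
          abs_add_le _ _
      _ = (1 - tanh (segPt p z) ^ 2) * |p.2 - p.1| * (tanhs l z).prod + tanh (segPt p z) * |D| := by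
          rw [abs_mul, abs_mul, abs_mul, abs_of_nonneg ht1, abs_of_nonneg hprod, abs_of_nonneg ht]
      _ ≤ (1 - tanh (segPt p z) ^ 2) * δ * (tanhs l z).prod +
          tanh (segPt p z) * (δ * sens (tanhs l z)) := by
          gcongr; exact hδ.1
      _ = _ := by ring

/-- The hypotheses on a list of segments: they lie in `[0, arsinh 1]`, and their lengths are
bounded in terms of `η` and of the length of the list. -/
structure Admissible (η : ℝ) (l : List (ℝ × ℝ)) : Prop where
  ne : l ≠ []
  left : ∀ p ∈ l, 0 ≤ p.1 ∧ p.1 ≤ arsinh 1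
  right : ∀ p ∈ l, 0 ≤ p.2 ∧ p.2 ≤ arsinh 1
  len : ∀ p ∈ l, |p.2 - p.1| * 0.981 ^ Nat.clog 4 (l.length + 1) ≤ η

theorem Admissible.tanhs_mem {η : ℝ} {l : List (ℝ × ℝ)} (h : Admissible η l) {z : ℝ}
    (hz : 0 ≤ z ∧ z ≤ 1) : ∀ s ∈ tanhs l z, 0 ≤ s ∧ s ≤ 0.7072 := by
  intro s hs
  obtain ⟨p, hp, rfl⟩ := List.mem_map.1 hs
  have := segPt_mem hz (h.left p hp) (h.right p hp)
  exact ⟨tanh_nonneg this.1, tanh_le_of_le_arsinh_one this.1 this.2⟩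

theorem Admissible.prod_mem {η : ℝ} {l : List (ℝ × ℝ)} (h : Admissible η l) {z : ℝ}
    (hz : 0 ≤ z ∧ z ≤ 1) : 0 ≤ (tanhs l z).prod ∧ (tanhs l z).prod ≤ 0.7072 :=
  prod_mem_Icc (by norm_num) _ (by simpa [tanhs] using h.ne) (h.tanhs_mem hz)

theorem Admissible.hasDerivAt {η : ℝ} {l : List (ℝ × ℝ)} (h : Admissible η l) {z : ℝ}
    (hz : 0 ≤ z ∧ z ≤ 1) : ∃ D, HasDerivAt (fun z => (tanhs l z).prod) D z ∧
      0.981 * |D| ≤ η * (1 - (tanhs l z).prod ^ 2) := by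
  have hq : 0 < (0.981 : ℝ) ^ Nat.clog 4 (l.length + 1) := by positivity
  obtain ⟨D, h1, h2⟩ := hasDerivAt_tanhs_prod l z (η / 0.981 ^ Nat.clog 4 (l.length + 1))
    (fun p hp => (segPt_mem hz (h.left p hp) (h.right p hp)).1)
    (fun p hp => by rw [le_div_iff₀ hq]; exact h.len p hp)
  have hη : 0 ≤ η := by
    obtain ⟨p, hp⟩ := List.exists_mem_of_ne_nil _ h.ne
    exact (mul_nonneg (abs_nonneg _) hq.le).trans (h.len p hp)
  refine ⟨D, h1, ?_⟩
  have h3 := sens_le (tanhs l z) (by simpa [tanhs] using h.ne) (h.tanhs_mem hz)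
  have e : (tanhs l z).length = l.length := by simp [tanhs]
  rw [e] at h3
  calc 0.981 * |D| ≤ 0.981 * (η / 0.981 ^ Nat.clog 4 (l.length + 1) * sens (tanhs l z)) := by gcongr
    _ = η / 0.981 ^ Nat.clog 4 (l.length + 1) * (0.981 * sens (tanhs l z)) := by ring
    _ ≤ η / 0.981 ^ Nat.clog 4 (l.length + 1) *
        (0.981 ^ Nat.clog 4 (l.length + 1) * (1 - (tanhs l z).prod ^ 2)) := by gcongr
    _ = _ := by field_simp

theorem nodeVal_pos {η : ℝ} {W : List (List (ℝ × ℝ))} (h : ∀ l ∈ W, Admissible η l) {z : ℝ}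
    (hz : 0 ≤ z ∧ z ≤ 1) : 0 < nodeVal W z := by
  refine List.prod_pos ?_
  intro s hs
  obtain ⟨l, hl, rfl⟩ := List.mem_map.1 hs
  have := (h l hl).prod_mem hz
  nlinarith

/-- In the logarithmic derivative of `∏ (1 - P²)` each clause contributes `2 P P' / (1 - P²)`. The
bound of `Admissible.hasDerivAt` carries the factor `1 - P²`, which cancels the denominator and
leaves the plain sum of the `P`. -/
theorem nodeVal_hasDerivAt {η : ℝ} {W : List (List (ℝ × ℝ))} (h : ∀ l ∈ W, Admissible η l) {z : ℝ}
    (hz : 0 ≤ z ∧ z ≤ 1) : ∃ D, HasDerivAt (nodeVal W) D z ∧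
      0.981 * |D| ≤ 2 * η * nodeVal W z * (W.map fun l => (tanhs l z).prod).sum := by
  induction W with
  | nil =>
    refine ⟨0, ?_, by simp⟩
    have : nodeVal [] = fun _ => 1 := by funext z; simp [nodeVal]
    rw [this]
    exact hasDerivAt_const z 1
  | cons l W ih =>
    have hW := List.forall_mem_cons.1 h
    obtain ⟨D, hD, hDb⟩ := ih hW.2
    obtain ⟨E, hE, hEb⟩ := hW.1.hasDerivAt hz
    have hV := nodeVal_pos hW.2 hz
    have hp := hW.1.prod_mem hz
    have e : nodeVal (l :: W) = fun z => (1 - (tanhs l z).prod ^ 2) * nodeVal W z := by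
      funext z; simp [nodeVal]
    rw [e]
    refine ⟨_, ((hE.pow 2).const_sub 1).mul hD, ?_⟩
    simp only [List.map_cons, List.sum_cons]
    set P := (tanhs l z).prod
    set V := nodeVal W z
    have h1 : 0 ≤ 1 - P ^ 2 := by nlinarith
    calc 0.981 * |-(((2 : ℕ) : ℝ) * P ^ (2 - 1) * E) * V + (1 - P ^ 2) * D|
        ≤ 0.981 * (|-(((2 : ℕ) : ℝ) * P ^ (2 - 1) * E) * V| + |(1 - P ^ 2) * D|) := by
          gcongr; exact abs_add_le _ _
      _ = 2 * P * V * (0.981 * |E|) + (1 - P ^ 2) * (0.981 * |D|) := by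
          rw [abs_mul, abs_neg, abs_mul, abs_mul, abs_mul, abs_of_nonneg h1, abs_of_pos hV,
            pow_one, abs_of_nonneg hp.1]
          norm_num
          ring
      _ ≤ 2 * P * V * (η * (1 - P ^ 2)) + (1 - P ^ 2) * (2 * η * V *
          (W.map fun l => (tanhs l z).prod).sum) := by
          gcongr
          exact mul_nonneg (mul_nonneg (by norm_num) hp.1) hV.le
      _ = _ := by ring

/-! ### The contraction inequality -/

/-- The quotient `16 p⁴ (1 - p) / (1 + p⁴)` is maximal where `p⁵ + 5 p = 4`, that is at `p ≈
0.7519`, with value about `0.9615 < 0.981²`. This extremal problem determines the constant `0.981`;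
the squares in the certificate are centred at the maximum. -/
theorem quintic_bound (p : ℝ) (h : 0 ≤ p) : 16 * p ^ 4 * (1 - p) ≤ 0.981 ^ 2 * (1 + p ^ 4) := by
  nlinarith [mul_nonneg (pow_nonneg h 3) (sq_nonneg (p - 0.7519)),
    mul_nonneg (pow_nonneg h 2) (sq_nonneg (p - 0.7519)), mul_nonneg h (sq_nonneg (p - 0.7519)),
    sq_nonneg (p - 0.7519)]

/-- With at most four clauses, the recursion contracts by the factor `0.981`. -/
theorem contraction_four (a b c d : ℝ) (ha : 0 ≤ a ∧ a ≤ 0.7072) (hb : 0 ≤ b ∧ b ≤ 0.7072)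
    (hc : 0 ≤ c ∧ c ≤ 0.7072) (hd : 0 ≤ d ∧ d ≤ 0.7072) :
    (a + b + c + d) ^ 2 * ((1 - a ^ 2) * (1 - b ^ 2) * (1 - c ^ 2) * (1 - d ^ 2)) ≤
      0.981 ^ 2 * (1 + (1 - a ^ 2) * (1 - b ^ 2) * (1 - c ^ 2) * (1 - d ^ 2)) := by
  have sq : ∀ x : ℝ, 0 ≤ x ∧ x ≤ 0.7072 → 0 ≤ 1 - x ^ 2 := fun x hx => by nlinarith
  -- Symmetrization: with `S` the mean of the `1 - a²`, Cauchy-Schwarz bounds the squared sum by `16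
  -- (1 - S)`, and the inequality of the means bounds the product by `S ^ 4`.
  set S := 1 - (a ^ 2 + b ^ 2 + c ^ 2 + d ^ 2) / 4 with hS
  have hsum : (a + b + c + d) ^ 2 ≤ 16 * (1 - S) := by
    rw [hS]
    nlinarith [sq_nonneg (a - b), sq_nonneg (a - c), sq_nonneg (a - d), sq_nonneg (b - c),
      sq_nonneg (b - d), sq_nonneg (c - d)]
  have hS0 : 0 ≤ S := by linarith [sq a ha, sq b hb, sq c hc, sq d hd]
  have hprod : (1 - a ^ 2) * (1 - b ^ 2) * (1 - c ^ 2) * (1 - d ^ 2) ≤ S ^ 4 := by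
    have h1 : (1 - a ^ 2) * (1 - b ^ 2) ≤ (1 - (a ^ 2 + b ^ 2) / 2) ^ 2 := by
      nlinarith [sq_nonneg (a ^ 2 - b ^ 2)]
    have h2 : (1 - c ^ 2) * (1 - d ^ 2) ≤ (1 - (c ^ 2 + d ^ 2) / 2) ^ 2 := by
      nlinarith [sq_nonneg (c ^ 2 - d ^ 2)]
    have h3 : (1 - (a ^ 2 + b ^ 2) / 2) * (1 - (c ^ 2 + d ^ 2) / 2) ≤ S ^ 2 := by
      rw [hS]
      nlinarith [sq_nonneg (a ^ 2 + b ^ 2 - c ^ 2 - d ^ 2)]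
    have h4 : 0 ≤ (1 - (a ^ 2 + b ^ 2) / 2) * (1 - (c ^ 2 + d ^ 2) / 2) :=
      mul_nonneg (by linarith [sq a ha, sq b hb]) (by linarith [sq c hc, sq d hd])
    calc (1 - a ^ 2) * (1 - b ^ 2) * (1 - c ^ 2) * (1 - d ^ 2)
        = ((1 - a ^ 2) * (1 - b ^ 2)) * ((1 - c ^ 2) * (1 - d ^ 2)) := by ring
      _ ≤ (1 - (a ^ 2 + b ^ 2) / 2) ^ 2 * (1 - (c ^ 2 + d ^ 2) / 2) ^ 2 := by
          gcongr
          · exact mul_nonneg (sq c hc) (sq d hd)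
      _ = ((1 - (a ^ 2 + b ^ 2) / 2) * (1 - (c ^ 2 + d ^ 2) / 2)) ^ 2 := by ring
      _ ≤ (S ^ 2) ^ 2 := by gcongr
      _ = S ^ 4 := by ring
  have hp0 : 0 ≤ (1 - a ^ 2) * (1 - b ^ 2) * (1 - c ^ 2) * (1 - d ^ 2) :=
    mul_nonneg (mul_nonneg (mul_nonneg (sq a ha) (sq b hb)) (sq c hc)) (sq d hd)
  generalize (1 - a ^ 2) * (1 - b ^ 2) * (1 - c ^ 2) * (1 - d ^ 2) = p at *
  have h1 : (a + b + c + d) ^ 2 * p ≤ 16 * (1 - S) * p := by gcongr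
  have h2 := quintic_bound S hS0
  -- After moving terms to one side, the product `p` has the coefficient `16 (1 - S) - 0.981²`. If
  -- it is positive, `p` may be replaced by its upper bound `S ^ 4`; otherwise the claim is
  -- immediate.
  by_cases h16 : 16 * (1 - S) ≤ 0.981 ^ 2
  · nlinarith
  · push Not at h16
    have : (16 * (1 - S) - 0.981 ^ 2) * p ≤ (16 * (1 - S) - 0.981 ^ 2) * S ^ 4 := by
      gcongr
    nlinarith

/-- Missing clauses are padded with the value `0`, which adds nothing to the sum and contributes the
factor `1` to the product. -/
theorem nodeVal_contraction {η : ℝ} {W : List (List (ℝ × ℝ))} (h : ∀ l ∈ W, Admissible η l)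
    (hW : W.length ≤ 4) {z : ℝ} (hz : 0 ≤ z ∧ z ≤ 1) :
    (W.map fun l => (tanhs l z).prod).sum ^ 2 * nodeVal W z ≤ 0.981 ^ 2 * (1 + nodeVal W z) := by
  have key := contraction_four
  have h0 : (0 : ℝ) ≤ 0 ∧ (0 : ℝ) ≤ 0.7072 := by norm_num
  match W, hW, h with
  | [], _, _ => simp [nodeVal]; norm_num
  | [l], _, h =>
    simp only [List.forall_mem_cons] at h
    have := key _ 0 0 0 (h.1.prod_mem hz) h0 h0 h0
    simpa [nodeVal] using this
  | [l, l'], _, h =>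
    simp only [List.forall_mem_cons] at h
    have := key _ _ 0 0 (h.1.prod_mem hz) (h.2.1.prod_mem hz) h0 h0
    simpa [nodeVal] using this
  | [l, l', l''], _, h =>
    simp only [List.forall_mem_cons] at h
    have := key _ _ _ 0 (h.1.prod_mem hz) (h.2.1.prod_mem hz) (h.2.2.1.prod_mem hz) h0
    simpa [nodeVal, add_assoc, mul_assoc] using this
  | [l, l', l'', l3], _, h =>
    simp only [List.forall_mem_cons] at h
    have := key _ _ _ _ (h.1.prod_mem hz) (h.2.1.prod_mem hz) (h.2.2.1.prod_mem hz)
      (h.2.2.2.1.prod_mem hz)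
    simpa [nodeVal, add_assoc, mul_assoc] using this
  | _ :: _ :: _ :: _ :: _ :: _, hW, _ => simp at hW; omega

/-- Mean value inequality on `[0, 1]`. The derivative of `arsinh √V` is `V' / (2 √V √(1+V))`, so the
bound `|V'| ≤ 2 η V S / 0.981` becomes `η S √(V/(1+V)) / 0.981`, which is where the hypothesis on
`S² V` enters. -/
theorem arsinh_sqrt_nodeVal_sub_le {η κ : ℝ} {W : List (List (ℝ × ℝ))}
    (h : ∀ l ∈ W, Admissible η l) (hη : 0 ≤ η) (hκ : 0 ≤ κ)
    (hc : ∀ z : ℝ, 0 ≤ z ∧ z ≤ 1 →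
      (W.map fun l => (tanhs l z).prod).sum ^ 2 * nodeVal W z ≤ κ ^ 2 * (1 + nodeVal W z)) :
    0.981 * |arsinh √(nodeVal W 1) - arsinh √(nodeVal W 0)| ≤ κ * η := by
  have hd : ∀ z : ℝ, 0 ≤ z ∧ z ≤ 1 → ∃ D, HasDerivAt (fun z => arsinh √(nodeVal W z)) D z ∧
      |D| ≤ κ * η / 0.981 := by
    intro z hz
    obtain ⟨D, hD, hDb⟩ := nodeVal_hasDerivAt h hz
    have hV := nodeVal_pos h hz
    refine ⟨_, (hD.sqrt hV.ne').arsinh, ?_⟩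
    have hcz := hc z hz
    have hS : 0 ≤ (W.map fun l => (tanhs l z).prod).sum := by
      refine List.sum_nonneg ?_
      intro s hs
      obtain ⟨l, hl, rfl⟩ := List.mem_map.1 hs
      exact ((h l hl).prod_mem hz).1
    set S := (W.map fun l => (tanhs l z).prod).sum
    generalize nodeVal W z = V at *
    rw [Real.sq_sqrt hV.le, smul_eq_mul, le_div_iff₀ (by norm_num)]
    have hs1 : 0 < √V := Real.sqrt_pos.2 hV
    have hs2 : 0 < √(1 + V) := Real.sqrt_pos.2 (by linarith)
    have e1 : √V ^ 2 = V := Real.sq_sqrt hV.le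
    have e2 : √(1 + V) ^ 2 = 1 + V := Real.sq_sqrt (by linarith)
    have hk : S * √V ≤ κ * √(1 + V) := by
      refine le_of_sq_le_sq ?_ (by positivity)
      rw [mul_pow, mul_pow, e1, e2]; exact hcz
    rw [abs_mul, abs_div, abs_of_pos (inv_pos.2 hs2), abs_of_pos (by positivity : 0 < 2 * √V)]
    have : 0.981 * |D| ≤ 2 * √V * √(1 + V) * (κ * η) := by
      calc 0.981 * |D| ≤ 2 * η * V * S := hDb
        _ = 2 * η * √V * (S * √V) := by linear_combination (-(2 * η * S)) * e1
        _ ≤ 2 * η * √V * (κ * √(1 + V)) := by gcongr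
        _ = _ := by ring
    calc (√(1 + V))⁻¹ * (|D| / (2 * √V)) * 0.981 = (0.981 * |D|) / (2 * √V * √(1 + V)) := by
          field_simp
      _ ≤ κ * η := by rw [div_le_iff₀ (by positivity)]; linarith
  choose! D hD hDb using hd
  have := norm_image_sub_le_of_norm_deriv_le_segment_01'
    (f := fun z => arsinh √(nodeVal W z)) (f' := D) (C := κ * η / 0.981)
    (fun z hz => (hD z hz).hasDerivWithinAt) (fun z hz => hDb z ⟨hz.1, hz.2.le⟩)
  rw [Real.norm_eq_abs, le_div_iff₀ (by norm_num)] at this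
  linarith

end CorrelationDecay

namespace MonCNF

variable {n : ℕ}

open CorrelationDecay Real

/-! ### Degrees -/

/-- The number of clauses that contain `x`. -/
def deg (C : MonCNF n) (x : Fin n) : ℕ := (C.clausesWith x).length

theorem deg_append (C D : MonCNF n) (x : Fin n) : deg (C ++ D) x = deg C x + deg D x := by
  simp [deg, clausesWith]

theorem deg_cons (c : List (Fin n)) (C : MonCNF n) (x : Fin n) :
    deg (c :: C) x = (if x ∈ c then 1 else 0) + deg C x := by
  unfold deg clausesWith
  rw [List.filter_cons]
  split_ifs with h1 h2 h2 <;> simp_all [add_comm]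

theorem deg_pinZero_le (C : MonCNF n) (x y : Fin n) : deg (pinZero C x) y ≤ deg C y := by
  induction C with
  | nil => simp [pinZero]
  | cons c C ih =>
    have h : pinZero (c :: C) x = c.filter (fun y => y ≠ x) :: pinZero C x := rfl
    rw [h, deg_cons, deg_cons]
    refine add_le_add ?_ ih
    split_ifs with h1 h2
    · exact le_rfl
    · exact absurd (List.mem_filter.1 h1).1 h2
    · exact Nat.zero_le _
    · exact le_rfl

theorem deg_clauses (C : MonCNF n) (x y : Fin n) :
    deg (clausesWithout C x) y + deg (clausesWith C x) y = deg C y := by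
  induction C with
  | nil => rfl
  | cons c C ih =>
    rw [deg_cons, ← ih]
    by_cases h : x ∈ c
    · have h1 : clausesWithout (c :: C) x = clausesWithout C x := by simp [clausesWithout, h]
      have h2 : clausesWith (c :: C) x = c :: clausesWith C x := by simp [clausesWith, h]
      rw [h1, h2, deg_cons]; omega
    · have h1 : clausesWithout (c :: C) x = c :: clausesWithout C x := by simp [clausesWithout, h]
      have h2 : clausesWith (c :: C) x = clausesWith C x := by simp [clausesWith, h]
      rw [h1, h2, deg_cons]; omega

/-- No clause contains a variable twice, and every variable is in at most five clauses. -/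
structure ReadFive (C : MonCNF n) : Prop where
  nodup : ∀ c ∈ C, c.Nodup
  read : ∀ x, deg C x ≤ 5

theorem IsRead.readFive {C : MonCNF n} (h : C.IsRead 5) : C.ReadFive := ⟨h.nodup, h.read⟩

theorem ReadFive.pinZero {C : MonCNF n} (h : C.ReadFive) (x : Fin n) : (C.pinZero x).ReadFive where
  nodup := by
    intro c hc
    obtain ⟨c', hc', rfl⟩ := List.mem_map.1 hc
    exact (h.nodup c' hc').filter _
  read y := (deg_pinZero_le C x y).trans (h.read y)

theorem ReadFive.node {C : MonCNF n} (h : C.ReadFive) (x : Fin n) :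
    ReadFive (C.clausesWithout x ++ (C.clausesWith x).pinZero x) where
  nodup := by
    intro c hc
    rcases List.mem_append.1 hc with hc | hc
    · exact h.nodup c (List.mem_filter.1 hc).1
    · obtain ⟨c', hc', rfl⟩ := List.mem_map.1 hc
      exact (h.nodup c' (List.mem_filter.1 hc').1).filter _
  read y := by
    rw [deg_append]
    have := deg_pinZero_le (C.clausesWith x) x y
    have := deg_clauses C x y
    have := h.read y
    omega

/-- Why degree five at the root becomes degree four below it: a variable of `c` loses the occurrence
in `c` itself when `c` is removed. -/
theorem ReadFive.of_cons {A cs : MonCNF n} {c : List (Fin n)} (h : ReadFive (A ++ c :: cs)) :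
    ReadFive (A ++ cs) ∧ ∀ v ∈ c, deg (A ++ cs) v ≤ 4 := by
  refine ⟨⟨fun c' hc' => h.nodup c' ?_, fun y => ?_⟩, fun v hv => ?_⟩
  · simp only [List.mem_append, List.mem_cons] at hc' ⊢; tauto
  · have := h.read y
    rw [deg_append, deg_cons] at this
    rw [deg_append]; omega
  · have := h.read v
    rw [deg_append, deg_cons, if_pos hv] at this
    rw [deg_append]; omega

theorem ReadFive.clausesWithout {C : MonCNF n} (h : C.ReadFive) (x : Fin n) :
    (C.clausesWithout x).ReadFive where
  nodup c hc := h.nodup c (List.mem_filter.1 hc).1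
  read y := by
    have := deg_clauses C x y
    have := h.read y
    omega

theorem nil_notMem_node {C : MonCNF n} (hC : [] ∉ C) (x : Fin n)
    (hW : [] ∉ (C.clausesWith x).pinZero x) :
    [] ∉ C.clausesWithout x ++ (C.clausesWith x).pinZero x := by
  rw [List.mem_append, not_or]
  exact ⟨fun h => hC (List.mem_filter.1 h).1, hW⟩

/-! ### Bounds for the truncated ratio -/

theorem clauseProd_mem_Icc {t : MonCNF n → Fin n → ℚ} (ht : ∀ D v, 0 ≤ t D v ∧ t D v ≤ 1)
    (D : MonCNF n) (vs : List (Fin n)) : 0 ≤ clauseProd t D vs ∧ clauseProd t D vs ≤ 1 := by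
  induction vs generalizing D with
  | nil => simp [clauseProd]
  | cons v vs ih =>
    have h1 := ht D v
    have h2 := ih (pinZero D v)
    exact ⟨mul_nonneg h1.1 h2.1, mul_le_one₀ h1.2 h2.1 h2.2⟩

theorem nodeProd_mem_Icc {t : ℕ → MonCNF n → Fin n → ℚ}
    (ht : ∀ w, w ≠ 0 → ∀ D v, 0 ≤ t w D v ∧ t w D v ≤ 1)
    (A W : MonCNF n) : 0 ≤ nodeProd t A W ∧ nodeProd t A W ≤ 1 := by
  induction W with
  | nil => simp [nodeProd]
  | cons c cs ih =>
    rcases eq_or_ne c [] with rfl | hc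
    · simp [nodeProd, clauseProd]
    · have h1 := clauseProd_mem_Icc (ht c.length (by simpa using hc)) (A ++ cs) c
      exact ⟨mul_nonneg (by linarith) ih.1, mul_le_one₀ (by linarith) ih.1 ih.2⟩

theorem clog_succ_pos {w : ℕ} (hw : w ≠ 0) : 0 < Nat.clog 4 (w + 1) :=
  Nat.clog_pos (by norm_num) (by omega)

theorem ratio_mem_Icc (C : MonCNF n) (x : Fin n) (L : ℕ) :
    0 ≤ ratio C x L ∧ ratio C x L ≤ 1 := by
  induction L using Nat.strong_induction_on generalizing C x with
  | _ L ih =>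
    rw [ratio_eq_nodeProd]
    refine nodeProd_mem_Icc (fun w hw D v => ?_) _ _
    unfold truncProb
    split_ifs with hL
    · simp
    · have := ih (L - Nat.clog 4 (w + 1)) (by have := clog_succ_pos hw; omega) D v
      exact ⟨div_nonneg this.1 (by linarith), div_le_one_of_le₀ (by linarith) (by linarith)⟩

/-! ### Decay of the truncation error -/

/-- The potential of a ratio. -/
noncomputable def potential (r : ℚ) : ℝ := arsinh √(r : ℝ)

theorem potential_mem {r : ℚ} (h : 0 ≤ r ∧ r ≤ 1) :
    0 ≤ potential r ∧ potential r ≤ arsinh 1 := by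
  unfold potential
  constructor
  · exact arsinh_nonneg_iff.2 (Real.sqrt_nonneg _)
  · rw [arsinh_le_arsinh, Real.sqrt_le_one]
    exact_mod_cast h.2

theorem tanh_potential_sq {r : ℚ} (h : 0 ≤ r) :
    tanh (potential r) ^ 2 = ((r / (1 + r) : ℚ) : ℝ) := by
  have : (0 : ℝ) ≤ r := by exact_mod_cast h
  rw [potential, tanh_arsinh, div_pow, Real.sq_sqrt this, Real.sq_sqrt (by linarith)]
  push_cast
  rfl

theorem arsinh_one_le_one : arsinh 1 ≤ 1 := by
  rw [← sinh_le_sinh, sinh_arsinh]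
  exact Real.self_le_sinh_iff.2 zero_le_one

theorem abs_potential_sub_le_one {r s : ℚ} (hr : 0 ≤ r ∧ r ≤ 1) (hs : 0 ≤ s ∧ s ≤ 1) :
    |potential r - potential s| ≤ 1 := by
  have h1 := potential_mem hr
  have h2 := potential_mem hs
  have h3 := arsinh_one_le_one
  rw [abs_le]; constructor <;> linarith

theorem exactRatio_mem_Icc (C : MonCNF n) (x : Fin n) : 0 ≤ exactRatio C x ∧ exactRatio C x ≤ 1 :=
  ⟨exactRatio_nonneg C x, exactRatio_le_one C x⟩

/-- An empty clause created by pinning `v` comes from the unit clause `v`. In that case the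
truncated and the exact ratio at `v` are both `0`. -/
theorem nil_mem_of_nil_mem_pinZero {D : MonCNF n} {v : Fin n} (hD : [] ∉ D)
    (h : [] ∈ pinZero D v) : [] ∈ pinZero (clausesWith D v) v := by
  obtain ⟨c, hc, he⟩ := List.mem_map.1 h
  refine List.mem_map.2 ⟨c, List.mem_filter.2 ⟨hc, ?_⟩, he⟩
  by_contra hv
  simp only [decide_eq_true_eq] at hv
  have : c.filter (fun y => y ≠ v) = c := by
    rw [List.filter_eq_self]
    intro y hy
    simpa using ne_of_mem_of_not_mem hy hv
  rw [this] at he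
  exact hD (he ▸ hc)

/-- Encodes one clause as segments running from the truncated potential at time `0` to the exact one
at time `1`, so that both clause products are squares of products of `tanh` values. -/
theorem exists_segments_clause (L : ℕ) (δ : ℝ) (hδ : 0 ≤ δ)
    (h : ∀ (D : MonCNF n) (v : Fin n), [] ∉ D → D.ReadFive → deg D v ≤ 4 →
      |potential (exactRatio D v) - potential (ratio D v L)| ≤ δ)
    (D : MonCNF n) (vs : List (Fin n)) (hD : [] ∉ D) (hR : D.ReadFive)
    (hv : ∀ v ∈ vs, deg D v ≤ 4) :
    ∃ l : List (ℝ × ℝ), l.length = vs.length ∧ (∀ p ∈ l, 0 ≤ p.1 ∧ p.1 ≤ arsinh 1) ∧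
      (∀ p ∈ l, 0 ≤ p.2 ∧ p.2 ≤ arsinh 1) ∧ (∀ p ∈ l, |p.2 - p.1| ≤ δ) ∧
      (clauseProd (fun D v => ratio D v L / (1 + ratio D v L)) D vs : ℝ) =
        (tanhs l 0).prod ^ 2 ∧
      (clauseProd exactProb D vs : ℝ) = (tanhs l 1).prod ^ 2 := by
  induction vs generalizing D with
  | nil => exact ⟨[], by simp [clauseProd, tanhs]⟩
  | cons v vs ih =>
    simp only [List.forall_mem_cons] at hv
    by_cases hz : [] ∈ pinZero D v
    -- A unit clause on `v` makes both products `0`, while the formula after pinning no longer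
    -- satisfies the induction hypothesis. Constant segments at `0` represent the rest; only their
    -- number matters.
    · refine ⟨List.replicate (vs.length + 1) (0, 0), by simp, ?_, ?_, ?_, ?_, ?_⟩
      · intro p hp
        rw [List.eq_of_mem_replicate hp]
        simp
      · intro p hp
        rw [List.eq_of_mem_replicate hp]
        simp
      · intro p hp
        rw [List.eq_of_mem_replicate hp]
        simpa using hδ
      · have : ratio D v L = 0 := by
          rw [ratio_eq_nodeProd, nodeProd_eq_zero _ _ _ (nil_mem_of_nil_mem_pinZero hD hz)]
        simp [clauseProd, this, tanhs, segPt]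
      · have : exactRatio D v = 0 := by
          rw [exactRatio_eq_nodeProd hD hR.nodup,
            nodeProd_eq_zero _ _ _ (nil_mem_of_nil_mem_pinZero hD hz)]
        simp [clauseProd, exactProb_eq hD, this, tanhs, segPt]
    · obtain ⟨l, h1, h2, h3, h4, h5, h6⟩ := ih (pinZero D v) hz (hR.pinZero v)
        (fun y hy => (deg_pinZero_le D v y).trans (hv.2 y hy))
      have hr := ratio_mem_Icc D v L
      have he := exactRatio_mem_Icc D v
      refine ⟨(potential (ratio D v L), potential (exactRatio D v)) :: l, by simp [h1], ?_, ?_, ?_,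
        ?_, ?_⟩
      · exact List.forall_mem_cons.2 ⟨potential_mem hr, h2⟩
      · exact List.forall_mem_cons.2 ⟨potential_mem he, h3⟩
      · exact List.forall_mem_cons.2 ⟨h D v hD hR hv.1, h4⟩
      · rw [clauseProd, Rat.cast_mul, h5, ← tanh_potential_sq hr.1]
        simp [tanhs, segPt, mul_pow]
      · rw [clauseProd, Rat.cast_mul, h6, exactProb_eq hD, ← tanh_potential_sq he.1]
        simp [tanhs, segPt, mul_pow]

theorem exists_segments_node (L : ℕ) (hL : L ≠ 0) (η : ℝ) (δ : ℕ → ℝ) (hδ : ∀ w, 0 ≤ δ w)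
    (hη : ∀ w, w ≠ 0 → δ w * 0.981 ^ Nat.clog 4 (w + 1) ≤ η)
    (h : ∀ w, w ≠ 0 → ∀ (D : MonCNF n) (v : Fin n), [] ∉ D → D.ReadFive → deg D v ≤ 4 →
      |potential (exactRatio D v) - potential (ratio D v (L - Nat.clog 4 (w + 1)))| ≤ δ w)
    (A W : MonCNF n) (hD : [] ∉ A ++ W) (hR : ReadFive (A ++ W)) :
    ∃ S : List (List (ℝ × ℝ)), S.length = W.length ∧ (∀ l ∈ S, Admissible η l) ∧
      (nodeProd (truncProb L) A W : ℝ) = nodeVal S 0 ∧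
      (nodeProd (fun _ => exactProb) A W : ℝ) = nodeVal S 1 := by
  induction W with
  | nil => exact ⟨[], by simp [nodeProd, nodeVal]⟩
  | cons c cs ih =>
    have hc : c ≠ [] := by rintro rfl; simp at hD
    have hD' : [] ∉ A ++ cs := by simp only [List.mem_append, List.mem_cons] at hD ⊢; tauto
    have hw : c.length ≠ 0 := by simpa using hc
    obtain ⟨S, s1, s2, s3, s4⟩ := ih hD' hR.of_cons.1
    obtain ⟨l, h1, h2, h3, h4, h5, h6⟩ := exists_segments_clause _ _ (hδ c.length)
      (h c.length hw) (A ++ cs) c hD' hR.of_cons.1 hR.of_cons.2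
    refine ⟨l :: S, by simp [s1], List.forall_mem_cons.2 ⟨⟨?_, h2, h3, ?_⟩, s2⟩, ?_, ?_⟩
    · rw [← List.length_pos_iff, h1]; omega
    · intro p hp
      rw [h1]
      exact (mul_le_mul_of_nonneg_right (h4 p hp) (by positivity)).trans (hη _ hw)
    · have e : truncProb (n := n) L c.length = fun D v =>
          ratio D v (L - Nat.clog 4 (c.length + 1)) /
            (1 + ratio D v (L - Nat.clog 4 (c.length + 1))) := by
        funext D v; simp [truncProb, hL]
      rw [nodeProd, e, Rat.cast_mul, s3, Rat.cast_sub, h5]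
      simp [nodeVal]
    · rw [nodeProd, Rat.cast_mul, s4, Rat.cast_sub, h6]
      simp [nodeVal]

/-- This is an inequality because of the truncated subtraction: for `k > L` the child has error at
most `1`, and `0.981 ^ k` alone is already small enough. -/
theorem pow_sub_mul_pow_le (L k : ℕ) : (0.981 : ℝ) ^ (L - k) * 0.981 ^ k ≤ 0.981 ^ L := by
  rw [← pow_add]
  exact pow_le_pow_of_le_one (by norm_num) (by norm_num) (by omega)

/-- One level of the recursion, with `η = 0.981 ^ L` and child errors `0.981 ^ (L - ⌈log₄(w+1)⌉)`.
The factor `κ` is left open so that inner nodes can use `0.981` and the root `3`. -/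
theorem potential_error_step (C : MonCNF n) (x : Fin n) (L : ℕ) (hL : L ≠ 0) (κ : ℝ) (hκ : 0 ≤ κ)
    (hC : [] ∉ C) (hR : C.ReadFive)
    (h : ∀ l, l < L → ∀ (D : MonCNF n) (v : Fin n), [] ∉ D → D.ReadFive → deg D v ≤ 4 →
      |potential (exactRatio D v) - potential (ratio D v l)| ≤ 0.981 ^ l)
    (hc : ∀ (η : ℝ) (S : List (List (ℝ × ℝ))) (z : ℝ), (∀ l ∈ S, Admissible η l) →
      S.length = deg C x → 0 ≤ z ∧ z ≤ 1 →
      (S.map fun l => (tanhs l z).prod).sum ^ 2 * nodeVal S z ≤ κ ^ 2 * (1 + nodeVal S z)) :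
    0.981 * |potential (exactRatio C x) - potential (ratio C x L)| ≤ κ * 0.981 ^ L := by
  rw [exactRatio_eq_nodeProd hC hR.nodup, ratio_eq_nodeProd]
  by_cases hW : [] ∈ (C.clausesWith x).pinZero x
  · rw [nodeProd_eq_zero _ _ _ hW, nodeProd_eq_zero _ _ _ hW]
    simp only [sub_self, abs_zero, mul_zero]
    positivity
  · obtain ⟨S, s1, s2, s3, s4⟩ := exists_segments_node L hL (0.981 ^ L)
      (fun w => 0.981 ^ (L - Nat.clog 4 (w + 1))) (fun w => by positivity)
      (fun w _ => pow_sub_mul_pow_le _ _)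
      (fun w hw D v => h _ (by have := clog_succ_pos hw; omega) D v)
      (C.clausesWithout x) ((C.clausesWith x).pinZero x) (nil_notMem_node hC x hW) (hR.node x)
    rw [potential, potential, s3, s4]
    refine arsinh_sqrt_nodeVal_sub_le s2 (by positivity) hκ (fun z hz => hc _ S z s2 ?_ hz)
    rw [s1, pinZero, List.length_map, deg]

/-- For `L = 0` the error is at most `arsinh 1 ≤ 1`. Otherwise `κ = 0.981` cancels the factor on the
left of `potential_error_step`. -/
theorem potential_error_le (C : MonCNF n) (x : Fin n) (L : ℕ) (hC : [] ∉ C) (hR : C.ReadFive)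
    (hx : deg C x ≤ 4) :
    |potential (exactRatio C x) - potential (ratio C x L)| ≤ 0.981 ^ L := by
  induction L using Nat.strong_induction_on generalizing C x with
  | _ L ih =>
    rcases eq_or_ne L 0 with rfl | hL
    · simpa using abs_potential_sub_le_one (exactRatio_mem_Icc C x) (ratio_mem_Icc C x 0)
    · have := potential_error_step C x L hL 0.981 (by norm_num) hC hR
        (fun l hl D v hD hR' hv => ih l hl D v hD hR' hv)
        (fun η S z hS hl hz => nodeVal_contraction hS (by omega) hz)
      linarith

/-- A root may lie in five clauses, where no contraction is available. A crude `κ = 3` is enough for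
one step, and `3 / 0.981 < 3.06`. -/
theorem potential_error_le_root (C : MonCNF n) (x : Fin n) (L : ℕ) (hC : [] ∉ C)
    (hR : C.ReadFive) :
    |potential (exactRatio C x) - potential (ratio C x L)| ≤ 3.06 * 0.981 ^ L := by
  rcases eq_or_ne L 0 with rfl | hL
  · have := abs_potential_sub_le_one (exactRatio_mem_Icc C x) (ratio_mem_Icc C x 0)
    norm_num at *
    linarith
  · have := potential_error_step C x L hL 3 (by norm_num) hC hR
      (fun l _ D v hD hR' hv => potential_error_le D v l hD hR' hv) ?_
    · have h2 : (0 : ℝ) < 0.981 ^ L := by positivity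
      linarith
    · intro η S z hS hl hz
      have h5 := hR.read x
      have hV := nodeVal_pos hS hz
      have hV1 : nodeVal S z ≤ 1 := by
        clear hV hl
        induction S with
        | nil => simp [nodeVal]
        | cons l S ih =>
          have hS' := List.forall_mem_cons.1 hS
          have e : nodeVal (l :: S) z = (1 - (tanhs l z).prod ^ 2) * nodeVal S z := by
            simp [nodeVal]
          rw [e]
          exact mul_le_one₀ (by nlinarith [hS'.1.prod_mem hz]) (nodeVal_pos hS'.2 hz).le (ih hS'.2)
      have hsum : 0 ≤ (S.map fun l => (tanhs l z).prod).sum ∧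
          (S.map fun l => (tanhs l z).prod).sum ≤ S.length * 0.7072 := by
        clear hV hV1 hl
        induction S with
        | nil => simp
        | cons l S ih =>
          have hS' := List.forall_mem_cons.1 hS
          have h1 := hS'.1.prod_mem hz
          have h2 := ih hS'.2
          simp only [List.map_cons, List.sum_cons, List.length_cons]
          push_cast
          constructor <;> linarith
      have hl5 : (S.length : ℝ) ≤ 5 := by exact_mod_cast hl.trans_le h5
      -- Five clauses of value at most `0.7072` sum to at most `3.536`, and `12.51 V ≤ 9 (1 + V)`
      -- holds because `V ≤ 1`.
      have h6 : (S.map fun l => (tanhs l z).prod).sum ≤ 3.536 := by linarith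
      have h7 : (S.map fun l => (tanhs l z).prod).sum ^ 2 ≤ 12.51 := by nlinarith
      nlinarith

end MonCNF

namespace MonCNF

variable {n : ℕ}

open CorrelationDecay Real

/-! ### The estimator as a product over a list of variables -/

/-- The product of `f` along a list of variables that are pinned to `1` one after the other. -/
def pinProd (f : MonCNF n → Fin n → ℚ) : MonCNF n → List (Fin n) → ℚ
  | _, [] => 1
  | C, v :: vs => f C v * pinProd f (clausesWithout C v) vs

theorem prod_get_eq_pinProd (f : MonCNF n → Fin n → ℚ) (C : MonCNF n) (vs : List (Fin n)) :
    ∏ i : Fin vs.length, f ((vs.take i).foldl clausesWithout C) (vs.get i) = pinProd f C vs := by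
  induction vs generalizing C with
  | nil => simp [pinProd]
  | cons v vs ih =>
    rw [pinProd, ← ih]
    exact Fin.prod_univ_succ (n := vs.length) _

theorem estimate_eq_pinProd (C : MonCNF n) (L : ℕ) :
    C.estimate L = pinProd (fun C x => 1 + ratio C x L) C (List.finRange n) := by
  rw [← prod_get_eq_pinProd, estimate]
  refine (Fintype.prod_equiv (finCongr List.length_finRange) _ _ fun i => ?_).symm
  simp [pinPrefix]

theorem nil_notMem_clausesWithout {C : MonCNF n} (h : [] ∉ C) (x : Fin n) :
    [] ∉ C.clausesWithout x := fun h' => h (List.mem_filter.1 h').1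

/-- Telescoping of `one_add_exactRatio`; every pinned variable stays free in the count and
contributes one factor `2`. -/
theorem pinProd_exactRatio (C : MonCNF n) (hC : [] ∉ C) (vs : List (Fin n)) :
    pinProd (fun C x => 1 + exactRatio C x) C vs * count (Sat (vs.foldl clausesWithout C)) =
      2 ^ vs.length * count C.Sat := by
  induction vs generalizing C with
  | nil => simp [pinProd]
  | cons v vs ih =>
    rw [pinProd, List.foldl_cons, mul_assoc,
      ih _ (nil_notMem_clausesWithout hC v), List.length_cons, pow_succ, mul_assoc,
      ← one_add_exactRatio hC v]
    ring

theorem mem_foldl_clausesWithout (C : MonCNF n) (vs : List (Fin n)) (c : List (Fin n))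
    (h : c ∈ vs.foldl clausesWithout C) : c ∈ C ∧ ∀ v ∈ vs, v ∉ c := by
  induction vs generalizing C with
  | nil => simpa using h
  | cons v vs ih =>
    have := ih _ h
    obtain ⟨h1, h2⟩ := List.mem_filter.1 this.1
    exact ⟨h1, List.forall_mem_cons.2 ⟨by simpa using h2, this.2⟩⟩

theorem numSat_eq_pinProd (C : MonCNF n) (hC : [] ∉ C) :
    (C.numSat : ℚ) = pinProd (fun C x => 1 + exactRatio C x) C (List.finRange n) := by
  have h := pinProd_exactRatio C hC (List.finRange n)
  -- Once every variable is pinned to `1`, only an empty clause could survive, and there is none.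
  -- The remaining `2 ^ n` assignments cancel the powers of two.
  have h1 : (List.finRange n).foldl clausesWithout C = [] := by
    rw [List.eq_nil_iff_forall_not_mem]
    intro c hc
    obtain ⟨h1, h2⟩ := mem_foldl_clausesWithout _ _ _ hc
    obtain ⟨v, vs, rfl⟩ := List.exists_cons_of_ne_nil (show c ≠ [] from fun e => hC (e ▸ h1))
    exact h2 v (List.mem_finRange v) (by simp)
  have h2 : count (Sat ([] : MonCNF n)) = 2 ^ n := by
    have : count (Sat ([] : MonCNF n)) = count (fun _ : Fin n → Bool => True) :=
      count_congr fun a => by simp [Sat]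
    rw [this, count, Nat.card_congr (Equiv.subtypeUnivEquiv fun _ => trivial)]
    simp
  rw [h1, h2, List.length_finRange, mul_comm] at h
  exact (mul_left_cancel₀ (by positivity) h).symm

theorem pinProd_le_mul {f g : MonCNF n → Fin n → ℚ} {ρ : ℝ} (hρ : 0 ≤ ρ)
    (hf : ∀ C x, 0 ≤ f C x) (hg : ∀ C x, 0 ≤ g C x)
    (h : ∀ C x, [] ∉ C → C.ReadFive → (f C x : ℝ) ≤ ρ * g C x) (C : MonCNF n) (hC : [] ∉ C)
    (hR : C.ReadFive) (vs : List (Fin n)) :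
    (pinProd f C vs : ℝ) ≤ ρ ^ vs.length * pinProd g C vs := by
  have nonneg : ∀ (f : MonCNF n → Fin n → ℚ), (∀ C x, 0 ≤ f C x) → ∀ C vs, 0 ≤ pinProd f C vs := by
    intro f hf C vs
    induction vs generalizing C with
    | nil => simp [pinProd]
    | cons v vs ih => exact mul_nonneg (hf _ _) (ih _)
  induction vs generalizing C with
  | nil => simp [pinProd]
  | cons v vs ih =>
    have h1 := ih _ (nil_notMem_clausesWithout hC v) (hR.clausesWithout v)
    have h2 := h C v hC hR
    have h3 : (0 : ℝ) ≤ f C v := by exact_mod_cast hf C v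
    have h4 : (0 : ℝ) ≤ g C v := by exact_mod_cast hg C v
    have h5 : (0 : ℝ) ≤ pinProd f (clausesWithout C v) vs := by exact_mod_cast nonneg f hf _ _
    have h6 : (0 : ℝ) ≤ pinProd g (clausesWithout C v) vs := by exact_mod_cast nonneg g hg _ _
    rw [pinProd, pinProd, Rat.cast_mul, Rat.cast_mul, List.length_cons, pow_succ]
    calc (f C v : ℝ) * pinProd f (clausesWithout C v) vs
        ≤ (ρ * g C v) * (ρ ^ vs.length * pinProd g (clausesWithout C v) vs) := by gcongr
      _ = _ := by ring

/-! ### From errors of potentials to the approximation ratio -/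

theorem cosh_le_mul_exp (a b : ℝ) : cosh a ≤ exp |a - b| * cosh b := by
  rw [cosh_eq, cosh_eq]
  have h1 : exp a ≤ exp |a - b| * exp b := by
    rw [← exp_add]; exact exp_le_exp.2 (by linarith [le_abs_self (a - b)])
  have h2 : exp (-a) ≤ exp |a - b| * exp (-b) := by
    rw [← exp_add]; exact exp_le_exp.2 (by linarith [neg_abs_le (a - b)])
  linarith

theorem one_add_eq_cosh_sq {r : ℚ} (h : 0 ≤ r) : ((1 + r : ℚ) : ℝ) = cosh (potential r) ^ 2 := by
  have : (0 : ℝ) ≤ r := by exact_mod_cast h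
  rw [potential, cosh_arsinh, Real.sq_sqrt (by positivity), Real.sq_sqrt this]
  push_cast
  rfl

/-- Since `1 + r = cosh²` of the potential, an additive error `η` of the potential is a
multiplicative error `exp (2 η)` of the factor. -/
theorem one_add_le_mul {r s : ℚ} {η : ℝ} (hr : 0 ≤ r) (hs : 0 ≤ s)
    (h : |potential r - potential s| ≤ η) :
    ((1 + r : ℚ) : ℝ) ≤ exp (2 * η) * ((1 + s : ℚ) : ℝ) := by
  rw [one_add_eq_cosh_sq hr, one_add_eq_cosh_sq hs, two_mul, exp_add, ← pow_two, ← mul_pow]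
  refine pow_le_pow_left₀ (cosh_pos _).le ((cosh_le_mul_exp _ (potential s)).trans ?_) 2
  gcongr

theorem pow_depth_le (hn : 0 < n) {ε : ℝ} (h0 : 0 < ε) :
    (0.981 : ℝ) ^ depth n ε ≤ ε / (10 * √6 * n) := by
  have hn' : (0 : ℝ) < n := by exact_mod_cast hn
  have hX : 0 < ε / (10 * √6 * n) := by positivity
  rw [← Real.rpow_natCast]
  calc (0.981 : ℝ) ^ (depth n ε : ℝ) ≤ 0.981 ^ Real.logb 0.981 (ε / (10 * √6 * n)) :=
        Real.rpow_le_rpow_of_exponent_ge (by norm_num) (by norm_num) (Nat.le_ceil _)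
    _ = _ := Real.rpow_logb (by norm_num) (by norm_num) hX

theorem estimate_mem_Icc (hn : 0 < n) (C : MonCNF n) (hC : C.IsRead 5) (ε : ℝ) (h0 : 0 < ε)
    (h1 : ε < 1) :
    (1 - ε) * (C.numSat : ℝ) ≤ (C.estimate (depth n ε) : ℝ) ∧
      (C.estimate (depth n ε) : ℝ) ≤ (1 + ε) * (C.numSat : ℝ) := by
  have hn' : (0 : ℝ) < n := by exact_mod_cast hn
  have hnil : [] ∉ C := fun h => hC.nonempty [] h rfl
  set L := depth n ε with hL
  set η : ℝ := 3.06 * 0.981 ^ L with hη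
  have e1 := estimate_eq_pinProd C L
  have e2 : (C.numSat : ℝ) = (pinProd (fun C x => 1 + exactRatio C x) C (List.finRange n) : ℚ) := by
    rw [← numSat_eq_pinProd C hnil]; simp
  have nn1 : ∀ (C : MonCNF n) x, 0 ≤ 1 + exactRatio C x := fun C x => by
    linarith [exactRatio_nonneg C x]
  have nn2 : ∀ (C : MonCNF n) x, 0 ≤ 1 + ratio C x L := fun C x => by
    linarith [(ratio_mem_Icc C x L).1]
  have u1 := pinProd_le_mul (exp_pos (2 * η)).le nn2 nn1
    (fun C x hC hR => one_add_le_mul (ratio_mem_Icc C x L).1 (exactRatio_nonneg C x)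
      (by rw [abs_sub_comm]; exact potential_error_le_root C x L hC hR)) C hnil hC.readFive
      (List.finRange n)
  have u2 := pinProd_le_mul (exp_pos (2 * η)).le nn1 nn2
    (fun C x hC hR => one_add_le_mul (exactRatio_nonneg C x) (ratio_mem_Icc C x L).1
      (potential_error_le_root C x L hC hR)) C hnil hC.readFive
      (List.finRange n)
  rw [← e1, ← e2, List.length_finRange, ← exp_nat_mul] at u1 u2
  have hZ : (0 : ℝ) ≤ C.numSat := Nat.cast_nonneg _
  have hE : (0 : ℝ) ≤ C.estimate L := by
    by_contra hneg
    push Not at hneg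
    nlinarith [exp_pos (n * (2 * η))]
  -- With `√6 ≥ 2.4` the depth gives `0.981 ^ L ≤ ε / (24 n)`; the total exponent is at most `2 ·
  -- 3.06 / 24 · ε = 0.255 ε`.
  have hy : n * (2 * η) ≤ 0.255 * ε := by
    have h6 : (2.4 : ℝ) ≤ √6 := Real.le_sqrt_of_sq_le (by norm_num)
    have h7 := pow_depth_le hn h0
    rw [← hL] at h7
    have h8 : ε / (10 * √6 * n) ≤ ε / (24 * n) := by gcongr; linarith
    have h9 : n * (ε / (24 * n)) = ε / 24 := by field_simp
    calc n * (2 * η) = 6.12 * (n * 0.981 ^ L) := by rw [hη]; ring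
      _ ≤ 6.12 * (n * (ε / (24 * n))) := by gcongr; exact h7.trans h8
      _ = 0.255 * ε := by rw [h9]; ring
  have hexp : exp (n * (2 * η)) * (1 - 0.255 * ε) ≤ 1 := by
    have a1 : exp (n * (2 * η)) ≤ exp (0.255 * ε) := exp_le_exp.2 hy
    have a2 := Real.add_one_le_exp (-(0.255 * ε))
    have a3 : exp (0.255 * ε) * exp (-(0.255 * ε)) = 1 := by rw [← exp_add]; simp
    nlinarith [exp_pos (0.255 * ε), exp_pos (n * (2 * η))]
  have hpos := exp_pos (n * (2 * η))
  generalize exp (n * (2 * η)) = T at *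
  generalize (C.numSat : ℝ) = Z at *
  generalize (C.estimate L : ℝ) = E at *
  have hT : T ≤ 1 + ε := by
    by_contra hc
    push Not at hc
    nlinarith
  constructor
  · have : Z * (1 - 0.255 * ε) ≤ E := by
      calc Z * (1 - 0.255 * ε) ≤ (T * E) * (1 - 0.255 * ε) := by
            gcongr; linarith
        _ = E * (T * (1 - 0.255 * ε)) := by ring
        _ ≤ E * 1 := by gcongr
        _ = E := mul_one _
    nlinarith
  · exact u1.trans (by gcongr)

/-! ### Set covers -/

theorem ofSets_isRead {m : ℕ} (S : Fin n → Finset (Fin m)) (h5 : ∀ i, (S i).card ≤ 5)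
    (hS : ∀ e, ∃ i, e ∈ S i) : (ofSets S).IsRead 5 where
  nonempty := by
    intro c hc
    obtain ⟨e, -, rfl⟩ := List.mem_map.1 hc
    obtain ⟨i, hi⟩ := hS e
    exact List.ne_nil_of_mem (List.mem_filter.2 ⟨List.mem_finRange i, by simpa using hi⟩)
  nodup := by
    intro c hc
    obtain ⟨e, -, rfl⟩ := List.mem_map.1 hc
    exact (List.nodup_finRange n).filter _
  read := by
    intro x
    refine le_trans (le_of_eq ?_) (h5 x)
    have : (ofSets S).clausesWith x = ((List.finRange m).filter (fun e => e ∈ S x)).map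
        (fun e => (List.finRange n).filter (fun i => e ∈ S i)) := by
      simp only [clausesWith, ofSets, List.filter_map]
      congr 1
      refine List.filter_congr fun e _ => ?_
      simp [Function.comp]
    rw [this, List.length_map,
      ← List.toFinset_card_of_nodup ((List.nodup_finRange m).filter _)]
    congr 1
    ext e
    simp

theorem numSat_ofSets {m : ℕ} (S : Fin n → Finset (Fin m)) :
    (ofSets S).numSat = Nat.card {T : Finset (Fin n) // ∀ e, ∃ i ∈ T, e ∈ S i} := by
  refine Nat.card_congr ((Equiv.subtypeEquiv
    ⟨fun a => Finset.univ.filter (fun i => a i = true), fun T i => decide (i ∈ T), ?_, ?_⟩) ?_)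
  · intro a; funext i; simp
  · intro T; ext i; simp
  · intro a
    simp [Sat, ofSets, and_comm]

end MonCNF

namespace RAM

/-! ### Runs in which only the rational numbers are bounded -/

/-- The side condition of an instruction: constants are small, natural numbers are not multiplied,
and newly computed rational numbers have at most `B` binary digits. -/
def Instr.Ok (B : ℕ) : Instr → State → Prop
  | const _ v, _ => v < 256
  | op .mul _ _ _, _ => False
  | rconst _ q, _ => bits q ≤ B
  | rcast _ x, s => bits (s.reg x : ℚ) ≤ B
  | rop o _ v w, s => bits (o.eval (s.rreg v) (s.rreg w)) ≤ B
  | _, _ => True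

/-- Like `Exec`, but the size of the natural numbers is not bounded. -/
inductive Run (P : Program) (B : ℕ) : Cmd → State → ℕ → State → Prop
  | instr {i : Instr} {s : State} : i.Ok B s → Run P B (.instr i) s 1 (i.exec s)
  | seq {c d : Cmd} {s t u : State} {k l : ℕ} :
      Run P B c s k t → Run P B d t l u → Run P B (.seq c d) s (k + l) u
  | iteTrue {b : Test} {c d : Cmd} {s t : State} {k : ℕ} :
      b.holds s → Run P B c s k t → Run P B (.ite b c d) s (k + 1) t
  | iteFalse {b : Test} {c d : Cmd} {s t : State} {k : ℕ} :
      ¬ b.holds s → Run P B d s k t → Run P B (.ite b c d) s (k + 1) t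
  | whileTrue {b : Test} {c : Cmd} {s t u : State} {k l : ℕ} :
      b.holds s → Run P B c s k t → Run P B (.while b c) t l u →
        Run P B (.while b c) s (k + l + 1) u
  | whileFalse {b : Test} {c : Cmd} {s : State} :
      ¬ b.holds s → Run P B (.while b c) s 1 s
  | call {p : ℕ} {c : Cmd} {s t : State} {k : ℕ} :
      P[p]? = some c → Run P B c s k t → Run P B (.call p) s (k + 1) t

/-- The natural numbers in the state have at most `b` binary digits. -/
structure State.NatFits (s : State) (b : ℕ) : Prop where
  reg : ∀ a, Nat.size (s.reg a) ≤ b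
  mem : ∀ a, Nat.size (s.mem a) ≤ b

/-- The rational numbers in the state have at most `B` binary digits. -/
structure State.RatFits (s : State) (B : ℕ) : Prop where
  rreg : ∀ a, bits (s.rreg a) ≤ B
  rmem : ∀ a, bits (s.rmem a) ≤ B

theorem State.NatFits.mono {s : State} {b c : ℕ} (h : s.NatFits b) (hbc : b ≤ c) : s.NatFits c :=
  ⟨fun a => (h.reg a).trans hbc, fun a => (h.mem a).trans hbc⟩

theorem size_op_le (o : NatOp) (ho : o ≠ .mul) (a b c : ℕ) (ha : Nat.size a ≤ c)
    (hb : Nat.size b ≤ c) : Nat.size (o.eval a b) ≤ c + 1 := by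
  rw [Nat.size_le] at *
  rw [pow_succ]
  cases o with
  | add => simp only [NatOp.eval]; omega
  | sub => simp only [NatOp.eval]; omega
  | mul => exact absurd rfl ho

theorem update_le {f : ℕ → ℕ} {b x v : ℕ} (hf : ∀ a, Nat.size (f a) ≤ b) (hv : Nat.size v ≤ b)
    (a : ℕ) : Nat.size (Function.update f x v a) ≤ b := by
  rw [Function.update_apply]; split_ifs; exacts [hv, hf a]

theorem update_bits_le {f : ℕ → ℚ} {b x : ℕ} {v : ℚ} (hf : ∀ a, bits (f a) ≤ b) (hv : bits v ≤ b)
    (a : ℕ) : bits (Function.update f x v a) ≤ b := by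
  rw [Function.update_apply]; split_ifs; exacts [hv, hf a]

/-- Without multiplication, addition creates at most one new digit, and constants below `256` have
at most eight digits; so eight new digits per step is a safe uniform bound. -/
theorem Instr.exec_fits {i : Instr} {s : State} {b B : ℕ} (h : i.Ok B s) (hn : s.NatFits b)
    (hr : s.RatFits B) : (i.exec s).NatFits (b + 8) ∧ (i.exec s).RatFits B := by
  have hn' := hn.mono (show b ≤ b + 8 by omega)
  cases i with
  | const x v =>
    refine ⟨⟨update_le hn'.reg ?_, hn'.mem⟩, ⟨hr.rreg, hr.rmem⟩⟩
    have : Nat.size v ≤ 8 := Nat.size_le.2 (by simpa [Ok] using h)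
    omega
  | op o x y z =>
    refine ⟨⟨update_le hn'.reg ?_, hn'.mem⟩, ⟨hr.rreg, hr.rmem⟩⟩
    have := size_op_le o (by rintro rfl; exact h) _ _ b (hn.reg y) (hn.reg z)
    omega
  | load x y => exact ⟨⟨update_le hn'.reg (hn'.mem _), hn'.mem⟩, ⟨hr.rreg, hr.rmem⟩⟩
  | store x y => exact ⟨⟨hn'.reg, update_le hn'.mem (hn'.reg _)⟩, ⟨hr.rreg, hr.rmem⟩⟩
  | rconst u q => exact ⟨⟨hn'.reg, hn'.mem⟩, ⟨update_bits_le hr.rreg h, hr.rmem⟩⟩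
  | rcast u x => exact ⟨⟨hn'.reg, hn'.mem⟩, ⟨update_bits_le hr.rreg h, hr.rmem⟩⟩
  | rop o u v w => exact ⟨⟨hn'.reg, hn'.mem⟩, ⟨update_bits_le hr.rreg h, hr.rmem⟩⟩
  | rload u x => exact ⟨⟨hn'.reg, hn'.mem⟩, ⟨update_bits_le hr.rreg (hr.rmem _), hr.rmem⟩⟩
  | rstore x u => exact ⟨⟨hn'.reg, hn'.mem⟩, ⟨hr.rreg, update_bits_le hr.rmem (hr.rreg _)⟩⟩

/-- Natural numbers grow by a bounded number of digits per step, so that a bound for them comes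
from the number of steps. -/
theorem Run.exec {P : Program} {A B k : ℕ} {c : Cmd} {s t : State} (h : Run P A c s k t)
    (hA : A ≤ B) : ∀ b, s.NatFits b → s.RatFits A → b + 8 * k ≤ B →
      Exec P B c s k t ∧ t.NatFits (b + 8 * k) ∧ t.RatFits A := by
  induction h with
  | instr hi =>
    intro b hn hr hb
    have := Instr.exec_fits hi hn hr
    have h2 := this.1.mono (show b + 8 ≤ B by omega)
    exact ⟨.instr ⟨h2.reg, h2.mem, fun a => (this.2.rreg a).trans hA,
      fun a => (this.2.rmem a).trans hA⟩, this.1, this.2⟩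
  | @seq c d s t u k l _ _ ih1 ih2 =>
    intro b hn hr hb
    obtain ⟨e1, n1, r1⟩ := ih1 b hn hr (by omega)
    obtain ⟨e2, n2, r2⟩ := ih2 _ n1 r1 (by omega)
    exact ⟨.seq e1 e2, n2.mono (by omega), r2⟩
  | iteTrue hb _ ih =>
    intro b hn hr hB
    obtain ⟨e1, n1, r1⟩ := ih b hn hr (by omega)
    exact ⟨.iteTrue hb e1, n1.mono (by omega), r1⟩
  | iteFalse hb _ ih =>
    intro b hn hr hB
    obtain ⟨e1, n1, r1⟩ := ih b hn hr (by omega)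
    exact ⟨.iteFalse hb e1, n1.mono (by omega), r1⟩
  | whileTrue hb _ _ ih1 ih2 =>
    intro b hn hr hB
    obtain ⟨e1, n1, r1⟩ := ih1 b hn hr (by omega)
    obtain ⟨e2, n2, r2⟩ := ih2 _ n1 r1 (by omega)
    exact ⟨.whileTrue hb e1 e2, n2.mono (by omega), r2⟩
  | whileFalse hb =>
    intro b hn hr hB
    exact ⟨.whileFalse hb, hn.mono (by omega), hr⟩
  | call hp _ ih =>
    intro b hn hr hB
    obtain ⟨e1, n1, r1⟩ := ih b hn hr (by omega)
    exact ⟨.call hp e1, n1.mono (by omega), r1⟩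

/-! ### Total correctness with a bound for the number of steps -/

/-- Started in `s`, the command `c` halts after at most `K` steps in a state with property `Q`. -/
def Tri (P : Program) (B : ℕ) (c : Cmd) (s : State) (K : ℕ) (Q : State → Prop) : Prop :=
  ∃ k t, k ≤ K ∧ Run P B c s k t ∧ Q t

/-- The sequential composition of a list of commands. -/
def Cmd.seqs : List Cmd → Cmd
  | [] => .instr (.const 0 0)
  | [c] => c
  | c :: d :: cs => .seq c (seqs (d :: cs))

/-- A list of instructions as a command. -/
def Cmd.blk (is : List Instr) : Cmd := Cmd.seqs (is.map Cmd.instr)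

/-- The effect of a list of instructions. -/
def execs : List Instr → State → State
  | [], s => s
  | i :: is, s => execs is (i.exec s)

/-- The side conditions of a list of instructions. -/
def OkAll (B : ℕ) : List Instr → State → Prop
  | [], _ => True
  | i :: is, s => i.Ok B s ∧ OkAll B is (i.exec s)

namespace Tri

variable {P : Program} {B : ℕ}

theorem mono {c : Cmd} {s : State} {K K' : ℕ} {Q Q' : State → Prop} (h : Tri P B c s K Q)
    (hK : K ≤ K') (hQ : ∀ t, Q t → Q' t) : Tri P B c s K' Q' := by
  obtain ⟨k, t, hk, hr, hq⟩ := h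
  exact ⟨k, t, hk.trans hK, hr, hQ t hq⟩

theorem instr {i : Instr} {s : State} {K : ℕ} {Q : State → Prop} (h : i.Ok B s) (hK : 1 ≤ K)
    (hQ : Q (i.exec s)) : Tri P B (.instr i) s K Q := ⟨1, _, hK, .instr h, hQ⟩

theorem seq {c d : Cmd} {s : State} {K K₁ K₂ : ℕ} {Q R : State → Prop} (h₁ : Tri P B c s K₁ R)
    (h₂ : ∀ t, R t → Tri P B d t K₂ Q) (hK : K₁ + K₂ ≤ K) : Tri P B (.seq c d) s K Q := by
  obtain ⟨k, t, hk, hr, hq⟩ := h₁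
  obtain ⟨l, u, hl, hr', hq'⟩ := h₂ t hq
  exact ⟨k + l, u, by omega, .seq hr hr', hq'⟩

theorem ite {b : Test} {c d : Cmd} {s : State} {K : ℕ} {Q : State → Prop}
    (h₁ : b.holds s → Tri P B c s K Q) (h₂ : ¬ b.holds s → Tri P B d s K Q) :
    Tri P B (.ite b c d) s (K + 1) Q := by
  by_cases hb : b.holds s
  · obtain ⟨k, t, hk, hr, hq⟩ := h₁ hb
    exact ⟨k + 1, t, by omega, .iteTrue hb hr, hq⟩
  · obtain ⟨k, t, hk, hr, hq⟩ := h₂ hb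
    exact ⟨k + 1, t, by omega, .iteFalse hb hr, hq⟩

theorem call {p : ℕ} {c : Cmd} {s : State} {K : ℕ} {Q : State → Prop} (hp : P[p]? = some c)
    (h : Tri P B c s K Q) : Tri P B (.call p) s (K + 1) Q := by
  obtain ⟨k, t, hk, hr, hq⟩ := h
  exact ⟨k + 1, t, by omega, .call hp hr, hq⟩

theorem blk {is : List Instr} (hne : is ≠ []) {s : State} {K : ℕ} {Q : State → Prop}
    (h : OkAll B is s) (hK : is.length ≤ K) (hQ : Q (execs is s)) :
    Tri P B (Cmd.blk is) s K Q := by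
  induction is generalizing s K with
  | nil => exact absurd rfl hne
  | cons i is ih =>
    cases is with
    | nil => exact instr h.1 hK hQ
    | cons j js =>
      exact seq (instr (Q := fun t => t = i.exec s) h.1 le_rfl rfl)
        (fun t ht => by subst ht; exact ih (by simp) h.2 le_rfl hQ) (by simp at hK ⊢; omega)

theorem seqs_cons {c d : Cmd} {cs : List Cmd} {s : State} {K K₁ K₂ : ℕ} {Q R : State → Prop}
    (h₁ : Tri P B c s K₁ R) (h₂ : ∀ t, R t → Tri P B (Cmd.seqs (d :: cs)) t K₂ Q)
    (hK : K₁ + K₂ ≤ K) : Tri P B (Cmd.seqs (c :: d :: cs)) s K Q := seq h₁ h₂ hK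

theorem seqs_blk {is : List Instr} (hne : is ≠ []) {d : Cmd} {cs : List Cmd} {s : State} {K K₂ : ℕ}
    {Q : State → Prop} (h : OkAll B is s)
    (h₂ : Tri P B (Cmd.seqs (d :: cs)) (execs is s) K₂ Q)
    (hK : is.length + K₂ ≤ K) : Tri P B (Cmd.seqs (Cmd.blk is :: d :: cs)) s K Q :=
  seq (blk (Q := fun t => t = execs is s) hne h le_rfl rfl) (fun t ht => by subst ht; exact h₂) hK

/-- The rule for loops that process a list. -/
theorem while_list {α : Type*} {b : Test} {c : Cmd} (I : List α → State → Prop) (K : List α → ℕ)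
    (h0 : ∀ s, I [] s → ¬ b.holds s) (hK : 1 ≤ K [])
    (h1 : ∀ a l s, I (a :: l) s → b.holds s ∧
      ∃ k, k + K l + 1 ≤ K (a :: l) ∧ Tri P B c s k (I l))
    (l : List α) (s : State) (h : I l s) : Tri P B (.while b c) s (K l) (I []) := by
  induction l generalizing s with
  | nil => exact ⟨1, s, hK, .whileFalse (h0 s h), h⟩
  | cons a l ih =>
    obtain ⟨hb, k, hk, k', t, hk', hr, ht⟩ := h1 a l s h
    obtain ⟨m, u, hm, hr', hu⟩ := ih t ht
    exact ⟨k' + m + 1, u, by omega, .whileTrue hb hr hr', hu⟩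

/-- The rule for loops with a known number of iterations. -/
theorem while_nat {b : Test} {c : Cmd} (I : ℕ → State → Prop) (k : ℕ)
    (h0 : ∀ s, I 0 s → ¬ b.holds s)
    (h1 : ∀ m s, I (m + 1) s → b.holds s ∧ Tri P B c s k (I m))
    (m : ℕ) (s : State) (h : I m s) : Tri P B (.while b c) s (m * (k + 1) + 1) (I 0) := by
  induction m generalizing s with
  | zero => exact ⟨1, s, by omega, .whileFalse (h0 s h), h⟩
  | succ m ih =>
    obtain ⟨hb, k', t, hk', hr, ht⟩ := h1 m s h
    obtain ⟨j, u, hj, hr', hu⟩ := ih t ht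
    exact ⟨k' + j + 1, u, by rw [add_mul]; omega, .whileTrue hb hr hr', hu⟩

end Tri

/-! ### Lists in the memory -/

/-- The list `l` is stored from the address `a` on. -/
def Seg (mem : ℕ → ℕ) : ℕ → List ℕ → Prop
  | _, [] => True
  | a, v :: l => mem a = v ∧ Seg mem (a + 1) l

theorem Seg.congr {mem mem' : ℕ → ℕ} {a : ℕ} {l : List ℕ} (h : Seg mem a l)
    (hm : ∀ i, a ≤ i → i < a + l.length → mem' i = mem i) : Seg mem' a l := by
  induction l generalizing a with
  | nil => trivial
  | cons v l ih =>
    rw [List.length_cons] at hm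
    exact ⟨(hm a le_rfl (by omega)).trans h.1, ih h.2 fun i h1 h2 => hm i (by omega) (by omega)⟩

theorem seg_append {mem : ℕ → ℕ} {a : ℕ} {l l' : List ℕ} :
    Seg mem a (l ++ l') ↔ Seg mem a l ∧ Seg mem (a + l.length) l' := by
  induction l generalizing a with
  | nil => simp [Seg]
  | cons v l ih =>
    simp only [List.cons_append, Seg, ih, List.length_cons, and_assoc]
    rw [show a + 1 + l.length = a + (l.length + 1) by omega]

theorem Seg.update {mem : ℕ → ℕ} {a w v : ℕ} {l : List ℕ} (h : Seg mem a l)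
    (hw : w < a ∨ a + l.length ≤ w) : Seg (Function.update mem w v) a l :=
  h.congr fun i h1 h2 => Function.update_of_ne (by omega) _ _

theorem Seg.snoc {mem : ℕ → ℕ} {a w v : ℕ} {l : List ℕ} (h : Seg mem a l)
    (hw : w = a + l.length) : Seg (Function.update mem w v) a (l ++ [v]) := by
  rw [seg_append]
  refine ⟨h.update (by omega), ?_, trivial⟩
  rw [← hw, Function.update_self]

end RAM

namespace RAM

/-! ### Formulas as lists of tokens, and the filter loop -/

/-- The tokens of a list of clauses; `0` marks the end of a clause. -/
def toks (C : List (List ℕ)) : List ℕ := C.flatMap (fun c => c ++ [0])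

/-- Delete `x` from all clauses, keeping the clauses without `x` if `0 < k₀` and those with `x`
if `0 < k₁`. -/
def sieve (x k₀ k₁ : ℕ) (C : List (List ℕ)) : List (List ℕ) :=
  (C.filter (fun c => if x ∈ c then 0 < k₁ else 0 < k₀)).map (fun c => c.filter (fun y => y ≠ x))

/-- One step of the filter loop: `o` are the tokens kept so far, `r` those of the current clause,
and `k` tells whether that clause is kept. -/
def sieveStep (x k₀ k₁ : ℕ) : List ℕ × List ℕ × ℕ → ℕ → List ℕ × List ℕ × ℕ
  | (o, r, k), t =>
    if t = 0 then (if 0 < k then (o ++ (r ++ [0]), [], k₀) else (o, [], k₀))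
    else if t = x then (o, r, k₁) else (o, r ++ [t], k)

theorem foldl_sieveStep_clause (x k₀ k₁ : ℕ) (c o r : List ℕ) (k : ℕ) (hc : 0 ∉ c) :
    c.foldl (sieveStep x k₀ k₁) (o, r, k) =
      (o, r ++ c.filter (fun y => y ≠ x), if x ∈ c then k₁ else k) := by
  induction c generalizing r k with
  | nil => simp
  | cons t c ih =>
    simp only [List.mem_cons, not_or] at hc
    rw [List.foldl_cons, sieveStep, if_neg (Ne.symm hc.1)]
    by_cases h : t = x
    · subst h
      rw [if_pos rfl, ih _ _ hc.2]
      simp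
    · rw [if_neg h, ih _ _ hc.2]
      simp [h, Ne.symm h]

/-- At each end mark the pending clause is either appended to the output or dropped, and the flag is
reset to `k₀`. The loop therefore handles clauses independently. -/
theorem foldl_sieveStep (x k₀ k₁ : ℕ) (C : List (List ℕ)) (o : List ℕ) (hC : ∀ c ∈ C, 0 ∉ c) :
    (toks C).foldl (sieveStep x k₀ k₁) (o, [], k₀) = (o ++ toks (sieve x k₀ k₁ C), [], k₀) := by
  induction C generalizing o with
  | nil => simp [toks, sieve]
  | cons c C ih =>
    rw [List.forall_mem_cons] at hC
    have e : toks (c :: C) = c ++ (0 :: toks C) := by simp [toks]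
    rw [e, List.foldl_append, foldl_sieveStep_clause _ _ _ _ _ _ _ hC.1, List.foldl_cons,
      sieveStep, if_pos rfl]
    have hs : sieve x k₀ k₁ (c :: C) = (if 0 < (if x ∈ c then k₁ else k₀) then
        [c.filter (fun y => y ≠ x)] else []) ++ sieve x k₀ k₁ C := by
      unfold sieve
      rw [List.filter_cons]
      split_ifs <;> simp_all
    rw [hs]
    by_cases h : 0 < (if x ∈ c then k₁ else k₀)
    · rw [if_pos h, if_pos h, ih _ hC.2]
      simp [toks]
    · rw [if_neg h, if_neg h, ih _ hC.2]
      simp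

open Instr Test Cmd NatOp in
/-- Append the token in register `29` to the output. -/
def pushTok : Cmd := blk [store 22 29, op add 22 22 1]

open Instr Test Cmd NatOp in
/-- The body of the filter loop. -/
def sieveBody : Cmd := seqs [blk [load 29 20, op add 20 20 1],
  ite (lt 0 29)
    (ite (lt 29 23) pushTok (ite (lt 23 29) pushTok (blk [op add 30 25 0])))
    (seqs [blk [store 22 0, op add 22 22 1],
      ite (lt 0 30) (blk [op add 26 22 0]) (blk [op add 22 26 0]),
      blk [op add 30 24 0]])]

open Instr Test Cmd NatOp in
/-- The filter loop: it reads the tokens between the addresses in the registers `20` and `21` and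
writes from the address in register `22` on. Register `23` contains the variable `x`, and the
registers `24` and `25` tell whether the clauses without and with `x` are kept. -/
def sieveCmd : Cmd := seqs [blk [op add 26 22 0, op add 30 24 0], .while (lt 20 21) sieveBody]

/-- The registers that are not scratch registers of the filter loop, and the rational numbers. -/
structure Keeps (s t : State) : Prop where
  reg : ∀ r, r < 20 ∨ 100 ≤ r → t.reg r = s.reg r
  rreg : t.rreg = s.rreg
  rmem : t.rmem = s.rmem

theorem Keeps.refl (s : State) : Keeps s s := ⟨fun _ _ => rfl, rfl, rfl⟩

/-- The invariant of the filter loop. -/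
structure SieveInv (s₀ : State) (x k₀ k₁ a e : ℕ) (o r : List ℕ) (k : ℕ) (l : List ℕ)
    (s : State) : Prop where
  keeps : Keeps s₀ s
  pos : s.reg 20 + l.length = e
  endAddr : s.reg 21 = e
  var : s.reg 23 = x
  without : s.reg 24 = k₀
  within : s.reg 25 = k₁
  start : s.reg 26 = a + o.length
  cur : s.reg 22 = a + (o ++ r).length
  keep : s.reg 30 = k
  out : Seg s.mem a (o ++ r)
  inp : Seg s.mem (s.reg 20) l
  apart : s.reg 22 ≤ s.reg 20 ∨ e ≤ a
  below : ∀ i, i < a → s.mem i = s₀.mem i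

section

variable {P : Program} {B : ℕ} {s₀ s : State} {x k₀ k₁ a e k t v : ℕ} {o r l : List ℕ}

theorem Keeps.update_reg (h : Keeps s₀ s) {i : ℕ} (hi : 20 ≤ i ∧ i < 100) (mem : ℕ → ℕ) (v : ℕ) :
    Keeps s₀ { s with reg := Function.update s.reg i v, mem := mem } :=
  ⟨fun r hr => by
    have : r ≠ i := by omega
    simp [this, h.reg r hr], h.rreg, h.rmem⟩

/-- A write must not destroy unread input: either the write position is strictly behind the read
position, or the output area begins at or after the end of the input. -/
theorem push_spec (h : SieveInv s₀ x k₀ k₁ a e o r k l s) (h1 : s₀.reg 1 = 1)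
    (hs : s.reg 22 < s.reg 20 ∨ e ≤ a) {y : ℕ} (hy : s.reg y = v) :
    SieveInv s₀ x k₀ k₁ a e o (r ++ [v]) k l
      (execs [.store 22 y, .op .add 22 22 1] s) := by
  have hp := h.pos
  have hc := h.cur
  refine ⟨h.keeps.update_reg (by omega) _ _, ?_, ?_, ?_, ?_, ?_, ?_, ?_, ?_, ?_, ?_, ?_, ?_⟩
  · simpa [execs, Instr.exec] using h.pos
  · simpa [execs, Instr.exec] using h.endAddr
  · simpa [execs, Instr.exec] using h.var
  · simpa [execs, Instr.exec] using h.without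
  · simpa [execs, Instr.exec] using h.within
  · simpa [execs, Instr.exec] using h.start
  · simp [execs, Instr.exec, NatOp.eval, h.keeps.reg 1, h1, h.cur]; omega
  · simpa [execs, Instr.exec] using h.keep
  · simp only [execs, Instr.exec, hy, ← List.append_assoc]
    exact h.out.snoc hc
  · simp only [execs, Instr.exec]
    rw [Function.update_of_ne (by norm_num)]
    exact h.inp.update (by rw [List.length_append] at hc; omega)
  · simp [execs, Instr.exec, NatOp.eval, h.keeps.reg 1, h1]; omega
  · intro i hi
    simp only [execs, Instr.exec]
    rw [Function.update_of_ne (by omega)]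
    exact h.below i hi

theorem pushTok_spec (h : SieveInv s₀ x k₀ k₁ a e o r k l s) (h1 : s₀.reg 1 = 1)
    (hs : s.reg 22 < s.reg 20 ∨ e ≤ a) (ht : s.reg 29 = t) :
    Tri P B pushTok s 2 (SieveInv s₀ x k₀ k₁ a e o (r ++ [t]) k l) :=
  Tri.blk (by simp) (by simp [OkAll, Instr.Ok]) (by simp) (push_spec h h1 hs ht)

/-- Reading a token advances the read position and so creates the strict gap that allows one token
to be written when the loop runs in place. -/
theorem sieveRead_spec (h : SieveInv s₀ x k₀ k₁ a e o r k (t :: l) s) (h1 : s₀.reg 1 = 1) :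
    SieveInv s₀ x k₀ k₁ a e o r k l (execs [.load 29 20, .op .add 20 20 1] s) ∧
      (execs [.load 29 20, .op .add 20 20 1] s).reg 29 = t ∧
      ((execs [.load 29 20, .op .add 20 20 1] s).reg 22 <
        (execs [.load 29 20, .op .add 20 20 1] s).reg 20 ∨ e ≤ a) := by
  have hp := h.pos
  have ha := h.apart
  have hk := h.keeps.reg 1 (by norm_num)
  rw [h1] at hk
  rw [List.length_cons] at hp
  refine ⟨⟨?_, ?_, ?_, ?_, ?_, ?_, ?_, ?_, ?_, ?_, ?_, ?_, ?_⟩, ?_, ?_⟩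
  · exact (h.keeps.update_reg (i := 29) (by omega) s.mem _).update_reg (by omega) s.mem _
  · simp [execs, Instr.exec, NatOp.eval, hk]; omega
  · simpa [execs, Instr.exec] using h.endAddr
  · simpa [execs, Instr.exec] using h.var
  · simpa [execs, Instr.exec] using h.without
  · simpa [execs, Instr.exec] using h.within
  · simpa [execs, Instr.exec] using h.start
  · simpa [execs, Instr.exec] using h.cur
  · simpa [execs, Instr.exec] using h.keep
  · exact h.out
  · simpa [execs, Instr.exec, NatOp.eval, hk] using h.inp.2
  · simp [execs, Instr.exec, NatOp.eval, hk]; omega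
  · exact h.below
  · simpa [execs, Instr.exec] using h.inp.1
  · simp [execs, Instr.exec, NatOp.eval, hk]; omega

theorem SieveInv.set_keep (h : SieveInv s₀ x k₀ k₁ a e o r k l s) :
    SieveInv s₀ x k₀ k₁ a e o r v l { s with reg := Function.update s.reg 30 v } := by
  refine ⟨h.keeps.update_reg (by omega) _ _, ?_, ?_, ?_, ?_, ?_, ?_, ?_, ?_, h.out, ?_, ?_, h.below⟩
  · simpa using h.pos
  · simpa using h.endAddr
  · simpa using h.var
  · simpa using h.without
  · simpa using h.within
  · simpa using h.start
  · simpa using h.cur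
  · simp
  · simpa using h.inp
  · simpa using h.apart

theorem SieveInv.commit (h : SieveInv s₀ x k₀ k₁ a e o r k l s) :
    SieveInv s₀ x k₀ k₁ a e (o ++ r) [] k l
      { s with reg := Function.update s.reg 26 (s.reg 22) } := by
  refine ⟨h.keeps.update_reg (by omega) _ _, ?_, ?_, ?_, ?_, ?_, ?_, ?_, ?_, ?_, ?_, ?_, h.below⟩
  · simpa using h.pos
  · simpa using h.endAddr
  · simpa using h.var
  · simpa using h.without
  · simpa using h.within
  · simpa using h.cur
  · simpa using h.cur
  · simpa using h.keep
  · simpa using h.out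
  · simpa using h.inp
  · simpa using h.apart

/-- Dropping a clause needs no erasing: the write position returns to the start of the clause, and
the cells beyond it are no longer described by the invariant. -/
theorem SieveInv.discard (h : SieveInv s₀ x k₀ k₁ a e o r k l s) :
    SieveInv s₀ x k₀ k₁ a e o [] k l
      { s with reg := Function.update s.reg 22 (s.reg 26) } := by
  have hc := h.cur
  have hs := h.start
  have hp := h.apart
  rw [List.length_append] at hc
  refine ⟨h.keeps.update_reg (by omega) _ _, ?_, ?_, ?_, ?_, ?_, ?_, ?_, ?_, ?_, ?_, ?_, h.below⟩
  · simpa using h.pos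
  · simpa using h.endAddr
  · simpa using h.var
  · simpa using h.without
  · simpa using h.within
  · simpa using h.start
  · simpa using h.start
  · simpa using h.keep
  · simpa using (seg_append.1 h.out).1
  · simpa using h.inp
  · simp; omega

theorem sieveBody_spec (h : SieveInv s₀ x k₀ k₁ a e o r k (t :: l) s) (hz : s₀.reg 0 = 0)
    (h1 : s₀.reg 1 = 1) :
    Tri P B sieveBody s 10 (SieveInv s₀ x k₀ k₁ a e (sieveStep x k₀ k₁ (o, r, k) t).1
      (sieveStep x k₀ k₁ (o, r, k) t).2.1 (sieveStep x k₀ k₁ (o, r, k) t).2.2 l) := by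
  refine Tri.seqs_blk (K₂ := 8) (by simp) (by simp [OkAll, Instr.Ok]) ?_ (by simp)
  obtain ⟨hI, h29, hs⟩ := sieveRead_spec h h1
  generalize execs [.load 29 20, .op .add 20 20 1] s = s' at *
  clear h
  have g0 : s'.reg 0 = 0 := (hI.keeps.reg 0 (by norm_num)).trans hz
  refine Tri.ite (fun hb => ?_) (fun hb => ?_)
  · simp only [Test.holds, g0, h29] at hb
    have ht : t ≠ 0 := by omega
    refine Tri.mono (K := 4) ?_ (by norm_num) fun _ => id
    refine Tri.ite (K := 3) (fun hb1 => ?_)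
      (fun hb1 => Tri.ite (K := 2) (fun hb2 => ?_) fun hb2 => ?_)
    · simp only [Test.holds, h29, hI.var] at hb1
      have e : sieveStep x k₀ k₁ (o, r, k) t = (o, r ++ [t], k) := by
        rw [sieveStep, if_neg ht, if_neg (by omega)]
      rw [e]
      exact (pushTok_spec hI h1 hs h29).mono (by norm_num) fun _ => id
    · simp only [Test.holds, h29, hI.var] at hb2
      have e : sieveStep x k₀ k₁ (o, r, k) t = (o, r ++ [t], k) := by
        rw [sieveStep, if_neg ht, if_neg (by omega)]
      rw [e]
      exact pushTok_spec hI h1 hs h29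
    · simp only [Test.holds, h29, hI.var] at hb1 hb2
      have e : sieveStep x k₀ k₁ (o, r, k) t = (o, r, k₁) := by
        rw [sieveStep, if_neg ht, if_pos (by omega)]
      rw [e]
      refine Tri.blk (by simp) (by simp [OkAll, Instr.Ok]) (by simp) ?_
      simpa [execs, Instr.exec, NatOp.eval, g0, hI.within] using hI.set_keep (v := k₁)
  · simp only [Test.holds, g0, h29] at hb
    have ht : t = 0 := by omega
    subst ht
    refine Tri.seqs_blk (K₂ := 4) (by simp) (by simp [OkAll, Instr.Ok]) ?_ (by simp)
    have hJ := push_spec hI h1 hs g0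
    generalize execs [.store 22 0, .op .add 22 22 1] s' = s'' at *
    clear hI g0 h29 hs
    have g0 : s''.reg 0 = 0 := (hJ.keeps.reg 0 (by norm_num)).trans hz
    refine Tri.seqs_cons (K₁ := 2) (K₂ := 1) (R := SieveInv s₀ x k₀ k₁ a e
      (sieveStep x k₀ k₁ (o, r, k) 0).1 (sieveStep x k₀ k₁ (o, r, k) 0).2.1 k l)
      (Tri.ite (K := 1) (fun hb => ?_) (fun hb => ?_)) (fun t ht => ?_) (by norm_num)
    · simp only [Test.holds, g0, hJ.keep] at hb
      refine Tri.blk (by simp) (by simp [OkAll, Instr.Ok]) (by simp) ?_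
      simpa [execs, Instr.exec, NatOp.eval, g0, sieveStep, hb] using hJ.commit
    · simp only [Test.holds, g0, hJ.keep] at hb
      refine Tri.blk (by simp) (by simp [OkAll, Instr.Ok]) (by simp) ?_
      simpa [execs, Instr.exec, NatOp.eval, g0, sieveStep, hb] using hJ.discard
    · have g0 : t.reg 0 = 0 := (ht.keeps.reg 0 (by norm_num)).trans hz
      refine Tri.blk (by simp) (by simp [OkAll, Instr.Ok]) (by simp) ?_
      have e : (sieveStep x k₀ k₁ (o, r, k) 0).2.2 = k₀ := by
        simp only [sieveStep, if_true]; split_ifs <;> rfl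
      rw [e]
      simpa [execs, Instr.exec, NatOp.eval, g0, ht.without] using ht.set_keep (v := k₀)

/-- The filter loop stores the sieved formula at the address `a`. -/
theorem sieveCmd_spec (C : List (List ℕ)) (hC : ∀ c ∈ C, 0 ∉ c) (hz : s.reg 0 = 0)
    (h1 : s.reg 1 = 1) (hin : Seg s.mem (s.reg 20) (toks C))
    (hend : s.reg 21 = s.reg 20 + (toks C).length)
    (hap : s.reg 22 ≤ s.reg 20 ∨ s.reg 21 ≤ s.reg 22) :
    Tri P B sieveCmd s (11 * (toks C).length + 3) (fun t => Keeps s t ∧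
      Seg t.mem (s.reg 22) (toks (sieve (s.reg 23) (s.reg 24) (s.reg 25) C)) ∧
      t.reg 22 = s.reg 22 + (toks (sieve (s.reg 23) (s.reg 24) (s.reg 25) C)).length ∧
      ∀ i, i < s.reg 22 → t.mem i = s.mem i) := by
  set x := s.reg 23
  set k₀ := s.reg 24
  set k₁ := s.reg 25
  refine Tri.seqs_blk (K₂ := 11 * (toks C).length + 1) (by simp) (by simp [OkAll, Instr.Ok]) ?_
    (by simp; omega)
  -- The state is described by folding `sieveStep` over the tokens `l'` read so far, with `l` the
  -- unread rest.
  let I : List ℕ → State → Prop := fun l t => ∃ l', l' ++ l = toks C ∧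
    SieveInv s x k₀ k₁ (s.reg 22) (s.reg 21)
      (l'.foldl (sieveStep x k₀ k₁) ([], [], k₀)).1
      (l'.foldl (sieveStep x k₀ k₁) ([], [], k₀)).2.1
      (l'.foldl (sieveStep x k₀ k₁) ([], [], k₀)).2.2 l t
  have hI : I (toks C) (execs [.op .add 26 22 0, .op .add 30 24 0] s) := by
    refine ⟨[], rfl, ?_⟩
    refine ⟨((Keeps.refl s).update_reg (i := 26) (by omega) s.mem _).update_reg (by omega) s.mem _,
      ?_, ?_, ?_, ?_, ?_, ?_, ?_, ?_, ?_, ?_, ?_, ?_⟩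
    all_goals simp [execs, Instr.exec, NatOp.eval, hz, x, k₀, k₁, Seg]
    · exact hend.symm
    · exact hin
    · exact hap
  have := Tri.while_list (P := P) (B := B) (b := .lt 20 21) (c := sieveBody) I
    (fun l => 11 * l.length + 1) ?_ (by simp) ?_ (toks C) _ hI
  · refine this.mono le_rfl ?_
    rintro t ⟨l', hl', ht⟩
    rw [List.append_nil] at hl'
    rw [hl', foldl_sieveStep x k₀ k₁ C [] hC] at ht
    refine ⟨ht.keeps, ?_, ?_, ht.below⟩
    · simpa using ht.out
    · simpa using ht.cur
  · rintro t ⟨l', -, ht⟩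
    have := ht.pos
    have := ht.endAddr
    simp only [List.length_nil] at *
    simp only [Test.holds]
    omega
  · rintro b l t ⟨l', hl', ht⟩
    have h2 := ht.pos
    have h3 := ht.endAddr
    rw [List.length_cons] at h2
    refine ⟨by simp only [Test.holds]; omega, 10, by rw [List.length_cons]; omega, ?_⟩
    refine (sieveBody_spec ht hz h1).mono le_rfl fun u hu => ⟨l' ++ [b], by simpa using hl', ?_⟩
    rw [List.foldl_append]
    exact hu

end

end RAM

namespace RAM

open MonCNF

variable {n : ℕ}

/-! ### Formulas as token lists -/

/-- The clauses of a formula as lists of positive natural numbers. -/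
def enc (C : MonCNF n) : List (List ℕ) := C.map (fun c => c.map (fun v => v.val + 1))

/-- The tokens of a formula. -/
def ftoks (C : MonCNF n) : List ℕ := toks (enc C)

theorem enc_pos (C : MonCNF n) : ∀ c ∈ enc C, 0 ∉ c := by
  intro c hc
  obtain ⟨c', -, rfl⟩ := List.mem_map.1 hc
  simp

theorem mem_map_val_succ (c : List (Fin n)) (v : Fin n) :
    v.val + 1 ∈ c.map (fun v => v.val + 1) ↔ v ∈ c := by
  simp [Fin.val_inj]

theorem filter_map_val_succ (c : List (Fin n)) (v : Fin n) :
    (c.map (fun v => v.val + 1)).filter (fun y => y ≠ v.val + 1) =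
      (c.filter (fun y => y ≠ v)).map (fun v => v.val + 1) := by
  rw [List.filter_map]
  congr 1
  refine List.filter_congr fun y _ => ?_
  simp [Fin.val_inj]

/-- Variables are shifted by one so that the token `0` is free to mark the ends of clauses. -/
theorem sieve_enc (C : MonCNF n) (v : Fin n) (k₀ k₁ : ℕ) :
    sieve (v.val + 1) k₀ k₁ (enc C) =
      enc ((C.filter (fun c => if v ∈ c then 0 < k₁ else 0 < k₀)).map
        (fun c => c.filter (fun y => y ≠ v))) := by
  unfold sieve enc
  rw [List.filter_map, List.map_map, List.map_map]
  have : C.filter ((fun c => if v.val + 1 ∈ c then decide (0 < k₁) else decide (0 < k₀)) ∘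
      fun c => c.map (fun v => v.val + 1)) =
      C.filter (fun c => if v ∈ c then decide (0 < k₁) else decide (0 < k₀)) := by
    refine List.filter_congr fun c _ => ?_
    simp only [Function.comp, mem_map_val_succ]
  rw [this]
  refine List.map_congr_left fun c _ => ?_
  exact filter_map_val_succ c v

theorem sieve_pinZero (C : MonCNF n) (v : Fin n) :
    sieve (v.val + 1) 1 1 (enc C) = enc (pinZero C v) := by
  rw [sieve_enc]
  simp [pinZero]

theorem sieve_clausesWithout (C : MonCNF n) (v : Fin n) :
    sieve (v.val + 1) 1 0 (enc C) = enc (clausesWithout C v) := by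
  rw [sieve_enc]
  congr 1
  have : C.filter (fun c => if v ∈ c then 0 < 0 else 0 < 1) = clausesWithout C v := by
    refine List.filter_congr fun c _ => ?_
    by_cases h : v ∈ c <;> simp [h]
  rw [this]
  conv_rhs => rw [← List.map_id (clausesWithout C v)]
  refine List.map_congr_left fun c hc => ?_
  rw [id, List.filter_eq_self]
  intro y hy
  simpa using ne_of_mem_of_not_mem hy (notMem_of_mem_clausesWithout c hc)

theorem sieve_clausesWith (C : MonCNF n) (v : Fin n) :
    sieve (v.val + 1) 0 1 (enc C) = enc (pinZero (clausesWith C v) v) := by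
  rw [sieve_enc, pinZero]
  have : C.filter (fun c => if v ∈ c then 0 < 1 else 0 < 0) = clausesWith C v := by
    refine List.filter_congr fun c _ => ?_
    by_cases h : v ∈ c <;> simp [h]
  rw [this]

/-- No variable has the token `0`, so deleting `0` and keeping everything is plain copying. -/
theorem sieve_copy (C : List (List ℕ)) (hC : ∀ c ∈ C, 0 ∉ c) : sieve 0 1 1 C = C := by
  unfold sieve
  simp only [Nat.lt_add_one, ite_self, decide_true, List.filter_true]
  conv_rhs => rw [← List.map_id C]
  refine List.map_congr_left fun c hc => ?_
  rw [id, List.filter_eq_self]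
  intro y hy
  simpa using ne_of_mem_of_not_mem hy (hC c hc)

theorem ftoks_append (C D : MonCNF n) : ftoks (C ++ D) = ftoks C ++ ftoks D := by
  simp [ftoks, toks, enc]

theorem ftoks_cons (c : List (Fin n)) (C : MonCNF n) :
    ftoks (c :: C) = c.map (fun v => v.val + 1) ++ 0 :: ftoks C := by
  simp [ftoks, toks, enc]

theorem length_ftoks_cons (c : List (Fin n)) (C : MonCNF n) :
    (ftoks (c :: C)).length = c.length + 1 + (ftoks C).length := by
  rw [ftoks_cons]; simp; omega

theorem length_ftoks_pinZero_le (C : MonCNF n) (v : Fin n) :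
    (ftoks (pinZero C v)).length ≤ (ftoks C).length := by
  induction C with
  | nil => simp [pinZero]
  | cons c C ih =>
    have h : pinZero (c :: C) v = c.filter (fun y => y ≠ v) :: pinZero C v := rfl
    rw [h, length_ftoks_cons, length_ftoks_cons]
    have := List.length_filter_le (fun y => decide (y ≠ v)) c
    omega

theorem length_ftoks_clauses (C : MonCNF n) (v : Fin n) :
    (ftoks (clausesWithout C v)).length + (ftoks (clausesWith C v)).length =
      (ftoks C).length := by
  induction C with
  | nil => rfl
  | cons c C ih =>
    rw [length_ftoks_cons, ← ih]
    by_cases h : v ∈ c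
    · have h1 : clausesWithout (c :: C) v = clausesWithout C v := by simp [clausesWithout, h]
      have h2 : clausesWith (c :: C) v = c :: clausesWith C v := by simp [clausesWith, h]
      rw [h1, h2, length_ftoks_cons]; omega
    · have h1 : clausesWithout (c :: C) v = c :: clausesWithout C v := by simp [clausesWithout, h]
      have h2 : clausesWith (c :: C) v = clausesWith C v := by simp [clausesWith, h]
      rw [h1, h2, length_ftoks_cons]; omega

theorem length_ftoks_node (C : MonCNF n) (v : Fin n) :
    (ftoks (clausesWithout C v)).length + (ftoks (pinZero (clausesWith C v) v)).length ≤
      (ftoks C).length := by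
  have := length_ftoks_clauses C v
  have := length_ftoks_pinZero_le (clausesWith C v) v
  omega

/-! ### The procedure for the truncated ratio -/

section code

open Instr Test Cmd NatOp RatOp

/-- Count the variables of the clause at the address in register `9`: register `17` becomes their
number plus `1`, and register `16` the address of the end mark. -/
def countCmd : Cmd := seqs [blk [op add 16 9 0, op add 17 1 0, load 18 16],
  .while (lt 0 18) (blk [op add 17 17 1, op add 16 16 1, load 18 16])]

/-- Compute the recursion depth for the clause in register `11`. -/
def clogCmd : Cmd := seqs [blk [op add 11 6 0, op add 18 1 0],
  .while (lt 18 17) (blk [op add 18 18 18, op add 18 18 18, op sub 11 11 1])]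

/-- Build the formula that consists of the clauses without the variable and of the clauses that
follow the current one. -/
def buildCmd : Cmd := seqs [blk [op add 16 16 1, op add 20 13 0, op add 21 15 0, op add 22 14 0,
    op add 23 0 0, op add 24 1 0, op add 25 1 0], sieveCmd,
  blk [op add 20 16 0, op add 21 10 0, op add 23 0 0, op add 24 1 0, op add 25 1 0], sieveCmd,
  blk [op add 12 22 0, rconst 2 1, load 18 9]]

end code

/-- The invariant of the procedure for the truncated ratio, after the splitting of the formula:
`A` are the clauses without the variable, `acc` the product over the clauses processed so far, and
`l` are the tokens still to be processed. -/
structure NodeCtx (s₀ : State) (A : MonCNF n) (L : ℕ) (acc : ℚ) (l : List ℕ) (s : State) :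
    Prop where
  reg : ∀ r, r < 5 ∨ 100 ≤ r → s.reg r = s₀.reg r
  rreg : ∀ r, 100 ≤ r → s.rreg r = s₀.rreg r
  mem : ∀ i, i < s₀.reg 2 → s.mem i = s₀.mem i
  rmem : ∀ i, i < s₀.reg 2 → s.rmem i = s₀.rmem i
  level : s.reg 6 = L
  pos : s.reg 9 + l.length = s.reg 10
  endAddr : s.reg 10 ≤ s.reg 14
  base : s.reg 13 = s₀.reg 2 + 20
  child : s.reg 14 = s₀.reg 2 + 20 + s₀.reg 4
  start : s.reg 15 = s.reg 13 + (ftoks A).length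
  start_le : s.reg 15 ≤ s.reg 9
  without : Seg s.mem (s.reg 13) (ftoks A)
  rest : Seg s.mem (s.reg 9) l
  acc : s.rreg 1 = acc

section

variable {P : Program} {B : ℕ} {s₀ s t : State} {A : MonCNF n} {L : ℕ} {acc : ℚ} {l : List ℕ}

theorem NodeCtx.set_reg (h : NodeCtx s₀ A L acc l s) {i : ℕ}
    (hi : i = 11 ∨ i = 12 ∨ 16 ≤ i ∧ i < 100) (v : ℕ) :
    NodeCtx s₀ A L acc l { s with reg := Function.update s.reg i v } := by
  have hne : ∀ j, (j < 11 ∨ j = 13 ∨ j = 14 ∨ j = 15 ∨ 100 ≤ j) →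
      Function.update s.reg i v j = s.reg j := fun j hj => Function.update_of_ne (by omega) _ _
  refine ⟨fun r hr => ?_, h.rreg, h.mem, h.rmem, ?_, ?_, ?_, ?_, ?_, ?_, ?_, ?_, ?_, h.acc⟩
  · exact (hne r (by omega)).trans (h.reg r hr)
  all_goals simp only [hne 6 (by omega), hne 9 (by omega), hne 10 (by omega), hne 13 (by omega),
    hne 14 (by omega), hne 15 (by omega)]
  exacts [h.level, h.pos, h.endAddr, h.base, h.child, h.start, h.start_le, h.without, h.rest]

theorem NodeCtx.set_rreg (h : NodeCtx s₀ A L acc l s) {i : ℕ} (hi : 2 ≤ i ∧ i < 100) (v : ℚ) :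
    NodeCtx s₀ A L acc l { s with rreg := Function.update s.rreg i v } :=
  ⟨h.reg, fun r hr => by
    change Function.update s.rreg i v r = _
    rw [Function.update_of_ne (by omega), h.rreg r hr],
    h.mem, h.rmem, h.level, h.pos, h.endAddr, h.base, h.child, h.start, h.start_le,
    h.without, h.rest,
    by
      change Function.update s.rreg i v 1 = _
      rw [Function.update_of_ne (by omega), h.acc]⟩

/-- All data of the node lie below the address in register `14`, where the area for the formulas of
the children begins; a filter loop that writes only from there on leaves them intact. -/
theorem NodeCtx.of_keeps (h : NodeCtx s₀ A L acc l s) (hk : Keeps s t)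
    (hm : ∀ i, i < s.reg 14 → t.mem i = s.mem i) : NodeCtx s₀ A L acc l t := by
  have hs := h.endAddr
  have hc := h.child
  have hp := h.pos
  have h1 := h.start
  have h2 := h.start_le
  have hr := hk.reg
  refine ⟨fun r hr' => ?_, fun r hr' => ?_, fun i hi => ?_, fun i hi => ?_, ?_, ?_, ?_, ?_, ?_, ?_,
    ?_, ?_, ?_, ?_⟩
  · rw [hr r (by omega), h.reg r hr']
  · rw [hk.rreg, h.rreg r hr']
  · rw [hm i (by omega), h.mem i hi]
  · rw [hk.rmem, h.rmem i hi]
  · rw [hr 6 (by omega), h.level]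
  · rw [hr 9 (by omega), hr 10 (by omega), h.pos]
  · rw [hr 10 (by omega), hr 14 (by omega)]; exact h.endAddr
  · rw [hr 13 (by omega), h.base]
  · rw [hr 14 (by omega), h.child]
  · rw [hr 13 (by omega), hr 15 (by omega), h.start]
  · rw [hr 9 (by omega), hr 15 (by omega)]; exact h.start_le
  · rw [hr 13 (by omega)]; exact h.without.congr fun i _ hi => hm i (by omega)
  · rw [hr 9 (by omega)]; exact h.rest.congr fun i _ hi => hm i (by omega)
  · rw [hk.rreg, h.acc]

theorem NodeCtx.advance {a : ℕ} (h : NodeCtx s₀ A L acc (a :: l) s) (h1 : s₀.reg 1 = 1) :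
    NodeCtx s₀ A L acc l
      { s with reg := Function.update s.reg 9 (s.reg 9 + s.reg 1) } := by
  have hp := h.pos
  rw [List.length_cons] at hp
  have hr := h.reg 1 (by norm_num)
  rw [h1] at hr
  have hs := h.start_le
  refine ⟨fun r hr => ?_, h.rreg, h.mem, h.rmem, ?_, ?_, ?_, ?_, ?_, ?_, ?_, ?_, ?_, h.acc⟩
  · change Function.update s.reg 9 _ r = _
    rw [Function.update_of_ne (by omega), h.reg r hr]
  · simpa using h.level
  · simp [hr]; omega
  · simpa using h.endAddr
  · simpa using h.base
  · simpa using h.child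
  · simpa using h.start
  · simp [hr]; omega
  · simpa using h.without
  · simpa [hr] using h.rest.2

theorem countCmd_spec {c : List ℕ} (hc : 0 ∉ c) (h : NodeCtx s₀ A L acc (c ++ 0 :: l) s)
    (hz : s₀.reg 0 = 0) (h1 : s₀.reg 1 = 1) :
    Tri P B countCmd s (4 * c.length + 4) (fun t => NodeCtx s₀ A L acc (c ++ 0 :: l) t ∧
      t.reg 16 = t.reg 9 + c.length ∧ t.reg 17 = c.length + 1) := by
  refine Tri.seqs_blk (K₂ := 4 * c.length + 1) (by simp) (by simp [OkAll, Instr.Ok]) ?_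
    (by simp; omega)
  -- `r` is the part of the clause not yet counted. Register `18` holds the token ahead, which is
  -- the end mark `0` when `r` is empty and then stops the loop.
  let I : List ℕ → State → Prop := fun r t => NodeCtx s₀ A L acc (c ++ 0 :: l) t ∧
    Seg t.mem (t.reg 16) (r ++ 0 :: l) ∧ t.reg 18 = (r ++ [0]).headI ∧ 0 ∉ r ∧
    t.reg 16 + r.length = t.reg 9 + c.length ∧ t.reg 17 + r.length = c.length + 1
  have r0 := (h.reg 0 (by norm_num)).trans hz
  have r1 := (h.reg 1 (by norm_num)).trans h1
  refine (Tri.while_list (P := P) (B := B) I (fun r => 4 * r.length + 1) ?_ (by simp) ?_ c _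
    ⟨((h.set_reg (i := 16) (by omega) _).set_reg (i := 17) (by omega) _).set_reg (i := 18)
      (by omega) _, ?_, ?_, hc, ?_, ?_⟩).mono le_rfl ?_
  · rintro t ⟨ht, -, h18, -⟩
    have r0 := (ht.reg 0 (by norm_num)).trans hz
    simp [Test.holds, r0, h18]
  · rintro a r t ⟨ht, hseg, h18, har, h16, h17⟩
    have r0 := (ht.reg 0 (by norm_num)).trans hz
    have r1 := (ht.reg 1 (by norm_num)).trans h1
    simp only [List.mem_cons, not_or] at har
    refine ⟨?_, 3, by simp; omega, Tri.blk (by simp) (by simp [OkAll, Instr.Ok]) (by simp)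
      ⟨((ht.set_reg (i := 17) (by omega) _).set_reg (i := 16) (by omega) _).set_reg (i := 18)
      (by omega) _, ?_, ?_, har.2, ?_, ?_⟩⟩
    · simp [Test.holds, r0, h18]; omega
    · simpa [execs, Instr.exec, NatOp.eval, r1] using hseg.2
    · have := hseg.2
      simp only [execs, Instr.exec, NatOp.eval, Function.update_self]
      simp [r1]
      cases r with
      | nil => exact this.1
      | cons b r => exact this.1
    · simp [execs, Instr.exec, NatOp.eval, r1] at h16 ⊢; omega
    · simp [execs, Instr.exec, NatOp.eval, r1] at h17 ⊢; omega
  · simpa [execs, Instr.exec, NatOp.eval, r0] using h.rest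
  · have := h.rest
    simp only [Instr.exec, NatOp.eval, Function.update_self]
    simp [r0]
    cases c with
    | nil => exact this.1
    | cons b r => exact this.1
  · simp [Instr.exec, NatOp.eval, r0]
  · simp [Instr.exec, NatOp.eval, r0, r1]; omega
  · rintro t ⟨ht, -, -, -, h16, h17⟩
    exact ⟨ht, by simpa using h16, by simpa using h17⟩

theorem clog_le_self (w : ℕ) : Nat.clog 4 (w + 1) ≤ w :=
  Nat.clog_le_of_le_pow (Nat.succ_le_of_lt (Nat.lt_pow_self (by norm_num)))

/-- Register `18` runs through the powers of `4`, by two doublings per round, until it reaches `w +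
1`; each round lowers the level by one, and the machine subtraction is truncated just as in the
recursion. -/
theorem clogCmd_spec {w : ℕ} (h : NodeCtx s₀ A L acc l s) (hz : s₀.reg 0 = 0)
    (h1 : s₀.reg 1 = 1) (h17 : s.reg 17 = w + 1) :
    Tri P B clogCmd s (4 * w + 3) (fun t => NodeCtx s₀ A L acc l t ∧
      t.reg 11 = L - Nat.clog 4 (w + 1) ∧ t.reg 16 = s.reg 16 ∧ t.reg 9 = s.reg 9) := by
  set K := Nat.clog 4 (w + 1) with hK
  have hKw : K ≤ w := clog_le_self w
  refine Tri.seqs_blk (K₂ := K * (3 + 1) + 1) (by simp) (by simp [OkAll, Instr.Ok]) ?_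
    (by simp; omega)
  have r0 := (h.reg 0 (by norm_num)).trans hz
  have r1 := (h.reg 1 (by norm_num)).trans h1
  let I : ℕ → State → Prop := fun m t => NodeCtx s₀ A L acc l t ∧ m ≤ K ∧
    t.reg 18 = 4 ^ (K - m) ∧ t.reg 11 = L - (K - m) ∧ t.reg 17 = w + 1 ∧ t.reg 16 = s.reg 16 ∧
    t.reg 9 = s.reg 9
  refine (Tri.while_nat (P := P) (B := B) I 3 ?_ ?_ K _
    ⟨(h.set_reg (i := 11) (by omega) _).set_reg (i := 18) (by omega) _, le_rfl, ?_, ?_, ?_, ?_,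
      ?_⟩).mono le_rfl ?_
  · rintro t ⟨-, -, h18, -, h17, -⟩
    simp only [Test.holds, h18, h17, Nat.sub_zero, not_lt]
    exact Nat.le_pow_clog (by norm_num) _
  · rintro m t ⟨ht, hm, h18, h11, h17, h16, h9⟩
    have r1 := (ht.reg 1 (by norm_num)).trans h1
    refine ⟨?_, Tri.blk (by simp) (by simp [OkAll, Instr.Ok]) (by simp)
      ⟨((ht.set_reg (i := 18) (by omega) _).set_reg (i := 18) (by omega) _).set_reg (i := 11)
      (by omega) _, by omega, ?_, ?_, ?_, ?_, ?_⟩⟩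
    · simp only [Test.holds, h18, h17]
      exact Nat.pow_lt_of_lt_clog (by omega)
    · simp [execs, Instr.exec, NatOp.eval, h18]
      rw [show K - m = K - (m + 1) + 1 by omega, pow_succ]; omega
    · simp [execs, Instr.exec, NatOp.eval, h11, r1]; omega
    · simpa [execs, Instr.exec, NatOp.eval] using h17
    · simpa [execs, Instr.exec, NatOp.eval] using h16
    · simpa [execs, Instr.exec, NatOp.eval] using h9
  · simp [Instr.exec, NatOp.eval, r0, r1]
  · simp [Instr.exec, NatOp.eval, r0, h.level]
  · simpa [execs, Instr.exec, NatOp.eval] using h17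
  · simp [Instr.exec, NatOp.eval]
  · simp [Instr.exec, NatOp.eval]
  · rintro t ⟨ht, -, -, h11, -, h16, h9⟩
    exact ⟨ht, by simpa using h11, h16, h9⟩

/-- Two copies in a row: first the clauses without the variable, then everything behind the end mark
of the current clause. The second copy continues at the write position of the first, which
concatenates the formulas. -/
theorem buildCmd_spec {v : List ℕ} {D : MonCNF n} {T : ℕ}
    (h : NodeCtx s₀ A L acc (v ++ 0 :: ftoks D) s) (hz : s₀.reg 0 = 0)
    (h1 : s₀.reg 1 = 1) (h16 : s.reg 16 = s.reg 9 + v.length)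
    (hT : (ftoks (A ++ D)).length ≤ T) (hB : bits 1 ≤ B) :
    Tri P B buildCmd s (11 * T + 21) (fun t => NodeCtx s₀ A L acc (v ++ 0 :: ftoks D) t ∧
      t.reg 11 = s.reg 11 ∧ Seg t.mem (t.reg 14) (ftoks (A ++ D)) ∧
      t.reg 12 = t.reg 14 + (ftoks (A ++ D)).length ∧ t.rreg 2 = 1 ∧
      t.reg 18 = (v ++ [0]).headI) := by
  have r0 := (h.reg 0 (by norm_num)).trans hz
  have r1 := (h.reg 1 (by norm_num)).trans h1
  rw [ftoks_append, List.length_append] at hT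
  rw [ftoks_append, List.length_append]
  have hlast := h.endAddr
  have hstart := h.start
  have hle := h.start_le
  have hpos := h.pos
  rw [List.length_append, List.length_cons] at hpos
  refine Tri.seqs_blk (K₂ := 11 * T + 14) (by simp) (by simp [OkAll, Instr.Ok]) ?_ (by simp; omega)
  have hc : NodeCtx s₀ A L acc (v ++ 0 :: ftoks D)
      (execs [.op .add 16 16 1, .op .add 20 13 0, .op .add 21 15 0, .op .add 22 14 0,
        .op .add 23 0 0, .op .add 24 1 0, .op .add 25 1 0] s) :=
    ((((((h.set_reg (i := 16) (by omega) _).set_reg (i := 20) (by omega) _).set_reg (i := 21)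
      (by omega) _).set_reg (i := 22) (by omega) _).set_reg (i := 23) (by omega) _).set_reg
      (i := 24) (by omega) _).set_reg (i := 25) (by omega) _
  obtain ⟨s1, hs1⟩ : ∃ s1, s1 = execs [.op .add 16 16 1, .op .add 20 13 0, .op .add 21 15 0,
    .op .add 22 14 0, .op .add 23 0 0, .op .add 24 1 0, .op .add 25 1 0] s := ⟨_, rfl⟩
  have v16 : s1.reg 16 = s.reg 9 + v.length + 1 := by
    simp [hs1, execs, Instr.exec, NatOp.eval, r0, r1, h16]
  have v20 : s1.reg 20 = s.reg 13 := by simp [hs1, execs, Instr.exec, NatOp.eval, r0]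
  have v21 : s1.reg 21 = s.reg 15 := by simp [hs1, execs, Instr.exec, NatOp.eval, r0]
  have v22 : s1.reg 22 = s.reg 14 := by simp [hs1, execs, Instr.exec, NatOp.eval, r0]
  have v23 : s1.reg 23 = 0 := by simp [hs1, execs, Instr.exec, NatOp.eval, r0]
  have v24 : s1.reg 24 = 1 := by simp [hs1, execs, Instr.exec, NatOp.eval, r0, r1]
  have v25 : s1.reg 25 = 1 := by simp [hs1, execs, Instr.exec, NatOp.eval, r0, r1]
  have v14 : s1.reg 14 = s.reg 14 := by simp [hs1, execs, Instr.exec]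
  have v9 : s1.reg 9 = s.reg 9 := by simp [hs1, execs, Instr.exec]
  have v10 : s1.reg 10 = s.reg 10 := by simp [hs1, execs, Instr.exec]
  have v11 : s1.reg 11 = s.reg 11 := by simp [hs1, execs, Instr.exec]
  have vm : s1.mem = s.mem := by simp [hs1, execs, Instr.exec]
  rw [← hs1] at hc ⊢
  clear hs1
  have q0 := (hc.reg 0 (by norm_num)).trans hz
  have q1 := (hc.reg 1 (by norm_num)).trans h1
  have key := sieveCmd_spec (P := P) (B := B) (s := s1) (enc A) (enc_pos A) q0 q1
    (by rw [vm, v20]; exact h.without) (by rw [v20, v21]; exact hstart)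
    (by rw [v21, v22]; omega)
  rw [v23, v24, v25, sieve_copy _ (enc_pos A), v22] at key
  refine Tri.seqs_cons (K₂ := 11 * (ftoks D).length + 11) key ?_
    (by change 11 * (ftoks A).length + 3 + _ ≤ _; omega)
  rintro t1 ⟨hk1, hA1, w22, hm1⟩
  have hc1 := hc.of_keeps hk1 (by rw [v14]; intro i hi; exact hm1 i hi)
  refine Tri.seqs_blk (K₂ := 11 * (ftoks D).length + 6) (by simp) (by simp [OkAll, Instr.Ok]) ?_
    (by simp; omega)
  have p0 := (hc1.reg 0 (by norm_num)).trans hz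
  have p1 := (hc1.reg 1 (by norm_num)).trans h1
  have hc2 : NodeCtx s₀ A L acc (v ++ 0 :: ftoks D)
      (execs [.op .add 20 16 0, .op .add 21 10 0, .op .add 23 0 0, .op .add 24 1 0,
        .op .add 25 1 0] t1) :=
    ((((hc1.set_reg (i := 20) (by omega) _).set_reg (i := 21)
      (by omega) _).set_reg (i := 23) (by omega) _).set_reg (i := 24) (by omega) _).set_reg
      (i := 25) (by omega) _
  obtain ⟨s2, hs2⟩ : ∃ s2, s2 = execs [.op .add 20 16 0, .op .add 21 10 0, .op .add 23 0 0,
    .op .add 24 1 0, .op .add 25 1 0] t1 := ⟨_, rfl⟩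
  have z20 : s2.reg 20 = s.reg 9 + v.length + 1 := by
    simp [hs2, execs, Instr.exec, NatOp.eval, p0, hk1.reg 16, v16]
  have z21 : s2.reg 21 = s.reg 10 := by
    simp [hs2, execs, Instr.exec, NatOp.eval, p0, hk1.reg 10, v10]
  have z22 : s2.reg 22 = s.reg 14 + (ftoks A).length := by
    simpa [hs2, execs, Instr.exec, NatOp.eval, ftoks] using w22
  have z23 : s2.reg 23 = 0 := by simp [hs2, execs, Instr.exec, NatOp.eval, p0]
  have z24 : s2.reg 24 = 1 := by simp [hs2, execs, Instr.exec, NatOp.eval, p0, p1]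
  have z25 : s2.reg 25 = 1 := by simp [hs2, execs, Instr.exec, NatOp.eval, p0, p1]
  have z14 : s2.reg 14 = s.reg 14 := by simp [hs2, execs, Instr.exec, hk1.reg 14, v14]
  have z9 : s2.reg 9 = s.reg 9 := by simp [hs2, execs, Instr.exec, hk1.reg 9, v9]
  have z11 : s2.reg 11 = s.reg 11 := by simp [hs2, execs, Instr.exec, hk1.reg 11, v11]
  have zm : s2.mem = t1.mem := by simp [hs2, execs, Instr.exec]
  rw [← hs2] at hc2 ⊢
  clear hs2
  have q0 := (hc2.reg 0 (by norm_num)).trans hz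
  have q1 := (hc2.reg 1 (by norm_num)).trans h1
  have hD : Seg s2.mem (s2.reg 20) (ftoks D) := by
    have := (seg_append.1 hc2.rest).2.2
    rwa [z9, ← z20] at this
  have key := sieveCmd_spec (P := P) (B := B) (s := s2) (enc D) (enc_pos D) q0 q1
    hD (by rw [z20, z21]; change _ = _ + (ftoks D).length; omega)
    (by rw [z21, z22]; omega)
  rw [z23, z24, z25, sieve_copy _ (enc_pos D), z22] at key
  refine Tri.seqs_cons (K₂ := 3) key ?_ (by change 11 * (ftoks D).length + 3 + _ ≤ _; omega)
  rintro t2 ⟨hk2, hD2, u22, hm2⟩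
  have hc3 := hc2.of_keeps hk2 (by rw [z14]; intro i hi; exact hm2 i (by omega))
  have n0 := (hc3.reg 0 (by norm_num)).trans hz
  have e14 : t2.reg 14 = s.reg 14 := by rw [hk2.reg 14 (by omega), z14]
  refine Tri.blk (by simp) (by simpa [OkAll, Instr.Ok] using hB) (by simp)
    ⟨((hc3.set_reg (i := 12) (by omega) _).set_rreg (i := 2) (by omega) _).set_reg (i := 18)
      (by omega) _, ?_, ?_, ?_, ?_, ?_⟩
  · simp [execs, Instr.exec, hk2.reg 11, z11]
  · simp only [execs, Instr.exec]
    rw [Function.update_of_ne (by norm_num), Function.update_of_ne (by norm_num), e14, seg_append]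
    refine ⟨hA1.congr fun i _ hi => ?_, hD2⟩
    rw [hm2 i hi, zm]
  · simp [execs, Instr.exec, NatOp.eval, n0, e14, u22, add_assoc, ftoks]
  · simp [execs, Instr.exec]
  · simp only [execs, Instr.exec, Function.update_self]
    rw [Function.update_of_ne (by norm_num)]
    have := hc3.rest
    cases v with
    | nil => exact this.1
    | cons b r => exact this.1

end

end RAM

namespace RAM

open MonCNF

variable {n : ℕ}

/-! ### Recursive calls -/

section code

open Instr Test Cmd NatOp RatOp

/-- Save a register in the frame. -/
def saveCode (r : ℕ) : List Instr := [const 30 r, op add 30 30 2, store 30 r]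

/-- Restore a register from the frame. -/
def loadCode (r : ℕ) : List Instr := [const 30 r, op add 30 30 2, load r 30]

/-- The registers that are saved before a recursive call. -/
def locals : List ℕ := [6, 9, 10, 11, 12, 13, 14, 15, 18]

/-- Process a variable of the current clause: call the procedure for it, multiply the product over
the clause by the conditional probability, and pin the variable to `0`. -/
def recCmd : Cmd := seqs [blk (locals.flatMap saveCode),
  blk [rstore 2 1, op add 30 2 1, rstore 30 2, op add 5 18 0, op add 6 11 0, op add 7 14 0,
    op add 8 12 0, op add 2 2 3],
  call 1,
  blk [op sub 2 2 3],
  blk (locals.flatMap loadCode),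
  blk [rconst 4 1, rop add 4 4 1, rop div 3 1 4, rload 1 2, op add 30 2 1, rload 2 30,
    rop mul 2 2 3, op add 20 14 0, op add 21 12 0, op add 22 14 0, op add 23 18 0, op add 24 1 0,
    op add 25 1 0],
  sieveCmd,
  blk [op add 12 22 0]]

end code

section

variable {P : Program} {B : ℕ} {s₀ s t : State} {A D : MonCNF n} {v : Fin n} {L L' T κ : ℕ}
  {acc p : ℚ} {l : List ℕ}

theorem execs_append (is js : List Instr) (s : State) :
    execs (is ++ js) s = execs js (execs is s) := by
  induction is generalizing s with
  | nil => rfl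
  | cons i is ih => exact ih _

/-- Register `r` goes to cell `r` of the frame. Register `30` holds the address and hence cannot be
saved itself. -/
theorem execs_save (rs : List ℕ) (h30 : 30 ∉ rs) (s : State) :
    (execs (rs.flatMap saveCode) s).rreg = s.rreg ∧
      (execs (rs.flatMap saveCode) s).rmem = s.rmem ∧
      (∀ i, i ≠ 30 → (execs (rs.flatMap saveCode) s).reg i = s.reg i) ∧
      (∀ a, (∀ r ∈ rs, a ≠ s.reg 2 + r) → (execs (rs.flatMap saveCode) s).mem a = s.mem a) ∧
      ∀ r ∈ rs, (execs (rs.flatMap saveCode) s).mem (s.reg 2 + r) = s.reg r := by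
  induction rs generalizing s with
  | nil => simp [execs]
  | cons r rs ih =>
    simp only [List.mem_cons, not_or] at h30
    rw [List.flatMap_cons, execs_append]
    obtain ⟨s1, hs1⟩ : ∃ s1, s1 = execs (saveCode r) s := ⟨_, rfl⟩
    have e1 : s1.rreg = s.rreg := by simp [hs1, saveCode, execs, Instr.exec]
    have e2 : s1.rmem = s.rmem := by simp [hs1, saveCode, execs, Instr.exec]
    have e3 : ∀ i, i ≠ 30 → s1.reg i = s.reg i := by
      intro i hi
      simp [hs1, saveCode, execs, Instr.exec, hi]
    have e4 : s1.mem = Function.update s.mem (s.reg 2 + r) (s.reg r) := by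
      simp [hs1, saveCode, execs, Instr.exec, NatOp.eval, Ne.symm h30.1, add_comm]
    rw [← hs1]
    obtain ⟨f1, f2, f3, f4, f5⟩ := ih h30.2 s1
    rw [e3 2 (by norm_num)] at f4 f5
    refine ⟨f1.trans e1, f2.trans e2, fun i hi => (f3 i hi).trans (e3 i hi), ?_, ?_⟩
    · intro a ha
      rw [List.forall_mem_cons] at ha
      rw [f4 a ha.2, e4, Function.update_of_ne ha.1]
    · intro r' hr'
      by_cases h : r' ∈ rs
      · rw [f5 r' h, e3 r' (by rintro rfl; exact h30.2 h)]
      · have hr : r' = r := (List.mem_cons.1 hr').resolve_right h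
        subst hr
        rw [f4 _ (fun q hq hqe => h (by rwa [Nat.add_left_cancel hqe])), e4, Function.update_self]

theorem execs_load (rs : List ℕ) (h30 : 30 ∉ rs) (h2 : 2 ∉ rs) (s : State) :
    (execs (rs.flatMap loadCode) s).rreg = s.rreg ∧
      (execs (rs.flatMap loadCode) s).rmem = s.rmem ∧
      (execs (rs.flatMap loadCode) s).mem = s.mem ∧
      (∀ i, i ≠ 30 → i ∉ rs → (execs (rs.flatMap loadCode) s).reg i = s.reg i) ∧
      ∀ r ∈ rs, (execs (rs.flatMap loadCode) s).reg r = s.mem (s.reg 2 + r) := by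
  induction rs generalizing s with
  | nil => simp [execs]
  | cons r rs ih =>
    simp only [List.mem_cons, not_or] at h30 h2
    rw [List.flatMap_cons, execs_append]
    obtain ⟨s1, hs1⟩ : ∃ s1, s1 = execs (loadCode r) s := ⟨_, rfl⟩
    have e1 : s1.rreg = s.rreg := by simp [hs1, loadCode, execs, Instr.exec]
    have e2 : s1.rmem = s.rmem := by simp [hs1, loadCode, execs, Instr.exec]
    have e3 : ∀ i, i ≠ 30 → i ≠ r → s1.reg i = s.reg i := by
      intro i hi hir
      simp [hs1, loadCode, execs, Instr.exec, hi, hir]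
    have e4 : s1.mem = s.mem := by simp [hs1, loadCode, execs, Instr.exec]
    have e5 : s1.reg r = s.mem (s.reg 2 + r) := by
      simp [hs1, loadCode, execs, Instr.exec, NatOp.eval, add_comm]
    rw [← hs1]
    obtain ⟨f1, f2, f3, f4, f5⟩ := ih h30.2 h2.2 s1
    rw [e3 2 (by norm_num) h2.1, e4] at f5
    refine ⟨f1.trans e1, f2.trans e2, f3.trans e4, ?_, ?_⟩
    · intro i hi hir
      simp only [List.mem_cons, not_or] at hir
      rw [f4 i hi hir.2, e3 i hi hir.1]
    · intro r' hr'
      by_cases h : r' ∈ rs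
      · exact f5 r' h
      · have hr : r' = r := (List.mem_cons.1 hr').resolve_right h
        subst hr
        rw [f4 _ (Ne.symm h30.1) h, e5]

/-- The hypotheses under which the procedure for the truncated ratio is called. -/
structure RatPre (T : ℕ) (C : MonCNF n) (x : Fin n) (L : ℕ) (s : State) : Prop where
  zero : s.reg 0 = 0
  one : s.reg 1 = 1
  gap : T ≤ s.reg 4
  frame : s.reg 4 + T + 20 ≤ s.reg 3
  var : s.reg 5 = x + 1
  level : s.reg 6 = L
  inp : Seg s.mem (s.reg 7) (ftoks C)
  endAddr : s.reg 8 = s.reg 7 + (ftoks C).length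
  below : s.reg 8 ≤ s.reg 2
  size : (ftoks C).length ≤ T
  read : C.ReadFive

/-- What the procedure for the truncated ratio achieves. -/
structure RatPost (C : MonCNF n) (x : Fin n) (L N : ℕ) (s t : State) : Prop where
  val : t.rreg 1 = ratio C x L
  den : (ratio C x L).den ≤ 2 ^ N
  reg : ∀ r, r < 5 ∨ 100 ≤ r → t.reg r = s.reg r
  rreg : ∀ r, 100 ≤ r → t.rreg r = s.rreg r
  mem : ∀ i, i < s.reg 2 → t.mem i = s.mem i
  rmem : ∀ i, i < s.reg 2 → t.rmem i = s.rmem i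

/-- Between the start of the frame and its cell `20` the memory may change, since saved registers
are stored there; the formulas of the node lie between that cell and the area of the children. -/
theorem NodeCtx.transfer (h : NodeCtx s₀ A L acc l s)
    (hr : ∀ r, r < 5 ∨ 100 ≤ r ∨ r ∈ locals → t.reg r = s.reg r)
    (hq : ∀ r, 100 ≤ r → t.rreg r = s.rreg r) (h1 : t.rreg 1 = s.rreg 1)
    (hm : ∀ i, i < s₀.reg 2 ∨ s₀.reg 2 + 20 ≤ i ∧ i < s.reg 14 → t.mem i = s.mem i)
    (hrm : ∀ i, i < s₀.reg 2 → t.rmem i = s.rmem i) : NodeCtx s₀ A L acc l t := by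
  have hs := h.endAddr
  have hc := h.child
  have hp := h.pos
  have g1 := h.start
  have g2 := h.start_le
  have g3 := h.base
  have e6 := hr 6 (by simp [locals])
  have e9 := hr 9 (by simp [locals])
  have e10 := hr 10 (by simp [locals])
  have e13 := hr 13 (by simp [locals])
  have e14 := hr 14 (by simp [locals])
  have e15 := hr 15 (by simp [locals])
  refine ⟨fun r hr' => ?_, fun r hr' => ?_, fun i hi => ?_, fun i hi => ?_, ?_, ?_, ?_, ?_, ?_, ?_,
    ?_, ?_, ?_, ?_⟩
  · rw [hr r (by omega), h.reg r hr']
  · rw [hq r hr', h.rreg r hr']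
  · rw [hm i (by omega), h.mem i hi]
  · rw [hrm i hi, h.rmem i hi]
  · rw [e6, h.level]
  · rw [e9, e10, h.pos]
  · rw [e10, e14]; exact h.endAddr
  · rw [e13, h.base]
  · rw [e14, h.child]
  · rw [e13, e15, h.start]
  · rw [e9, e15]; exact h.start_le
  · rw [e13]; exact h.without.congr fun i h1 h2 => hm i (by omega)
  · rw [e9]; exact h.rest.congr fun i h1 h2 => hm i (by omega)
  · rw [h1, h.acc]

/-- The callee works in the next frame, which starts above the formula passed to it, so everything
the caller needs survives below. The accumulated products are saved in rational memory at the first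
two addresses of the frame. After the return the formula of the child is pinned in place. -/
theorem recCmd_spec (h : NodeCtx s₀ A L acc l s) (hz : s₀.reg 0 = 0) (h1 : s₀.reg 1 = 1)
    (hgap : T ≤ s₀.reg 4) (hframe : s₀.reg 4 + T + 20 ≤ s₀.reg 3)
    (hD : Seg s.mem (s.reg 14) (ftoks D)) (h12 : s.reg 12 = s.reg 14 + (ftoks D).length)
    (hT : (ftoks D).length ≤ T) (hR : D.ReadFive) (h18 : s.reg 18 = v + 1) (h11 : s.reg 11 = L')
    (hp : s.rreg 2 = p)
    (hcall : ∀ s', RatPre T D v L' s' → Tri P B (.call 1) s' κ (RatPost D v L' κ s'))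
    (hb1 : bits 1 ≤ B) (hb2 : bits (1 + ratio D v L') ≤ B)
    (hb3 : bits (ratio D v L' / (1 + ratio D v L')) ≤ B)
    (hb4 : bits (p * (ratio D v L' / (1 + ratio D v L'))) ≤ B) :
    Tri P B recCmd s (κ + 11 * T + 80) (fun t => NodeCtx s₀ A L acc l t ∧ t.reg 11 = L' ∧
      Seg t.mem (t.reg 14) (ftoks (pinZero D v)) ∧
      t.reg 12 = t.reg 14 + (ftoks (pinZero D v)).length ∧
      t.rreg 2 = p * (ratio D v L' / (1 + ratio D v L'))) := by
  have r0 := (h.reg 0 (by norm_num)).trans hz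
  have r1 := (h.reg 1 (by norm_num)).trans h1
  have r2 := h.reg 2 (by norm_num)
  have r3 := h.reg 3 (by norm_num)
  have r4 := h.reg 4 (by norm_num)
  have hchild := h.child
  have h30 : 30 ∉ locals := by simp [locals]
  have h2 : 2 ∉ locals := by simp [locals]
  -- save
  refine Tri.seqs_blk (K₂ := κ + 11 * T + 53) (by simp [locals, saveCode])
    (by simp [locals, saveCode, OkAll, Instr.Ok]) ?_ (by simp [locals, saveCode]; omega)
  obtain ⟨a1, a2, a3, a4, a5⟩ := execs_save locals h30 s
  generalize execs (locals.flatMap saveCode) s = s1 at *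
  -- arguments
  refine Tri.seqs_blk (K₂ := κ + 11 * T + 45) (by simp) (by simp [OkAll, Instr.Ok]) ?_
    (by simp; omega)
  obtain ⟨s2, hs2⟩ : ∃ s2, s2 = execs [.rstore 2 1, .op .add 30 2 1, .rstore 30 2, .op .add 5 18 0,
    .op .add 6 11 0, .op .add 7 14 0, .op .add 8 12 0, .op .add 2 2 3] s1 := ⟨_, rfl⟩
  have b2 : s2.reg 2 = s₀.reg 2 + s₀.reg 3 := by
    simp [hs2, execs, Instr.exec, NatOp.eval, a3 2, a3 3, r2, r3]
  have b5 : s2.reg 5 = v + 1 := by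
    simp [hs2, execs, Instr.exec, NatOp.eval, a3 18, a3 0, h18, r0]
  have b6 : s2.reg 6 = L' := by
    simp [hs2, execs, Instr.exec, NatOp.eval, a3 11, a3 0, h11, r0]
  have b7 : s2.reg 7 = s.reg 14 := by
    simp [hs2, execs, Instr.exec, NatOp.eval, a3 14, a3 0, r0]
  have b8 : s2.reg 8 = s.reg 12 := by
    simp [hs2, execs, Instr.exec, NatOp.eval, a3 12, a3 0, r0]
  have blow : ∀ r, r ≠ 2 → (r < 5 ∨ 100 ≤ r) → s2.reg r = s.reg r := by
    intro r hr hr'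
    have : r ≠ 30 ∧ r ≠ 5 ∧ r ≠ 6 ∧ r ≠ 7 ∧ r ≠ 8 := by omega
    simp [hs2, execs, Instr.exec, this, hr, a3 r]
  have bq : s2.rreg = s.rreg := by simp [hs2, execs, Instr.exec, a1]
  have bm : s2.mem = s1.mem := by simp [hs2, execs, Instr.exec]
  have brm : s2.rmem = Function.update (Function.update s.rmem (s₀.reg 2) acc)
      (s₀.reg 2 + 1) p := by
    simp [hs2, execs, Instr.exec, NatOp.eval, a1, a2, a3 2, a3 1, r1, r2, hp, h.acc]
  rw [← hs2]
  clear hs2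
  have hmem1 : ∀ i, i < s₀.reg 2 ∨ s₀.reg 2 + 20 ≤ i → s1.mem i = s.mem i := by
    intro i hi
    refine a4 i fun r hr => ?_
    have : 6 ≤ r ∧ r ≤ 18 := by
      simp only [locals, List.mem_cons, List.not_mem_nil, or_false] at hr; omega
    omega
  have hpre : RatPre T D v L' s2 := by
    refine ⟨?_, ?_, ?_, ?_, b5, b6, ?_, ?_, ?_, hT, hR⟩
    · rw [blow 0 (by omega) (by omega), r0]
    · rw [blow 1 (by omega) (by omega), r1]
    · rw [blow 4 (by omega) (by omega), r4]; exact hgap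
    · rw [blow 4 (by omega) (by omega), blow 3 (by omega) (by omega), r3, r4]; exact hframe
    · rw [b7, bm]
      exact hD.congr fun i hi _ => hmem1 i (by omega)
    · rw [b7, b8, h12]
    · rw [b8, b2, h12]; omega
  refine Tri.seqs_cons (K₂ := 11 * T + 45) (hcall s2 hpre) (fun t ht => ?_) (by omega)
  -- return
  have c2 : t.reg 2 = s₀.reg 2 + s₀.reg 3 := by rw [ht.reg 2 (by omega), b2]
  have c3 : t.reg 3 = s₀.reg 3 := by rw [ht.reg 3 (by omega), blow 3 (by omega) (by omega), r3]
  have cmem : ∀ i, i < s₀.reg 2 + s₀.reg 3 → t.mem i = s1.mem i := by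
    intro i hi; rw [ht.mem i (by omega), bm]
  have crmem : ∀ i, i < s₀.reg 2 + s₀.reg 3 → t.rmem i = s2.rmem i := by
    intro i hi; rw [ht.rmem i (by omega)]
  refine Tri.seqs_blk (K₂ := 11 * T + 44) (by simp) (by simp [OkAll, Instr.Ok]) ?_ (by simp; omega)
  obtain ⟨t1, ht1⟩ : ∃ t1, t1 = execs [.op .sub 2 2 3] t := ⟨_, rfl⟩
  have d2 : t1.reg 2 = s₀.reg 2 := by simp [ht1, execs, Instr.exec, NatOp.eval, c2, c3]
  have dr : ∀ r, r ≠ 2 → t1.reg r = t.reg r := by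
    intro r hr; simp [ht1, execs, Instr.exec, hr]
  have dm : t1.mem = t.mem := by simp [ht1, execs, Instr.exec]
  have dq : t1.rreg = t.rreg := by simp [ht1, execs, Instr.exec]
  have drm : t1.rmem = t.rmem := by simp [ht1, execs, Instr.exec]
  rw [← ht1]
  clear ht1
  refine Tri.seqs_blk (K₂ := 11 * T + 17) (by simp [locals, loadCode])
    (by simp [locals, loadCode, OkAll, Instr.Ok]) ?_ (by simp [locals, loadCode]; omega)
  obtain ⟨e1, e2, e3, e4, e5⟩ := execs_load locals h30 h2 t1
  generalize execs (locals.flatMap loadCode) t1 = t2 at *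
  have eloc : ∀ r ∈ locals, t2.reg r = s.reg r := by
    intro r hr
    have : r ≤ 18 := by
      simp only [locals, List.mem_cons, List.not_mem_nil, or_false] at hr; omega
    rw [e5 r hr, d2, dm, cmem _ (by omega), ← r2, a5 r hr]
  have elow : ∀ r, r < 5 ∨ 100 ≤ r → t2.reg r = s.reg r := by
    intro r hr
    have hrl : r ∉ locals := by
      simp only [locals, List.mem_cons, List.not_mem_nil, or_false]; omega
    rw [e4 r (by omega) hrl]
    by_cases hr2 : r = 2
    · subst hr2; rw [d2, r2]
    · rw [dr r hr2, ht.reg r hr, blow r hr2 hr]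
  have ereg : ∀ r, r < 5 ∨ 100 ≤ r ∨ r ∈ locals → t2.reg r = s.reg r := by
    rintro r (hr | hr | hr)
    exacts [elow r (Or.inl hr), elow r (Or.inr hr), eloc r hr]
  have e14 := ereg 14 (by simp [locals])
  have e12 := ereg 12 (by simp [locals])
  have e18 := ereg 18 (by simp [locals])
  have e11 := ereg 11 (by simp [locals])
  have e00 := (ereg 0 (by omega)).trans r0
  have e01 := (ereg 1 (by omega)).trans r1
  have e02 := (ereg 2 (by omega)).trans r2
  have eval : t2.rreg 1 = ratio D v L' := by rw [e1, dq, ht.val]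
  have emem : ∀ i, i < s₀.reg 2 ∨ s₀.reg 2 + 20 ≤ i ∧ i < s₀.reg 2 + s₀.reg 3 →
      t2.mem i = s.mem i := by
    intro i hi
    rw [e3, dm, cmem i (by omega), hmem1 i (by omega)]
  have erm0 : t2.rmem (s₀.reg 2) = acc := by
    rw [e2, drm, crmem _ (by omega), brm, Function.update_of_ne (by omega), Function.update_self]
  have erm1 : t2.rmem (s₀.reg 2 + 1) = p := by
    rw [e2, drm, crmem _ (by omega), brm, Function.update_self]
  have erm : ∀ i, i < s₀.reg 2 → t2.rmem i = s.rmem i := by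
    intro i hi
    rw [e2, drm, crmem _ (by omega), brm, Function.update_of_ne (by omega),
      Function.update_of_ne (by omega)]
  have eq100 : ∀ r, 100 ≤ r → t2.rreg r = s.rreg r := by
    intro r hr
    rw [e1, dq, ht.rreg r hr, bq]
  -- the rational numbers
  refine Tri.seqs_blk (K₂ := 11 * T + 4) (by simp) ?_ ?_ (by simp; omega)
  · have e : (1 : ℚ) + ratio D v L' = 1 + ratio D v L' := rfl
    simp [OkAll, Instr.Ok, Instr.exec, RatOp.eval, NatOp.eval, eval, e02, e01, erm0, erm1, hb1,
      hb2, hb3, hb4]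
  obtain ⟨t3, ht3⟩ : ∃ t3, t3 = execs [.rconst 4 1, .rop .add 4 4 1, .rop .div 3 1 4, .rload 1 2,
    .op .add 30 2 1, .rload 2 30, .rop .mul 2 2 3, .op .add 20 14 0, .op .add 21 12 0,
    .op .add 22 14 0, .op .add 23 18 0, .op .add 24 1 0, .op .add 25 1 0] t2 := ⟨_, rfl⟩
  have f20 : t3.reg 20 = s.reg 14 := by
    simp [ht3, execs, Instr.exec, NatOp.eval, e00, e14]
  have f21 : t3.reg 21 = s.reg 12 := by
    simp [ht3, execs, Instr.exec, NatOp.eval, e00, e12]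
  have f22 : t3.reg 22 = s.reg 14 := by
    simp [ht3, execs, Instr.exec, NatOp.eval, e00, e14]
  have f23 : t3.reg 23 = v + 1 := by
    simp [ht3, execs, Instr.exec, NatOp.eval, e00, e18, h18]
  have f24 : t3.reg 24 = 1 := by
    simp [ht3, execs, Instr.exec, NatOp.eval, e00, e01]
  have f25 : t3.reg 25 = 1 := by
    simp [ht3, execs, Instr.exec, NatOp.eval, e00, e01]
  have freg : ∀ r, r < 20 ∨ 100 ≤ r → t3.reg r = t2.reg r := by
    intro r hr
    have : r ≠ 30 ∧ r ≠ 20 ∧ r ≠ 21 ∧ r ≠ 22 ∧ r ≠ 23 ∧ r ≠ 24 ∧ r ≠ 25 := by omega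
    simp [ht3, execs, Instr.exec, this]
  have fm : t3.mem = t2.mem := by simp [ht3, execs, Instr.exec]
  have frm : t3.rmem = t2.rmem := by simp [ht3, execs, Instr.exec]
  have fq1 : t3.rreg 1 = acc := by simp [ht3, execs, Instr.exec, e02, erm0]
  have fq2 : t3.rreg 2 = p * (ratio D v L' / (1 + ratio D v L')) := by
    simp [ht3, execs, Instr.exec, NatOp.eval, RatOp.eval, e02, e01, erm1, eval]
  have fq : ∀ r, 100 ≤ r → t3.rreg r = t2.rreg r := by
    intro r hr
    have : r ≠ 1 ∧ r ≠ 2 ∧ r ≠ 3 ∧ r ≠ 4 := by omega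
    simp [ht3, execs, Instr.exec, this]
  rw [← ht3]
  clear ht3
  have hc3 : NodeCtx s₀ A L acc l t3 := by
    refine h.transfer (fun r hr => ?_) (fun r hr => ?_) ?_ (fun i hi => ?_) (fun i hi => ?_)
    · rw [freg r ?_, ereg r hr]
      rcases hr with hr | hr | hr
      · omega
      · omega
      · simp only [locals, List.mem_cons, List.not_mem_nil, or_false] at hr; omega
    · rw [fq r hr, eq100 r hr]
    · rw [fq1, h.acc]
    · rw [fm, emem i (by omega)]
    · rw [frm, erm i hi]
  -- pin the variable
  have key := sieveCmd_spec (P := P) (B := B) (s := t3) (enc D) (enc_pos D)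
    (by rw [freg 0 (by omega), e00]) (by rw [freg 1 (by omega), e01])
    (by
      rw [f20, fm]
      exact hD.congr fun i hi hi' => emem i (by omega))
    (by rw [f20, f21]; exact h12) (by rw [f20, f22]; left; exact le_rfl)
  rw [f23, f24, f25, sieve_pinZero, f22] at key
  refine Tri.seqs_cons (K₂ := 1) key ?_ (by change 11 * (ftoks D).length + 3 + _ ≤ _; omega)
  rintro u ⟨hk, hu, hu22, hum⟩
  have g14 : t3.reg 14 = s.reg 14 := by rw [freg 14 (by omega), e14]
  have hcu := hc3.of_keeps hk (by rw [g14]; exact hum)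
  have u14 : u.reg 14 = s.reg 14 := by rw [hk.reg 14 (by omega), g14]
  have u0 : u.reg 0 = 0 := (hcu.reg 0 (by omega)).trans hz
  refine Tri.blk (by simp) (by simp [OkAll, Instr.Ok]) (by simp)
    ⟨hcu.set_reg (i := 12) (by omega) _, ?_, ?_, ?_, ?_⟩
  · simp [execs, Instr.exec, hk.reg 11, freg 11, e11, h11]
  · simp only [execs, Instr.exec]
    rw [Function.update_of_ne (by norm_num), u14]
    exact hu
  · simp [execs, Instr.exec, NatOp.eval, u0, u14, hu22, ftoks]
  · simp only [execs, Instr.exec]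
    rw [hk.rreg, fq2]

end

end RAM

namespace RAM

open MonCNF

variable {n : ℕ}

/-! ### Sizes of rational numbers -/

theorem bits_le_of_den_le {q : ℚ} {m : ℕ} (h0 : 0 ≤ q) (h2 : q ≤ 2) (hd : q.den ≤ 2 ^ m) :
    bits q ≤ 2 * m + 3 := by
  have h1 : q.num ≤ 2 * q.den := by
    have := Rat.num_div_den q
    have hpos : (0 : ℚ) < q.den := by exact_mod_cast q.den_pos
    have h3 : (q.num : ℚ) ≤ 2 * q.den := by
      rw [← div_le_iff₀ hpos, this]; exact h2
    exact_mod_cast h3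
  have h3 : 0 ≤ q.num := Rat.num_nonneg.2 h0
  have hpos : 0 < 2 ^ m := by positivity
  have h4 : Nat.size q.num.natAbs ≤ m + 2 := by
    rw [Nat.size_le, pow_add]
    generalize 2 ^ m = M at *
    omega
  have h5 : Nat.size q.den ≤ m + 1 := by
    rw [Nat.size_le, pow_succ]
    omega
  unfold bits
  omega

theorem den_mul_le {p q : ℚ} {a b : ℕ} (hp : p.den ≤ 2 ^ a) (hq : q.den ≤ 2 ^ b) :
    (p * q).den ≤ 2 ^ (a + b) := by
  rw [pow_add]
  exact (Nat.le_of_dvd (by positivity) (Rat.mul_den_dvd p q)).trans (Nat.mul_le_mul hp hq)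

theorem den_one_sub_le {p : ℚ} {a : ℕ} (hp : p.den ≤ 2 ^ a) : (1 - p).den ≤ 2 ^ a := by
  have h := Rat.add_den_dvd 1 (-p)
  rw [← sub_eq_add_neg] at h
  simp only [Rat.den_one, Rat.neg_den, one_mul] at h
  exact (Nat.le_of_dvd p.den_pos h).trans hp

theorem den_one_add_le {p : ℚ} {a : ℕ} (hp : p.den ≤ 2 ^ a) : (1 + p).den ≤ 2 ^ a := by
  have h := Rat.add_den_dvd 1 p
  simp only [Rat.den_one, one_mul] at h
  exact (Nat.le_of_dvd p.den_pos h).trans hp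

/-- If `r = a/b` then `r/(1+r) = a/(a+b)`, and `a ≤ b` bounds the new denominator by `2 b`; this
costs one binary digit. -/
theorem den_div_one_add_le {r : ℚ} {a : ℕ} (h0 : 0 ≤ r) (h1 : r ≤ 1) (hr : r.den ≤ 2 ^ a) :
    (r / (1 + r)).den ≤ 2 ^ (a + 1) := by
  have hpos : (0 : ℚ) < r.den := by exact_mod_cast r.den_pos
  have hn : 0 ≤ r.num := Rat.num_nonneg.2 h0
  have e : r / (1 + r) = ((r.num : ℤ) : ℚ) / ((r.num + r.den : ℤ) : ℚ) := by
    have h := Rat.num_div_den r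
    have : (r.num : ℚ) = r * r.den := (div_eq_iff hpos.ne').1 h
    push_cast
    rw [this]
    have h2 : (1 : ℚ) + r ≠ 0 := by linarith
    field_simp
    ring
  have h2 : ((r / (1 + r)).den : ℤ) ∣ r.num + r.den := by
    rw [e, ← Rat.divInt_eq_div]
    exact Rat.den_dvd _ _
  have h3 : r.num ≤ r.den := by
    have h := Rat.num_div_den r
    have h3 : (r.num : ℚ) ≤ r.den := by
      rw [← div_le_one hpos, h]; exact h1
    exact_mod_cast h3
  have h4 := Int.le_of_dvd (by have := r.den_pos; omega) h2
  rw [pow_succ]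
  omega

theorem den_le_of_mem {q : ℚ} (h : q = 0 ∨ q = 1) (a : ℕ) : q.den ≤ 2 ^ a := by
  rcases h with rfl | rfl <;> simpa using Nat.one_le_two_pow

/-! ### The loops of the procedure -/

section code

open Instr Test Cmd NatOp RatOp

/-- Process one variable of the current clause. -/
def varCmd : Cmd := seqs [blk [op add 9 9 1], ite (lt 0 6) recCmd (blk [rconst 2 0]),
  blk [load 18 9]]

/-- Process one clause. -/
def clauseCmd : Cmd := seqs [countCmd, clogCmd, buildCmd, .while (lt 0 18) varCmd,
  blk [op add 9 9 1, rconst 3 1, rop sub 3 3 2, rop mul 1 1 3]]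

/-- The procedure for the truncated ratio. -/
def ratCmd : Cmd := seqs [
  blk [const 20 20, op add 13 2 20, op add 20 7 0, op add 21 8 0, op add 22 13 0, op add 23 5 0,
    op add 24 1 0, op add 25 0 0], sieveCmd,
  blk [op add 15 22 0, op add 20 7 0, op add 21 8 0, op add 23 5 0, op add 24 0 0, op add 25 1 0],
  sieveCmd,
  blk [op add 10 22 0, op add 9 15 0, op add 14 13 4, rconst 1 1],
  .while (lt 9 10) clauseCmd]

end code

section

variable {P : Program} {B : ℕ} {s₀ s t : State} {A : MonCNF n} {L T κ : ℕ} {acc : ℚ}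

/-- The invariant of the loop over the variables of a clause. -/
structure VarInv (s₀ : State) (A : MonCNF n) (L T L' w kv M : ℕ) (acc P : ℚ) (l : List ℕ)
    (vs : List (Fin n)) (D : MonCNF n) (p : ℚ) (m : ℕ) (t : State) : Prop where
  ctx : NodeCtx s₀ A L acc (vs.map (fun v => v.val + 1) ++ 0 :: l) t
  depth : t.reg 11 = L'
  child : Seg t.mem (t.reg 14) (ftoks D)
  endAddr : t.reg 12 = t.reg 14 + (ftoks D).length
  size : (ftoks D).length ≤ T
  read : D.ReadFive
  deg : ∀ v ∈ vs, deg D v ≤ 4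
  reg : t.rreg 2 = p
  prod : p * clauseProd (truncProb L w) D vs = P
  tok : t.reg 18 = (vs.map (fun v : Fin n => v.val + 1) ++ [0]).headI
  nonneg : 0 ≤ p
  le_one : p ≤ 1
  den : p.den ≤ 2 ^ m
  exp : m + vs.length * kv ≤ M

theorem seg_getD (u : List ℕ) (f : ℕ → ℕ) (a : ℕ)
    (hf : ∀ i, i < u.length → f (a + i) = u.getD i 0) : Seg f a u := by
  induction u generalizing a with
  | nil => trivial
  | cons b u ih =>
    refine ⟨by simpa using hf 0 (by simp), ih (a + 1) fun i hi => ?_⟩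
    have := hf (i + 1) (by simpa using hi)
    rw [show a + 1 + i = a + (i + 1) by omega, this]
    simp

/-- The denominator bound in `RatPost` does not depend on the state, but it can be extracted from
the specification of a call only if some admissible state exists. -/
theorem exists_ratPre {D : MonCNF n} (hT : (ftoks D).length ≤ T) (hR : D.ReadFive) (v : Fin n) :
    ∃ s, RatPre T D v L s := by
  refine ⟨{ reg := fun i => [0, 1, (ftoks D).length, T + T + 20, T, v + 1, L, 0,
              (ftoks D).length].getD i 0
            mem := fun i => (ftoks D).getD i 0
            rreg := fun _ => 0, rmem := fun _ => 0 }, by simp, by simp, by simp, by simp, by simp,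
    by simp, ?_, by simp, by simp, hT, hR⟩
  exact seg_getD _ _ _ fun i _ => by simp

/-- Each variable multiplies the clause product by its conditional probability and adds `kv` to the
exponent that bounds the denominator; the budget `M` reserves this for all remaining variables. -/
theorem varCmd_spec {L' w kv M K : ℕ} {Q p : ℚ} {m : ℕ} {l : List ℕ} {v : Fin n}
    {vs : List (Fin n)} {D : MonCNF n} (hw : L' = L - Nat.clog 4 (w + 1))
    (h : VarInv s₀ A L T L' w kv M acc Q l (v :: vs) D p m s) (hz : s₀.reg 0 = 0)
    (h1 : s₀.reg 1 = 1) (hgap : T ≤ s₀.reg 4) (hframe : s₀.reg 4 + T + 20 ≤ s₀.reg 3)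
    (hcall : L ≠ 0 → ∀ (D : MonCNF n) (v : Fin n) (s' : State), MonCNF.deg D v ≤ 4 →
      RatPre T D v L' s' → Tri P B (.call 1) s' κ (RatPost D v L' κ s'))
    (hkv : L ≠ 0 → kv = κ + 1) (hB : 2 * M + 3 ≤ B) (hκ : L ≠ 0 → 2 * κ + 5 ≤ B)
    (hK1 : L = 0 → 4 ≤ K) (hK2 : L ≠ 0 → κ + 11 * T + 83 ≤ K) :
    Tri P B varCmd s K (fun t => ∃ D' p' m',
      VarInv s₀ A L T L' w kv M acc Q l vs D' p' m' t) := by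
  have hb0 : bits 0 ≤ B := (bits_le_of_den_le (m := M) (by norm_num) (by norm_num)
    (den_le_of_mem (by simp) _)).trans hB
  have hb1 : bits 1 ≤ B := (bits_le_of_den_le (m := M) (by norm_num) (by norm_num)
    (den_le_of_mem (by simp) _)).trans hB
  have hexp := h.exp
  rw [List.length_cons, add_mul, one_mul] at hexp
  have hctx := h.ctx.advance h1
  have hprod := h.prod
  rw [clauseProd] at hprod
  have hdeg := List.forall_mem_cons.1 h.deg
  have h18 := h.tok
  simp only [List.map_cons, List.cons_append, List.headI_cons] at h18
  obtain ⟨s1, hs1⟩ : ∃ s1, s1 = execs [.op .add 9 9 1] s := ⟨_, rfl⟩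
  have hc1 : NodeCtx s₀ A L acc (vs.map (fun v => v.val + 1) ++ 0 :: l) s1 := by
    rw [hs1]; exact hctx
  have v6 : s1.reg 6 = L := hc1.level
  have v0 : s1.reg 0 = 0 := (hc1.reg 0 (by norm_num)).trans hz
  have vr : ∀ r, r ≠ 9 → s1.reg r = s.reg r := by
    intro r hr; simp [hs1, execs, Instr.exec, hr]
  have vm : s1.mem = s.mem := by simp [hs1, execs, Instr.exec]
  have vq : s1.rreg = s.rreg := by simp [hs1, execs, Instr.exec]
  have hload : ∀ t, NodeCtx s₀ A L acc (vs.map (fun v => v.val + 1) ++ 0 :: l) t →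
      t.mem (t.reg 9) = (vs.map (fun v : Fin n => v.val + 1) ++ [0]).headI := by
    intro t ht
    have := ht.rest
    cases vs with
    | nil => exact this.1
    | cons b r => exact this.1
  refine Tri.mono (K := if L = 0 then 4 else κ + 11 * T + 83) (Q := fun t => ∃ D' p' m',
      VarInv s₀ A L T L' w kv M acc Q l vs D' p' m' t) ?_
        (by split_ifs with hL; exacts [hK1 hL, hK2 hL]) (fun _ => id)
  refine Tri.seqs_blk (K₂ := if L = 0 then 3 else κ + 11 * T + 82) (by simp)
    (by simp [OkAll, Instr.Ok]) ?_ (by simp; split_ifs <;> omega)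
  rw [← hs1]
  refine Tri.seqs_cons (K₁ := (if L = 0 then 1 else κ + 11 * T + 80) + 1) (K₂ := 1)
    (R := fun t => ∃ D' p' m', t.rreg 2 = p' ∧
      NodeCtx s₀ A L acc (vs.map (fun v => v.val + 1) ++ 0 :: l) t ∧
      t.reg 11 = L' ∧ Seg t.mem (t.reg 14) (ftoks D') ∧
      t.reg 12 = t.reg 14 + (ftoks D').length ∧ (ftoks D').length ≤ T ∧ D'.ReadFive ∧
      (∀ v ∈ vs, MonCNF.deg D' v ≤ 4) ∧ p' * clauseProd (truncProb L w) D' vs = Q ∧ 0 ≤ p' ∧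
      p' ≤ 1 ∧ p'.den ≤ 2 ^ m' ∧ m' + vs.length * kv ≤ M) ?_ ?_ (by split_ifs <;> omega)
  · refine Tri.ite (fun hb => ?_) (fun hb => ?_)
    · simp only [Test.holds, v6, v0] at hb
      have hL : L ≠ 0 := by omega
      rw [if_neg hL]
      have hkv' := hkv hL
      have hκ' := hκ hL
      have hr := ratio_mem_Icc D v L'
      have htp : truncProb L w D v = ratio D v L' / (1 + ratio D v L') := by
        rw [truncProb, if_neg hL, hw]
      rw [htp, ← mul_assoc] at hprod
      have ht0 : 0 ≤ ratio D v L' / (1 + ratio D v L') := div_nonneg hr.1 (by linarith)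
      have ht1 : ratio D v L' / (1 + ratio D v L') ≤ 1 :=
        div_le_one_of_le₀ (by linarith) (by linarith)
      have hp0 := mul_nonneg h.nonneg ht0
      have hp1 := mul_le_one₀ h.le_one ht0 ht1
      -- The bound is needed before the actual call, to justify the side conditions on digits; it
      -- comes from a call in an artificial state.
      have hden : (ratio D v L').den ≤ 2 ^ κ := by
        obtain ⟨s', hs'⟩ := exists_ratPre (L := L') h.size h.read v
        obtain ⟨k, t, -, -, ht⟩ := hcall hL D v s' hdeg.1 hs'
        exact ht.den
      have hden2 := den_mul_le h.den (den_div_one_add_le hr.1 hr.2 hden)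
      refine (recCmd_spec (D := D) (v := v) (L' := L') (T := T) (κ := κ) (p := p) hc1 hz h1 hgap
        hframe (by rw [vm, vr 14 (by norm_num)]; exact h.child)
        (by rw [vr 12 (by norm_num), vr 14 (by norm_num), h.endAddr]) h.size h.read
        (by rw [vr 18 (by norm_num), h18]) (by rw [vr 11 (by norm_num), h.depth])
        (by rw [vq, h.reg]) (fun s' hs' => hcall hL D v s' hdeg.1 hs') hb1
        ((bits_le_of_den_le (by linarith) (by linarith) (den_one_add_le hden)).trans (by omega))
        ((bits_le_of_den_le ht0 (by linarith) (den_div_one_add_le hr.1 hr.2 hden)).trans (by omega))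
        ((bits_le_of_den_le hp0 (by linarith) hden2).trans (by
          have : m + (κ + 1) ≤ M := by rw [← hkv']; omega
          omega))).mono le_rfl ?_
      rintro t ⟨ht, t11, tD, t12, t2⟩
      exact ⟨pinZero D v, _, m + (κ + 1), t2, ht, t11, tD, t12,
        (length_ftoks_pinZero_le D v).trans h.size, h.read.pinZero v,
        fun y hy => (deg_pinZero_le D v y).trans (hdeg.2 y hy), hprod, hp0, hp1, hden2,
        by rw [← hkv']; omega⟩
    · simp only [Test.holds, v6, v0] at hb
      have hL : L = 0 := by omega
      rw [if_pos hL]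
      -- At level `0` no call is made: the conditional probability counts as `0`, so the product
      -- becomes `0` and the formula need not be pinned any more.
      refine Tri.blk (by simp) (by simpa [OkAll, Instr.Ok] using hb0) (by simp)
        ⟨D, 0, m, ?_, hc1.set_rreg (i := 2) (by omega) _, ?_, ?_, ?_, h.size, h.read, hdeg.2,
          ?_, le_rfl, zero_le_one, den_le_of_mem (by simp) _, by omega⟩
      · simp [execs, Instr.exec]
      · simpa [execs, Instr.exec, vr 11] using h.depth
      · simpa [execs, Instr.exec, vr 14, vm] using h.child
      · simpa [execs, Instr.exec, vr 14, vr 12] using h.endAddr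
      · rw [← hprod]; simp [truncProb, hL]
  · rintro t ⟨D', p', m', t2, ht, t11, tD, t12, tT, tR, tdeg, tprod, tp0, tp1, tden, texp⟩
    refine Tri.blk (by simp) (by simp [OkAll, Instr.Ok]) (by simp)
      ⟨D', p', m', ht.set_reg (i := 18) (by omega) _, ?_, ?_, ?_, tT, tR, tdeg, t2, tprod, ?_, tp0,
        tp1, tden, texp⟩
    · simpa [execs, Instr.exec] using t11
    · simpa [execs, Instr.exec] using tD
    · simpa [execs, Instr.exec] using t12
    · simpa [execs, Instr.exec] using hload t ht

end

end RAM

namespace RAM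

open MonCNF

variable {n : ℕ}

/-! ### Correctness and cost of a clause and of a node -/

section

variable {P : Program} {B : ℕ} {s₀ s t : State} {A : MonCNF n} {L T : ℕ} {acc : ℚ}

theorem NodeCtx.set_acc {l : List ℕ} (h : NodeCtx s₀ A L acc l s) (q : ℚ) :
    NodeCtx s₀ A L q l { s with rreg := Function.update s.rreg 1 q } :=
  ⟨h.reg, fun r hr => by
    change Function.update s.rreg 1 q r = _
    rw [Function.update_of_ne (by omega), h.rreg r hr],
    h.mem, h.rmem, h.level, h.pos, h.endAddr, h.base, h.child, h.start, h.start_le,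
    h.without, h.rest,
    by
      change Function.update s.rreg 1 q 1 = _
      rw [Function.update_self]⟩

theorem clauseCmd_spec {κ m : ℕ} {c : List (Fin n)} {cs : MonCNF n}
    (h : NodeCtx s₀ A L acc (ftoks (c :: cs)) s) (hz : s₀.reg 0 = 0) (h1 : s₀.reg 1 = 1)
    (hgap : T ≤ s₀.reg 4) (hframe : s₀.reg 4 + T + 20 ≤ s₀.reg 3)
    (hR : ReadFive (A ++ c :: cs)) (hT : (ftoks (A ++ c :: cs)).length ≤ T)
    (hcall : L ≠ 0 → c.length ≠ 0 → ∀ (D : MonCNF n) (v : Fin n) (s' : State),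
      MonCNF.deg D v ≤ 4 → RatPre T D v (L - Nat.clog 4 (c.length + 1)) s' →
      Tri P B (.call 1) s' κ (RatPost D v (L - Nat.clog 4 (c.length + 1)) κ s'))
    (ha0 : 0 ≤ acc) (ha1 : acc ≤ 1) (hden : acc.den ≤ 2 ^ m)
    (hB : 2 * (m + c.length * (if L = 0 then 0 else κ + 1)) + 3 ≤ B)
    (hκ : L ≠ 0 → c.length ≠ 0 → 2 * κ + 5 ≤ B) :
    Tri P B clauseCmd s (19 * T + 33 + c.length * (if L = 0 then 5 else κ + 11 * T + 84))
      (fun t => NodeCtx s₀ A L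
        (acc * (1 - clauseProd (truncProb L c.length) (A ++ cs) c)) (ftoks cs) t ∧
        (acc * (1 - clauseProd (truncProb L c.length) (A ++ cs) c)).den ≤
          2 ^ (m + c.length * (if L = 0 then 0 else κ + 1))) := by
  have hb1 : bits 1 ≤ B := (bits_le_of_den_le (m := m) (by norm_num) (by norm_num)
    (den_le_of_mem (by simp) _)).trans (by omega)
  have hlen : (ftoks (A ++ cs)).length + c.length + 1 ≤ T := by
    rw [ftoks_append, List.length_append, length_ftoks_cons] at hT
    rw [ftoks_append, List.length_append]
    omega
  rw [ftoks_cons] at h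
  have hc0 : 0 ∉ c.map (fun v : Fin n => v.val + 1) := by simp
  refine Tri.seqs_cons (K₁ := 4 * c.length + 4) (K₂ := 15 * T + 29 + c.length *
    (if L = 0 then 5 else κ + 11 * T + 84))
    ((countCmd_spec hc0 h hz h1).mono (by simp) fun _ => id) ?_ (by omega)
  rintro s1 ⟨hs1, g16, g17⟩
  rw [List.length_map] at g16 g17
  refine Tri.seqs_cons (K₁ := 4 * c.length + 3) (K₂ := 11 * T + 26 + c.length *
    (if L = 0 then 5 else κ + 11 * T + 84))
    (clogCmd_spec hs1 hz h1 g17) ?_ (by omega)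
  rintro s2 ⟨hs2, h11, h16, h9⟩
  refine Tri.seqs_cons (K₁ := 11 * T + 21) (K₂ := 5 + c.length *
    (if L = 0 then 5 else κ + 11 * T + 84))
    (buildCmd_spec (T := T) hs2 hz h1 (by rw [h16, h9, g16, List.length_map]) (by omega) hb1) ?_
    (by omega)
  rintro s3 ⟨hs3, k11, kD, k12, k2, k18⟩
  let I : List (Fin n) → State → Prop := fun vs t => vs.length ≤ c.length ∧ ∃ D p m',
    VarInv s₀ A L T (L - Nat.clog 4 (c.length + 1)) c.length (if L = 0 then 0 else κ + 1)
      (c.length * (if L = 0 then 0 else κ + 1)) acc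
      (clauseProd (truncProb L c.length) (A ++ cs) c) (ftoks cs) vs D p m' t
  have hI : I c s3 := by
    refine ⟨le_rfl, A ++ cs, 1, 0, hs3, by rw [k11, h11], kD, k12, by omega, hR.of_cons.1,
      hR.of_cons.2, k2, one_mul _, k18, zero_le_one, le_rfl, by simp, by omega⟩
  refine Tri.seqs_cons (K₁ := 1 + c.length * (if L = 0 then 5 else κ + 11 * T + 84)) (K₂ := 4)
    (Tri.while_list I (fun vs => 1 + vs.length * (if L = 0 then 5 else κ + 11 * T + 84))
      ?_ (by simp) ?_ c s3 hI) ?_ (by omega)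
  · rintro t ⟨-, D, p, m', ht⟩
    have h18 := ht.tok
    have r0 := (ht.ctx.reg 0 (by norm_num)).trans hz
    simp [Test.holds, r0, h18]
  · rintro v vs t ⟨hvs, D, p, m', ht⟩
    have h18 := ht.tok
    have r0 := (ht.ctx.reg 0 (by norm_num)).trans hz
    rw [List.length_cons] at hvs
    refine ⟨by simp [Test.holds, r0, h18], if L = 0 then 4 else κ + 11 * T + 83, ?_, ?_⟩
    · rw [List.length_cons, add_mul, one_mul]; split_ifs <;> omega
    · refine (varCmd_spec rfl ht hz h1 hgap hframe (fun hL => hcall hL (by omega))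
        (fun hL => by rw [if_neg hL]) (by omega) (fun hL => hκ hL (by omega))
        (fun hL => by rw [if_pos hL]) (fun hL => by rw [if_neg hL])).mono le_rfl ?_
      rintro u ⟨D', p', m'', hu⟩
      exact ⟨by omega, D', p', m'', hu⟩
  · rintro t ⟨-, D, p, m', ht⟩
    have hp := ht.prod
    rw [clauseProd, mul_one] at hp
    have hexp := ht.exp
    simp only [List.length_nil, zero_mul, add_zero] at hexp
    have hp0 := ht.nonneg
    have hp1 := ht.le_one
    have hpd := (ht.den).trans (Nat.pow_le_pow_right (by norm_num) hexp)
    have h2 := ht.reg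
    have hctx := ht.ctx.advance h1
    rw [hp] at hp0 hp1 hpd h2
    have hq := den_mul_le hden (den_one_sub_le hpd)
    refine Tri.blk (by simp) ?_ (by simp) ⟨?_, hq⟩
    · have a1 : bits (1 - clauseProd (truncProb L c.length) (A ++ cs) c) ≤ B :=
        (bits_le_of_den_le (by linarith) (by linarith) (den_one_sub_le hpd)).trans (by omega)
      have a2 := (bits_le_of_den_le (mul_nonneg ha0 (sub_nonneg.2 hp1))
        ((mul_le_one₀ ha1 (sub_nonneg.2 hp1) (by linarith)).trans (by norm_num)) hq).trans hB
      simpa [OkAll, Instr.Ok, Instr.exec, RatOp.eval, h2, ht.ctx.acc] using ⟨hb1, a1, a2⟩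
    · have := ((hctx.set_rreg (i := 3) (by omega) 1).set_rreg (i := 3) (by omega)
        (1 - clauseProd (truncProb L c.length) (A ++ cs) c)).set_acc
        (acc * (1 - clauseProd (truncProb L c.length) (A ++ cs) c))
      simpa [execs, Instr.exec, RatOp.eval, NatOp.eval, h2, ht.ctx.acc] using this

/-- A bound for the number of steps for a clause with `w` variables, where `E` accounts for the
copying of formulas and `κ` for the recursive calls. -/
def clauseCost (E : ℕ) (κ : ℕ → ℕ) (L w : ℕ) : ℕ :=
  E + w * (if L = 0 then 0 else E + κ (L - Nat.clog 4 (w + 1)))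

/-- A bound for the number of steps for a node of the recursion tree. -/
def nodeCost (E : ℕ) (κ : ℕ → ℕ) (L : ℕ) (W : MonCNF n) : ℕ :=
  E + (W.map fun c => clauseCost E κ L c.length).sum

/-- The running product times `nodeProd` of the unread clauses stays equal to the ratio, while the
denominator exponent plus the cost of the unread clauses stays at most `N`. Thus one number bounds
both time and digits. -/
theorem ratCmd_spec {E N : ℕ} {κ : ℕ → ℕ} {C : MonCNF n} {x : Fin n} (h : RatPre T C x L s)
    (hE : 84 * (T + 1) ≤ E) (hN : nodeCost E κ L ((C.clausesWith x).pinZero x) ≤ N)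
    (hB : 2 * N + 3 ≤ B)
    (hcall : ∀ l, l < L → ∀ (D : MonCNF n) (v : Fin n) (s' : State),
      MonCNF.deg D v ≤ 4 → RatPre T D v l s' →
      Tri P B (.call 1) s' (κ l) (RatPost D v l (κ l) s')) (hP : P[1]? = some ratCmd) :
    Tri P B (.call 1) s N (RatPost C x L N s) := by
  set A := C.clausesWithout x with hA
  set W := (C.clausesWith x).pinZero x with hW
  have hlen := length_ftoks_node C x
  rw [← hA, ← hW] at hlen
  have hsize := h.size
  have hgap := h.gap
  have hframe := h.frame
  have hbelow := h.below
  have hb1 : bits 1 ≤ B := (bits_le_of_den_le (m := N) (by norm_num) (by norm_num)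
    (den_le_of_mem (by simp) _)).trans hB
  unfold nodeCost at hN
  refine (Tri.call (K := 22 * T + 24 + 1 + (W.map fun c => clauseCost E κ L c.length).sum) hP
    ?_).mono (by omega) fun _ => id
  -- the clauses without the variable
  have r0 := h.zero
  have r1 := h.one
  refine Tri.seqs_blk (K₂ := 22 * T + 17 + (W.map fun c => clauseCost E κ L c.length).sum)
    (by simp) (by simp [OkAll, Instr.Ok]) ?_ (by simp; omega)
  obtain ⟨s1, hs1⟩ : ∃ s1, s1 = execs [.const 20 20, .op .add 13 2 20, .op .add 20 7 0,
    .op .add 21 8 0, .op .add 22 13 0, .op .add 23 5 0, .op .add 24 1 0, .op .add 25 0 0] s :=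
    ⟨_, rfl⟩
  have a13 : s1.reg 13 = s.reg 2 + 20 := by simp [hs1, execs, Instr.exec, NatOp.eval]
  have a20 : s1.reg 20 = s.reg 7 := by simp [hs1, execs, Instr.exec, NatOp.eval, r0]
  have a21 : s1.reg 21 = s.reg 8 := by simp [hs1, execs, Instr.exec, NatOp.eval, r0]
  have a22 : s1.reg 22 = s.reg 2 + 20 := by simp [hs1, execs, Instr.exec, NatOp.eval, r0]
  have a23 : s1.reg 23 = x + 1 := by simp [hs1, execs, Instr.exec, NatOp.eval, r0, h.var]
  have a24 : s1.reg 24 = 1 := by simp [hs1, execs, Instr.exec, NatOp.eval, r0, r1]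
  have a25 : s1.reg 25 = 0 := by simp [hs1, execs, Instr.exec, NatOp.eval, r0]
  have ar : ∀ r, r ≠ 13 → (r < 20 ∨ 100 ≤ r) → s1.reg r = s.reg r := by
    intro r hr hr'
    have : r ≠ 20 ∧ r ≠ 21 ∧ r ≠ 22 ∧ r ≠ 23 ∧ r ≠ 24 ∧ r ≠ 25 := by omega
    simp [hs1, execs, Instr.exec, hr, this]
  have am : s1.mem = s.mem := by simp [hs1, execs, Instr.exec]
  have aq : s1.rreg = s.rreg := by simp [hs1, execs, Instr.exec]
  have arm : s1.rmem = s.rmem := by simp [hs1, execs, Instr.exec]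
  rw [← hs1]
  clear hs1
  have key := sieveCmd_spec (P := P) (B := B) (s := s1) (enc C) (enc_pos C)
    (by rw [ar 0 (by omega) (by omega), r0]) (by rw [ar 1 (by omega) (by omega), r1])
    (by rw [a20, am]; exact h.inp) (by rw [a20, a21]; exact h.endAddr)
    (by rw [a21, a22]; omega)
  rw [a23, a24, a25, sieve_clausesWithout, a22] at key
  refine Tri.seqs_cons
    (K₂ := 11 * T + 14 + (W.map fun c => clauseCost E κ L c.length).sum) key ?_
    (by change 11 * (ftoks C).length + 3 + _ ≤ _; omega)
  rintro t1 ⟨hk1, hA1, b22, hm1⟩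
  have b22 : t1.reg 22 = s.reg 2 + 20 + (ftoks A).length := b22
  have hA1 : Seg t1.mem (s.reg 2 + 20) (ftoks A) := hA1
  have br : ∀ r, r ≠ 13 → (r < 20 ∨ 100 ≤ r) → t1.reg r = s.reg r := fun r hr hr' => by
    rw [hk1.reg r hr', ar r hr hr']
  have b13 : t1.reg 13 = s.reg 2 + 20 := by rw [hk1.reg 13 (by omega), a13]
  have p0 := (br 0 (by omega) (by omega)).trans r0
  have p1 := (br 1 (by omega) (by omega)).trans r1
  -- the clauses with the variable
  refine Tri.seqs_blk (K₂ := 11 * T + 8 + (W.map fun c => clauseCost E κ L c.length).sum)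
    (by simp) (by simp [OkAll, Instr.Ok]) ?_ (by simp; omega)
  obtain ⟨s2, hs2⟩ : ∃ s2, s2 = execs [.op .add 15 22 0, .op .add 20 7 0, .op .add 21 8 0,
    .op .add 23 5 0, .op .add 24 0 0, .op .add 25 1 0] t1 := ⟨_, rfl⟩
  have c15 : s2.reg 15 = s.reg 2 + 20 + (ftoks A).length := by
    simp [hs2, execs, Instr.exec, NatOp.eval, p0, b22]
  have c20 : s2.reg 20 = s.reg 7 := by simp [hs2, execs, Instr.exec, NatOp.eval, p0, br 7]
  have c21 : s2.reg 21 = s.reg 8 := by simp [hs2, execs, Instr.exec, NatOp.eval, p0, br 8]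
  have c22 : s2.reg 22 = s.reg 2 + 20 + (ftoks A).length := by
    simp [hs2, execs, Instr.exec, b22]
  have c23 : s2.reg 23 = x + 1 := by simp [hs2, execs, Instr.exec, NatOp.eval, p0, br 5, h.var]
  have c24 : s2.reg 24 = 0 := by simp [hs2, execs, Instr.exec, NatOp.eval, p0]
  have c25 : s2.reg 25 = 1 := by simp [hs2, execs, Instr.exec, NatOp.eval, p0, p1]
  have cr : ∀ r, r ≠ 15 → (r < 20 ∨ 100 ≤ r) → s2.reg r = t1.reg r := by
    intro r hr hr'
    have : r ≠ 20 ∧ r ≠ 21 ∧ r ≠ 23 ∧ r ≠ 24 ∧ r ≠ 25 := by omega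
    simp [hs2, execs, Instr.exec, hr, this]
  have cm : s2.mem = t1.mem := by simp [hs2, execs, Instr.exec]
  have cq : s2.rreg = t1.rreg := by simp [hs2, execs, Instr.exec]
  have crm : s2.rmem = t1.rmem := by simp [hs2, execs, Instr.exec]
  rw [← hs2]
  clear hs2
  have hlast := h.endAddr
  have key := sieveCmd_spec (P := P) (B := B) (s := s2) (enc C) (enc_pos C)
    (by rw [cr 0 (by omega) (by omega), p0]) (by rw [cr 1 (by omega) (by omega), p1])
    (by
      rw [c20, cm]
      change Seg t1.mem _ (ftoks C)
      exact h.inp.congr fun i _ hi => by rw [hm1 i (by omega), am])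
    (by rw [c20, c21]; exact h.endAddr) (by rw [c21, c22]; omega)
  rw [c23, c24, c25, sieve_clausesWith, c22] at key
  refine Tri.seqs_cons
    (K₂ := 5 + (W.map fun c => clauseCost E κ L c.length).sum) key ?_
    (by change 11 * (ftoks C).length + 3 + _ ≤ _; omega)
  rintro t2 ⟨hk2, hW2, d22, hm2⟩
  have d22 : t2.reg 22 = s.reg 2 + 20 + (ftoks A).length + (ftoks W).length := d22
  have hW2 : Seg t2.mem (s.reg 2 + 20 + (ftoks A).length) (ftoks W) := hW2
  have d15 : t2.reg 15 = s.reg 2 + 20 + (ftoks A).length := by rw [hk2.reg 15 (by omega), c15]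
  have dr : ∀ r, r ≠ 13 → r ≠ 15 → (r < 20 ∨ 100 ≤ r) → t2.reg r = s.reg r :=
    fun r hr h15 hr' => by rw [hk2.reg r hr', cr r h15 hr', br r hr hr']
  have d13 : t2.reg 13 = s.reg 2 + 20 := by
    rw [hk2.reg 13 (by omega), cr 13 (by omega) (by omega), b13]
  have q0 := (dr 0 (by omega) (by omega) (by omega)).trans r0
  have q4 := dr 4 (by omega) (by omega) (by omega)
  refine Tri.seqs_blk (K₂ := 1 + (W.map fun c => clauseCost E κ L c.length).sum)
    (by simp) (by simpa [OkAll, Instr.Ok] using hb1) ?_ (by simp; omega)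
  obtain ⟨s3, hs3⟩ : ∃ s3, s3 = execs [.op .add 10 22 0, .op .add 9 15 0, .op .add 14 13 4,
    .rconst 1 1] t2 := ⟨_, rfl⟩
  have hctx : NodeCtx s A L 1 (ftoks W) s3 := by
    refine ⟨fun r hr => ?_, fun r hr => ?_, fun i hi => ?_, fun i hi => ?_, ?_, ?_, ?_, ?_, ?_, ?_,
      ?_, ?_, ?_, ?_⟩
    · have : r ≠ 9 ∧ r ≠ 10 ∧ r ≠ 14 := by omega
      simp only [hs3, execs, Instr.exec]
      rw [Function.update_of_ne this.2.2, Function.update_of_ne this.1,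
        Function.update_of_ne this.2.1, dr r (by omega) (by omega) (by omega)]
    · have : r ≠ 1 := by omega
      simp only [hs3, execs, Instr.exec]
      rw [Function.update_of_ne this, hk2.rreg, cq, hk1.rreg, aq]
    · simp only [hs3, execs, Instr.exec]
      rw [hm2 i (by omega), cm, hm1 i (by omega), am]
    · simp only [hs3, execs, Instr.exec]
      rw [hk2.rmem, crm, hk1.rmem, arm]
    · simp [hs3, execs, Instr.exec, dr 6, h.level]
    · simp [hs3, execs, Instr.exec, NatOp.eval, q0, d22, d15]
    · simp [hs3, execs, Instr.exec, NatOp.eval, q0, d22, d13, q4]; omega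
    · simp [hs3, execs, Instr.exec, d13]
    · simp [hs3, execs, Instr.exec, NatOp.eval, d13, q4]
    · simp [hs3, execs, Instr.exec, d13, d15]
    · simp [hs3, execs, Instr.exec, NatOp.eval, d15, q0]
    · simp only [hs3, execs, Instr.exec]
      rw [Function.update_of_ne (by omega), Function.update_of_ne (by omega),
        Function.update_of_ne (by omega), d13]
      exact hA1.congr fun i _ hi => by rw [hm2 i (by omega), cm]
    · simpa [hs3, execs, Instr.exec, NatOp.eval, d15, q0] using hW2
    · simp [hs3, execs, Instr.exec]
  rw [← hs3]
  clear hs3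
  -- the loop over the clauses
  let I : MonCNF n → State → Prop := fun cs t => ∃ acc m, NodeCtx s A L acc (ftoks cs) t ∧
    acc * nodeProd (truncProb L) A cs = ratio C x L ∧ 0 ≤ acc ∧ acc ≤ 1 ∧ acc.den ≤ 2 ^ m ∧
    m + (cs.map fun c => clauseCost E κ L c.length).sum ≤ N ∧ ReadFive (A ++ cs) ∧
    (ftoks (A ++ cs)).length ≤ T
  have hI : I W s3 := ⟨1, 0, hctx, by rw [one_mul, ratio_eq_nodeProd], zero_le_one, le_rfl,
    by simp, by omega, h.read.node x, by rw [ftoks_append, List.length_append]; omega⟩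
  refine (Tri.while_list I (fun cs => 1 + (cs.map fun c => clauseCost E κ L c.length).sum)
    ?_ (by simp) ?_ W s3 hI).mono le_rfl ?_
  · rintro t ⟨acc, m, ht, -⟩
    have := ht.pos
    simp only [ftoks, enc, toks, List.map_nil, List.flatMap_nil, List.length_nil, add_zero] at this
    simp [Test.holds, this]
  · rintro c cs t ⟨acc, m, ht, hprod, ha0, ha1, hden, hexp, hR, hT⟩
    rw [List.map_cons, List.sum_cons] at hexp
    have hpos := ht.pos
    rw [length_ftoks_cons] at hpos
    have hwT : c.length ≤ T := by
      rw [ftoks_append, List.length_append, length_ftoks_cons] at hT; omega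
    have hT' : (ftoks (A ++ cs)).length ≤ T := by
      rw [ftoks_append, List.length_append, length_ftoks_cons] at hT
      rw [ftoks_append, List.length_append]; omega
    -- The growth of the denominator exponent at a clause is dominated by the step cost of that
    -- clause.
    have hcost : c.length * (if L = 0 then 0 else κ (L - Nat.clog 4 (c.length + 1)) + 1) + E ≤
        clauseCost E κ L c.length := by
      unfold clauseCost
      rw [add_comm]
      gcongr
      split_ifs <;> omega
    refine ⟨by simp only [Test.holds]; omega, 19 * T + 33 + c.length *
      (if L = 0 then 5 else κ (L - Nat.clog 4 (c.length + 1)) + 11 * T + 84), ?_, ?_⟩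
    · rw [List.map_cons, List.sum_cons]
      have : 19 * T + 34 + c.length *
          (if L = 0 then 5 else κ (L - Nat.clog 4 (c.length + 1)) + 11 * T + 84) ≤
          clauseCost E κ L c.length := by
        unfold clauseCost
        split_ifs with hL
        · omega
        · have : c.length * (κ (L - Nat.clog 4 (c.length + 1)) + 11 * T + 84) ≤
              c.length * (E + κ (L - Nat.clog 4 (c.length + 1))) :=
            Nat.mul_le_mul_left _ (by omega)
          omega
      omega
    · refine (clauseCmd_spec (κ := κ (L - Nat.clog 4 (c.length + 1))) ht r0 r1 hgap hframe hR hT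
        (fun hL hc => hcall _ (by have := clog_succ_pos hc; omega)) ha0 ha1 hden (by omega)
        (fun hL hc => ?_)).mono le_rfl ?_
      · rw [if_neg hL] at hcost
        have : 1 * (κ (L - Nat.clog 4 (c.length + 1)) + 1) ≤
          c.length * (κ (L - Nat.clog 4 (c.length + 1)) + 1) :=
          Nat.mul_le_mul_right _ (by omega)
        omega
      · rintro u ⟨hu, hud⟩
        have hfac : 0 ≤ clauseProd (truncProb L c.length) (A ++ cs) c ∧
            clauseProd (truncProb L c.length) (A ++ cs) c ≤ 1 := by
          refine clauseProd_mem_Icc (fun D v => ?_) _ _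
          unfold truncProb
          split_ifs
          · simp
          · have := ratio_mem_Icc D v (L - Nat.clog 4 (c.length + 1))
            exact ⟨div_nonneg this.1 (by linarith), div_le_one_of_le₀ (by linarith) (by linarith)⟩
        refine ⟨_, _, hu, ?_, mul_nonneg ha0 (by linarith),
          mul_le_one₀ ha1 (by linarith) (by linarith), hud, by omega, hR.of_cons.1, hT'⟩
        rw [mul_assoc]
        exact hprod
  · rintro t ⟨acc, m, ht, hprod, -, -, hden, hexp, -⟩
    rw [nodeProd, mul_one] at hprod
    subst hprod
    exact ⟨ht.acc, hden.trans (Nat.pow_le_pow_right (by norm_num) (by omega)), ht.reg, ht.rreg,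
      ht.mem, ht.rmem⟩

/-! ### The size of the recursion tree -/

/-- A bound for the number of steps of the procedure for a variable in at most four clauses. -/
def ratCost (E T L : ℕ) : ℕ := if L = 0 then 7 * E else 17 * (E * (T + 1)) * 13 ^ L

theorem ratCost_mono (E T : ℕ) {l L : ℕ} (h : l ≤ L) : ratCost E T l ≤ ratCost E T L := by
  unfold ratCost
  split_ifs with h1 h2 h2
  · exact le_rfl
  · calc 7 * E = 7 * (E * 1) * 1 := by ring
      _ ≤ 17 * (E * (T + 1)) * 13 ^ L := by
        gcongr
        · norm_num
        · omega
        · exact Nat.one_le_pow _ _ (by norm_num)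
  · omega
  · exact Nat.mul_le_mul_left _ (Nat.pow_le_pow_right (by norm_num) h)

/-- A clause with `⌈log₄(w+1)⌉ = k + 1` has `w ≤ 4 ^ (k+1) - 1 ≤ 3 · 13 ^ k` variables: long clauses
cost no more than three variables one level down. -/
theorem four_pow_le (k : ℕ) : 4 ^ (k + 1) ≤ 3 * 13 ^ k + 1 := by
  induction k with
  | zero => norm_num
  | succ k ih => rw [pow_succ, pow_succ 13]; omega

theorem clauseCost_le {E T L w : ℕ} (hL : L ≠ 0) (hw : w ≤ T) :
    clauseCost E (ratCost E T) L w ≤ E + 54 * (E * (T + 1) * 13 ^ (L - 1)) := by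
  unfold clauseCost
  rw [if_neg hL]
  refine Nat.add_le_add_left ?_ _
  rcases eq_or_ne w 0 with rfl | hw0
  · simp
  have hk := clog_succ_pos hw0
  have hpow := Nat.le_pow_clog (b := 4) (by norm_num) (w + 1)
  obtain ⟨k, hk'⟩ : ∃ k, Nat.clog 4 (w + 1) = k + 1 := ⟨_, (Nat.succ_pred_eq_of_pos hk).symm⟩
  rw [hk'] at hpow ⊢
  have h4 := four_pow_le k
  -- If the children are already at level `0`, the length `w` is not controlled by the levels and
  -- only `w ≤ T` is known. This is the origin of the factor `T + 1` in `ratCost`.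
  by_cases hz : L - (k + 1) = 0
  · rw [ratCost, if_pos hz]
    calc w * (E + 7 * E) = 8 * (E * w * 1) := by ring
      _ ≤ 54 * (E * (T + 1) * 13 ^ (L - 1)) := by
        gcongr
        · norm_num
        · omega
        · exact Nat.one_le_pow _ _ (by norm_num)
  · rw [ratCost, if_neg hz]
    have h1 : E ≤ E * (T + 1) * 13 ^ (L - (k + 1)) := by
      calc E = E * 1 * 1 := by ring
        _ ≤ _ := by
          gcongr
          · omega
          · exact Nat.one_le_pow _ _ (by norm_num)
    calc w * (E + 17 * (E * (T + 1)) * 13 ^ (L - (k + 1)))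
        ≤ (3 * 13 ^ k) * (18 * (E * (T + 1) * 13 ^ (L - (k + 1)))) := by
          gcongr
          · omega
          · nlinarith
      _ = 54 * (E * (T + 1) * (13 ^ k * 13 ^ (L - (k + 1)))) := by ring
      _ = 54 * (E * (T + 1) * 13 ^ (L - 1)) := by
          rw [← pow_add]; congr 3; omega

theorem nodeCost_le {E T L : ℕ} {W : MonCNF n} (hW : ∀ c ∈ W, c.length ≤ T) :
    nodeCost E (ratCost E T) L W ≤ E + W.length *
      (E + if L = 0 then 0 else 54 * (E * (T + 1) * 13 ^ (L - 1))) := by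
  unfold nodeCost
  gcongr
  rw [← smul_eq_mul]
  refine (List.sum_le_card_nsmul _ _ ?_).trans (by rw [List.length_map])
  intro k hk
  obtain ⟨c, hc, rfl⟩ := List.mem_map.1 hk
  split_ifs with hL
  · simp [clauseCost, hL]
  · exact clauseCost_le hL (hW c hc)

/-- With `X = E (T+1) 13 ^ (L-1)`, four clauses cost at most `5 X + 4 · 54 X = 221 X = 17 · 13 · X`,
so the coefficient `17` reproduces itself. -/
theorem nodeCost_le_ratCost {E T L : ℕ} {W : MonCNF n} (hW : ∀ c ∈ W, c.length ≤ T)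
    (h4 : W.length ≤ 4) : nodeCost E (ratCost E T) L W ≤ ratCost E T L := by
  refine (nodeCost_le hW).trans ?_
  refine (Nat.add_le_add_left (Nat.mul_le_mul_right _ h4) _).trans ?_
  unfold ratCost
  split_ifs with hL
  · omega
  · obtain ⟨l, rfl⟩ := Nat.exists_eq_succ_of_ne_zero hL
    have h1 : E ≤ E * (T + 1) * 13 ^ l := by
      calc E = E * 1 * 1 := by ring
        _ ≤ _ := by
          gcongr
          · omega
          · exact Nat.one_le_pow _ _ (by norm_num)
    rw [Nat.succ_sub_one, pow_succ]
    nlinarith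

/-- The fifth clause occurs only at the root and is absorbed by the factor `2`, outside the
induction. -/
theorem nodeCost_le_two_mul_ratCost {E T L : ℕ} {W : MonCNF n} (hW : ∀ c ∈ W, c.length ≤ T)
    (h5 : W.length ≤ 5) : nodeCost E (ratCost E T) L W ≤ 2 * ratCost E T L := by
  refine (nodeCost_le hW).trans ?_
  refine (Nat.add_le_add_left (Nat.mul_le_mul_right _ h5) _).trans ?_
  unfold ratCost
  split_ifs with hL
  · omega
  · obtain ⟨l, rfl⟩ := Nat.exists_eq_succ_of_ne_zero hL
    have h1 : E ≤ E * (T + 1) * 13 ^ l := by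
      calc E = E * 1 * 1 := by ring
        _ ≤ _ := by
          gcongr
          · omega
          · exact Nat.one_le_pow _ _ (by norm_num)
    rw [Nat.succ_sub_one, pow_succ]
    nlinarith

theorem length_le_of_mem {W : MonCNF n} {c : List (Fin n)} (hc : c ∈ W) :
    c.length ≤ (ftoks W).length := by
  induction W with
  | nil => simp at hc
  | cons d W ih =>
    rw [length_ftoks_cons]
    rcases List.mem_cons.1 hc with rfl | hc
    · omega
    · have := ih hc; omega

theorem RatPre.length_le {C : MonCNF n} {x : Fin n} (h : RatPre T C x L s) :
    ∀ c ∈ (C.clausesWith x).pinZero x, c.length ≤ T := by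
  intro c hc
  have := length_le_of_mem hc
  have := length_ftoks_node C x
  have := h.size
  omega

theorem call_ratCmd_spec {E : ℕ} {C : MonCNF n} {x : Fin n} (hE : 84 * (T + 1) ≤ E)
    (hP : P[1]? = some ratCmd) (hB : 2 * ratCost E T L + 3 ≤ B) (hx : deg C x ≤ 4)
    (h : RatPre T C x L s) :
    Tri P B (.call 1) s (ratCost E T L) (RatPost C x L (ratCost E T L) s) := by
  induction L using Nat.strong_induction_on generalizing C x s with
  | _ L ih =>
    refine ratCmd_spec h hE (nodeCost_le_ratCost h.length_le ?_) hB (fun l hl D v s' hD hs' =>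
      ih l hl (le_trans (by have := ratCost_mono E T hl.le; omega) hB) hD hs') hP
    rwa [pinZero, List.length_map]

theorem call_ratCmd_spec_root {E : ℕ} {C : MonCNF n} {x : Fin n} (hE : 84 * (T + 1) ≤ E)
    (hP : P[1]? = some ratCmd) (hB : 4 * ratCost E T L + 3 ≤ B) (h : RatPre T C x L s) :
    Tri P B (.call 1) s (2 * ratCost E T L) (RatPost C x L (2 * ratCost E T L) s) := by
  refine ratCmd_spec h hE (nodeCost_le_two_mul_ratCost h.length_le ?_) (by omega)
    (fun l hl D v s' hD hs' => call_ratCmd_spec hE hP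
      (le_trans (by have := ratCost_mono E T hl.le; omega) hB) hD hs') hP
  rw [pinZero, List.length_map]
  exact h.read.read x

end

end RAM

namespace RAM

open MonCNF

variable {n : ℕ}

/-! ### Reading the input -/

section code

open Instr Test Cmd NatOp RatOp

/-- Convert the variables of a clause to tokens. -/
def convCmd : Cmd := .while (lt 0 29)
  (blk [load 30 21, op add 30 30 1, store 20 30, op add 20 20 1, op add 21 21 1, op sub 29 29 1])

/-- Convert the code of the formula to its tokens in place. -/
def parseCmd : Cmd := seqs [
  blk [const 1 1, load 100 0, load 102 1, const 20 2],
  .while (lt 0 102) (seqs [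
    blk [load 29 20, op add 21 20 1], convCmd, blk [store 20 0, op add 20 20 1, op sub 102 102 1]])]

end code

section

variable {P : Program} {B : ℕ} {s₀ s t : State}

/-- The registers that are kept while the input is read. -/
structure ParseKeeps (s t : State) : Prop where
  zero : t.reg 0 = s.reg 0
  one : t.reg 1 = s.reg 1
  vars : t.reg 100 = s.reg 100
  count : t.reg 102 = s.reg 102
  rreg : t.rreg = s.rreg

/-- The conversion works in place: the cell of the length becomes free, each variable moves one cell
down, and the last cell is left for the end mark. -/
theorem convCmd_spec {a : ℕ} {o r : List ℕ} (c : List (Fin n)) (hz : s.reg 0 = 0)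
    (h1 : s.reg 1 = 1) (h29 : s.reg 29 = c.length) (hout : Seg s.mem a o)
    (h20 : s.reg 20 = a + o.length) (h21 : s.reg 21 = s.reg 20 + 1)
    (hin : Seg s.mem (s.reg 21) (c.map Fin.val ++ r)) :
    Tri P B convCmd s (1 + 7 * c.length) (fun t => ParseKeeps s t ∧
      Seg t.mem a (o ++ c.map (fun v => v.val + 1)) ∧
      t.reg 20 = a + o.length + c.length ∧ Seg t.mem (t.reg 20 + 1) r) := by
  let I : List (Fin n) → State → Prop := fun vs t => ParseKeeps s t ∧ ∃ d, d ++ vs = c ∧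
    Seg t.mem a (o ++ d.map (fun v => v.val + 1)) ∧ t.reg 20 = a + o.length + d.length ∧
    t.reg 21 = t.reg 20 + 1 ∧ t.reg 29 = vs.length ∧ Seg t.mem (t.reg 21) (vs.map Fin.val ++ r)
  refine (Tri.while_list I (fun vs => 1 + 7 * vs.length) ?_ (by simp) ?_ c s
    ⟨⟨rfl, rfl, rfl, rfl, rfl⟩, [], rfl, by simpa using hout, by simpa using h20, h21, h29,
      hin⟩).mono le_rfl ?_
  · rintro t ⟨hk, d, -, -, -, -, h29, -⟩
    simp [Test.holds, hk.zero, hz, h29]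
  · rintro v vs t ⟨hk, d, hd, ho, h20, h21, h29, hi⟩
    have r0 := hk.zero.trans hz
    have r1 := hk.one.trans h1
    refine ⟨by simp [Test.holds, r0, h29], 6, by simp; omega, Tri.blk (by simp)
      (by simp [OkAll, Instr.Ok]) (by simp) ⟨⟨?_, ?_, ?_, ?_, ?_⟩, d ++ [v],
        by simpa using hd, ?_, ?_, ?_,
        ?_, ?_⟩⟩
    · simp [execs, Instr.exec, hk.zero]
    · simp [execs, Instr.exec, hk.one]
    · simp [execs, Instr.exec, hk.vars]
    · simp [execs, Instr.exec, hk.count]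
    · simp [execs, Instr.exec, hk.rreg]
    · have hv : t.mem (t.reg 21) = v.val := hi.1
      have := ho.snoc (w := t.reg 20) (v := v.val + 1) (by simp [h20, add_assoc])
      simpa [execs, Instr.exec, NatOp.eval, r1, hv] using this
    · simp [execs, Instr.exec, NatOp.eval, r1, h20, add_assoc]
    · simp [execs, Instr.exec, NatOp.eval, r1, h21]
    · simp [execs, Instr.exec, NatOp.eval, r1, h29]
    · have hi2 : Seg t.mem (t.reg 21 + 1) (vs.map Fin.val ++ r) := hi.2
      have := hi2.update (w := t.reg 20) (v := t.mem (t.reg 21) + 1) (by omega)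
      simpa [execs, Instr.exec, NatOp.eval, r1] using this
  · rintro t ⟨hk, d, hd, ho, h20, h21, -, hi⟩
    rw [List.append_nil] at hd
    subst hd
    exact ⟨hk, ho, h20, by rw [← h21]; exact hi⟩

/-- The state after the input has been read. -/
structure Parsed (C : MonCNF n) (ε : ℚ) (s : State) : Prop where
  zero : s.reg 0 = 0
  one : s.reg 1 = 1
  vars : s.reg 100 = n
  endAddr : s.reg 20 = 2 + (ftoks C).length
  inp : Seg s.mem 2 (ftoks C)
  eps : s.rreg 0 = ε

theorem parseCmd_spec (C : MonCNF n) (ε : ℚ) :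
    Tri P B parseCmd (init C ε) (5 + 7 * (ftoks C).length) (Parsed C ε) := by
  refine Tri.seqs_blk (K₂ := 1 + 7 * (ftoks C).length) (by simp) (by simp [OkAll, Instr.Ok]) ?_
    (by simp; omega)
  let I : MonCNF n → State → Prop := fun cs t => ∃ d, d ++ cs = C ∧ t.reg 0 = 0 ∧ t.reg 1 = 1 ∧
    t.reg 100 = n ∧ t.rreg 0 = ε ∧ t.reg 20 = 2 + (ftoks d).length ∧ Seg t.mem 2 (ftoks d) ∧
    t.reg 102 = cs.length ∧ Seg t.mem (t.reg 20) (cs.flatMap fun c => c.length :: c.map Fin.val)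
  refine (Tri.while_list I (fun cs => 1 + 7 * (ftoks cs).length) ?_ (by simp [ftoks, enc, toks]) ?_
    C _ ⟨[], rfl, ?_, ?_, ?_, ?_, ?_, ?_, ?_, ?_⟩).mono le_rfl ?_
  · rintro t ⟨d, -, h0, -, -, -, -, -, h, -⟩
    simp [Test.holds, h0, h]
  · rintro c cs t ⟨d, hd, h0, h1, hn, hε, h20, ho, h102, hi⟩
    refine ⟨by simp [Test.holds, h0, h102], 7 * c.length + 6, by rw [length_ftoks_cons]; omega, ?_⟩
    refine Tri.seqs_blk (K₂ := 7 * c.length + 4) (by simp) (by simp [OkAll, Instr.Ok]) ?_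
      (by simp; omega)
    obtain ⟨s1, hs1⟩ : ∃ s1, s1 = execs [.load 29 20, .op .add 21 20 1] t := ⟨_, rfl⟩
    rw [List.flatMap_cons, List.cons_append] at hi
    have a29 : s1.reg 29 = c.length := by simp [hs1, execs, Instr.exec, hi.1]
    have a21 : s1.reg 21 = s1.reg 20 + 1 := by simp [hs1, execs, Instr.exec, NatOp.eval, h1]
    have a20 : s1.reg 20 = t.reg 20 := by simp [hs1, execs, Instr.exec]
    have ar : ∀ r, r ≠ 29 → r ≠ 21 → s1.reg r = t.reg r := fun r hr hr' => by
      simp [hs1, execs, Instr.exec, hr, hr']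
    have am : s1.mem = t.mem := by simp [hs1, execs, Instr.exec]
    have aq : s1.rreg = t.rreg := by simp [hs1, execs, Instr.exec]
    rw [← hs1]
    clear hs1
    refine Tri.seqs_cons (K₂ := 3) (convCmd_spec (a := 2) (o := ftoks d)
      (r := cs.flatMap fun c => c.length :: c.map Fin.val) c
      (by rw [ar 0 (by omega) (by omega), h0])
      (by rw [ar 1 (by omega) (by omega), h1]) a29 (by rw [am]; exact ho) (by rw [a20, h20]) a21
      (by rw [a21, a20, am]; exact hi.2)) ?_ (by omega)
    rintro t1 ⟨hk, ho1, b20, hi1⟩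
    have b0 := (hk.zero.trans (ar 0 (by omega) (by omega))).trans h0
    have b1 := (hk.one.trans (ar 1 (by omega) (by omega))).trans h1
    refine Tri.blk (by simp) (by simp [OkAll, Instr.Ok]) (by simp)
      ⟨d ++ [c], by simpa using hd, ?_, ?_, ?_, ?_, ?_, ?_, ?_, ?_⟩
    · simp [execs, Instr.exec, b0]
    · simp [execs, Instr.exec, b1]
    · simp [execs, Instr.exec, hk.vars, ar 100, hn]
    · simp [execs, Instr.exec, hk.rreg, aq, hε]
    · simp [execs, Instr.exec, NatOp.eval, b1, b20, ftoks, enc, toks]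
      omega
    · have := ho1.snoc (w := t1.reg 20) (v := 0) (by simp [b20, add_assoc])
      simpa [execs, Instr.exec, b0, ftoks, enc, toks] using this
    · simp [execs, Instr.exec, NatOp.eval, b1, hk.count, ar 102, h102]
    · have := hi1.update (w := t1.reg 20) (v := 0) (by omega)
      simpa [execs, Instr.exec, NatOp.eval, b0, b1] using this
  · simp [execs, Instr.exec, init]
  · simp [execs, Instr.exec, init]
  · simp [execs, Instr.exec, init, encode]
  · simp [execs, Instr.exec, init]
  · simp [execs, Instr.exec, init, ftoks, enc, toks]
  · simp [ftoks, enc, toks, Seg]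
  · simp [execs, Instr.exec, init, encode]
  · refine seg_getD _ _ _ fun i _ => ?_
    simp [execs, Instr.exec, init, encode, add_comm 2]
  · rintro t ⟨d, hd, h0, h1, hn, hε, h20, ho, -, -⟩
    rw [List.append_nil] at hd
    subst hd
    exact ⟨h0, h1, hn, h20, ho, hε⟩

/-! ### The recursion depth -/

/-- Squaring removes `√6`, so the machine can find the depth by comparing rational numbers only; the
logarithm to a base below `1` reverses the inequality. -/
theorem lt_depth_iff (hn : 0 < n) {ε : ℝ} (h0 : 0 < ε) (l : ℕ) :
    l < depth n ε ↔ ε ^ 2 / (n ^ 2 * 600) < (0.981 ^ 2) ^ l := by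
  have hn' : (0 : ℝ) < n := by exact_mod_cast hn
  have hX : 0 < ε / (10 * √6 * n) := by positivity
  have e : ε ^ 2 / (n ^ 2 * 600) = (ε / (10 * √6 * n)) ^ 2 := by
    rw [div_pow, mul_pow, mul_pow, Real.sq_sqrt (by norm_num)]
    ring
  rw [depth, Nat.lt_ceil, e, ← pow_mul, mul_comm 2 l, pow_mul,
    pow_lt_pow_iff_left₀ hX.le (by positivity) two_ne_zero,
    Real.lt_logb_iff_rpow_lt_of_base_lt_one (by norm_num) (by norm_num) hX, Real.rpow_natCast]

/-! ### Digit bounds and the loop that computes the depth -/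

theorem bits_mul_le (p q : ℚ) : bits (p * q) ≤ bits p + bits q := by
  have h1 : (p * q).num.natAbs ≤ p.num.natAbs * q.num.natAbs := by
    rw [Rat.mul_num, ← Int.natAbs_mul]
    exact (Int.natAbs_ediv_le_natAbs _ _)
  have h2 : (p * q).den ≤ p.den * q.den :=
    Nat.le_of_dvd (by positivity) (Rat.mul_den_dvd p q)
  have key : ∀ a b c : ℕ, a ≤ b * c → Nat.size a ≤ Nat.size b + Nat.size c := by
    intro a b c h
    rw [Nat.size_le, pow_add]
    exact h.trans_lt (Nat.mul_lt_mul'' (Nat.lt_size_self b) (Nat.lt_size_self c))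
  have := key _ _ _ h1
  have := key _ _ _ h2
  unfold bits
  omega

theorem bits_inv {q : ℚ} (h : 0 < q) : bits q⁻¹ = bits q := by
  have h1 : 0 < q.num := Rat.num_pos.2 h
  unfold bits
  rw [Rat.num_inv, Rat.den_inv, Int.sign_eq_one_of_pos h1, if_neg h1.ne', one_mul,
    Int.natAbs_natCast, add_comm]

theorem bits_natCast_le (a : ℕ) : bits (a : ℚ) ≤ a + 1 := by
  unfold bits
  rw [Rat.num_natCast, Rat.den_natCast, Int.natAbs_natCast]
  have : Nat.size a ≤ a := Nat.size_le.2 Nat.lt_two_pow_self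
  have : Nat.size 1 = 1 := Nat.size_one
  omega

theorem bits_le_of_le_pow {q : ℚ} {a m : ℕ} (h0 : 0 ≤ q) (h2 : q ≤ 2 ^ a) (hd : q.den ≤ 2 ^ m) :
    bits q ≤ 2 * m + a + 2 := by
  have hpos : (0 : ℚ) < q.den := by exact_mod_cast q.den_pos
  have h3 : 0 ≤ q.num := Rat.num_nonneg.2 h0
  have h1 : (q.num.natAbs : ℚ) ≤ 2 ^ a * q.den := by
    rw [← div_le_iff₀ hpos, Nat.cast_natAbs, abs_of_nonneg h3, Rat.num_div_den]
    exact h2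
  have h1 : q.num.natAbs ≤ 2 ^ a * q.den := by exact_mod_cast h1
  have h4 : Nat.size q.num.natAbs ≤ m + a + 1 := by
    rw [Nat.size_le, pow_succ, pow_add]
    have := Nat.mul_le_mul_left (2 ^ a) hd
    have : 0 < 2 ^ m * 2 ^ a := by positivity
    linarith [mul_comm (2 ^ m) (2 ^ a)]
  have h5 : Nat.size q.den ≤ m + 1 := by
    rw [Nat.size_le, pow_succ]
    have : 0 < 2 ^ m := by positivity
    omega
  unfold bits
  omega

open Instr Test Cmd NatOp RatOp in
/-- Compute the recursion depth. -/
def depthCmd : Cmd := seqs [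
  blk [rcast 10 100, rop mul 10 10 10, rconst 11 600, rop mul 10 10 11, rop mul 11 0 0,
    rop div 10 11 10, rconst 11 1, rconst 12 (962361 / 1000000), op add 104 0 0],
  .while (rlt 10 11) (blk [rop mul 11 11 12, op add 104 104 1])]

theorem depthCmd_spec {C : MonCNF n} {ε : ℚ} (hn : 0 < n) (h0 : 0 < ε) (h : Parsed C ε s)
    (hB : 2 * n + 2 * bits ε + 40 * depth n (ε : ℝ) + 100 ≤ B) :
    Tri P B depthCmd s (3 * depth n (ε : ℝ) + 10)
      (fun t => Parsed C ε t ∧ t.reg 104 = depth n (ε : ℝ)) := by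
  set D := depth n (ε : ℝ) with hD
  have hnQ : (0 : ℚ) < n := by exact_mod_cast hn
  have bn := bits_natCast_le n
  have bn2 := bits_mul_le (n : ℚ) n
  have b600 : bits 600 = 11 := by decide +kernel
  have dq : (962361 / 1000000 : ℚ).den ≤ 2 ^ 20 := by decide +kernel
  have bq := bits_le_of_den_le (q := 962361 / 1000000) (by norm_num) (by norm_num) dq
  have b1 : bits 1 = 2 := by decide +kernel
  have bn3 := bits_mul_le ((n : ℚ) * n) 600
  have be2 := bits_mul_le ε ε
  have ba := bits_mul_le (ε * ε) (n * n * 600)⁻¹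
  rw [bits_inv (by positivity), ← div_eq_mul_inv] at ba
  have hv := h.vars
  have hε := h.eps
  have r0 := h.zero
  refine Tri.seqs_blk (K₂ := D * (2 + 1) + 1) (by simp) ?_ ?_ (by simp; omega)
  · simp [OkAll, Instr.Ok, Instr.exec, RatOp.eval, hv, hε]
    omega
  let I : ℕ → State → Prop := fun m t => Parsed C ε t ∧ m ≤ D ∧ t.reg 104 = D - m ∧
    t.rreg 10 = ε * ε / (n * n * 600) ∧ t.rreg 11 = (962361 / 1000000) ^ (D - m) ∧
    t.rreg 12 = 962361 / 1000000
  -- The constant `962361 / 1000000` is `0.981²`, so the loop runs exactly `D` times.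
  have test : ∀ l : ℕ, ε * ε / (n * n * 600) < (962361 / 1000000 : ℚ) ^ l ↔ l < D := by
    intro l
    rw [hD, lt_depth_iff hn (by exact_mod_cast h0), ← Rat.cast_lt (K := ℝ)]
    push_cast
    rw [sq, sq, show (0.981 ^ 2 : ℝ) = 962361 / 1000000 by norm_num]
  refine (Tri.while_nat (P := P) (B := B) I 2 ?_ ?_ D _
    ⟨⟨?_, ?_, ?_, ?_, ?_, ?_⟩, le_rfl, ?_, ?_, ?_, ?_⟩).mono le_rfl ?_
  · rintro t ⟨-, -, -, h10, h11, -⟩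
    rw [Test.holds, h10, h11, test]
    omega
  · rintro m t ⟨ht, hm, h104, h10, h11, h12⟩
    have hz : bits ((962361 / 1000000 : ℚ) ^ (D - (m + 1)) * (962361 / 1000000)) ≤ B := by
      rw [← pow_succ]
      refine (bits_le_of_den_le (m := 20 * (D - (m + 1) + 1)) (by positivity) ?_ ?_).trans
        (by omega)
      · exact (pow_le_one₀ (by norm_num) (by norm_num)).trans (by norm_num)
      · rw [Rat.den_pow, pow_mul]
        exact Nat.pow_le_pow_left dq _
    refine ⟨?_, Tri.blk (by simp) ?_ (by simp)
      ⟨⟨?_, ?_, ?_, ?_, ?_, ?_⟩, by omega, ?_, ?_, ?_, ?_⟩⟩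
    · rw [Test.holds, h10, h11, test]
      omega
    · simpa [OkAll, Instr.Ok, RatOp.eval, h11, h12] using hz
    · simpa [execs, Instr.exec] using ht.zero
    · simpa [execs, Instr.exec] using ht.one
    · simpa [execs, Instr.exec] using ht.vars
    · simpa [execs, Instr.exec] using ht.endAddr
    · simpa [execs, Instr.exec] using ht.inp
    · simpa [execs, Instr.exec] using ht.eps
    · simp [execs, Instr.exec, NatOp.eval, h104, ht.one]; omega
    · simpa [execs, Instr.exec] using h10
    · simp [execs, Instr.exec, RatOp.eval, h11, h12]
      rw [← pow_succ]; congr 1; omega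
    · simpa [execs, Instr.exec] using h12
  · simpa [execs, Instr.exec] using h.zero
  · simpa [execs, Instr.exec] using h.one
  · simpa [execs, Instr.exec] using h.vars
  · simpa [execs, Instr.exec] using h.endAddr
  · simpa [execs, Instr.exec] using h.inp
  · simpa [execs, Instr.exec] using h.eps
  · simp [execs, Instr.exec, NatOp.eval, r0]
  · simp [execs, Instr.exec, RatOp.eval, hv, hε]
  · simp [execs, Instr.exec]
  · simp [execs, Instr.exec]
  · rintro t ⟨ht, -, h104, -⟩
    exact ⟨ht, by simpa using h104⟩

end

end RAM

namespace RAM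

open MonCNF

variable {n : ℕ}

/-! ### The main procedure -/

section code

open Instr Test Cmd NatOp RatOp

/-- Multiply the estimate by the factor of the next variable and pin that variable to `1`. -/
def factorCmd : Cmd := seqs [
  blk [op add 5 105 1, op add 6 104 0, const 7 2, op add 8 103 0], call 1,
  blk [rconst 2 1, rop add 1 2 1, rop mul 100 100 1, const 20 2, op add 21 103 0, const 22 2,
    op add 23 105 1, op add 24 1 0, op add 25 0 0], sieveCmd,
  blk [op add 103 22 0, op add 105 105 1]]

/-- The main procedure. -/
def mainCmd : Cmd := seqs [parseCmd, depthCmd,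
  blk [op add 103 20 0, op add 2 20 0, op add 4 20 0, const 29 20, op add 3 20 20, op add 3 3 29,
    rconst 100 1, op add 105 0 0],
  .while (lt 105 100) factorCmd,
  blk [rconst 2 0, rop add 0 100 2]]

end code

section

variable {P : Program} {B T L N : ℕ} {s t : State} {Z : ℚ}

/-- The invariant of the loop over the variables: `vs` are the variables that remain, and `D` is
the formula in which the others have been pinned to `1`. -/
structure MainInv (T L N : ℕ) (Z : ℚ) (vs : List (Fin n)) (D : MonCNF n) (p : ℚ) (m : ℕ)
    (s : State) : Prop where
  zero : s.reg 0 = 0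
  one : s.reg 1 = 1
  gap : T ≤ s.reg 4
  frame : s.reg 4 + T + 20 ≤ s.reg 3
  vars : s.reg 100 = n
  level : s.reg 104 = L
  endAddr : s.reg 103 = 2 + (ftoks D).length
  below : s.reg 103 ≤ s.reg 2
  inp : Seg s.mem 2 (ftoks D)
  size : (ftoks D).length ≤ T
  read : D.ReadFive
  index : s.reg 105 + vs.length = n
  drop : vs = (List.finRange n).drop (s.reg 105)
  val : s.rreg 100 = p
  prod : p * pinProd (fun C x => 1 + ratio C x L) D vs = Z
  nonneg : 0 ≤ p
  le : p * 2 ^ vs.length ≤ 2 ^ n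
  den : p.den ≤ 2 ^ m
  exp : m + vs.length * N = n * N

/-- A factor is at most `2`, so the product stays at most `2 ^ n`; each factor adds at most `N` to
the denominator exponent. The formula at address `2` is then pinned in place. -/
theorem factorCmd_spec {v : Fin n} {vs : List (Fin n)} {D : MonCNF n} {p : ℚ} {m : ℕ}
    (h : MainInv T L N Z (v :: vs) D p m s) (hB : 2 * (n * N) + n + 3 ≤ B)
    (hcall : ∀ s', RatPre T D v L s' → Tri P B (.call 1) s' N (RatPost D v L N s')) :
    Tri P B factorCmd s (N + 11 * T + 18) (fun t => ∃ D' p' m',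
      MainInv T L N Z vs D' p' m' t) := by
  have r0 := h.zero
  have r1 := h.one
  have hlast := h.endAddr
  have hsize := h.size
  have hbelow := h.below
  have hindex := h.index
  rw [List.length_cons] at hindex
  have hv : v.val = s.reg 105 ∧ vs = (List.finRange n).drop (s.reg 105 + 1) := by
    have hd := h.drop
    rw [List.drop_eq_getElem_cons (by simp; omega), List.cons.injEq] at hd
    exact ⟨by rw [hd.1]; simp, hd.2⟩
  refine Tri.seqs_blk (K₂ := N + 11 * T + 14) (by simp) (by simp [OkAll, Instr.Ok]) ?_
    (by simp; omega)
  obtain ⟨s1, hs1⟩ : ∃ s1, s1 = execs [.op .add 5 105 1, .op .add 6 104 0, .const 7 2,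
    .op .add 8 103 0] s := ⟨_, rfl⟩
  have a5 : s1.reg 5 = v + 1 := by simp [hs1, execs, Instr.exec, NatOp.eval, r1, hv.1]
  have a6 : s1.reg 6 = L := by simp [hs1, execs, Instr.exec, NatOp.eval, r0, h.level]
  have a7 : s1.reg 7 = 2 := by simp [hs1, execs, Instr.exec]
  have a8 : s1.reg 8 = s.reg 103 := by simp [hs1, execs, Instr.exec, NatOp.eval, r0]
  have ar : ∀ r, r < 5 ∨ 100 ≤ r → s1.reg r = s.reg r := by
    intro r hr
    have : r ≠ 5 ∧ r ≠ 6 ∧ r ≠ 7 ∧ r ≠ 8 := by omega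
    simp [hs1, execs, Instr.exec, this]
  have am : s1.mem = s.mem := by simp [hs1, execs, Instr.exec]
  have aq : s1.rreg = s.rreg := by simp [hs1, execs, Instr.exec]
  rw [← hs1]
  clear hs1
  have hpre : RatPre T D v L s1 := by
    refine ⟨?_, ?_, ?_, ?_, a5, a6, ?_, ?_, ?_, hsize, h.read⟩
    · rw [ar 0 (by omega), r0]
    · rw [ar 1 (by omega), r1]
    · rw [ar 4 (by omega)]; exact h.gap
    · rw [ar 4 (by omega), ar 3 (by omega)]; exact h.frame
    · rw [a7, am]; exact h.inp
    · rw [a7, a8]; exact hlast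
    · rw [a8, ar 2 (by omega)]; exact hbelow
  refine Tri.seqs_cons (K₂ := 11 * T + 14) (hcall s1 hpre) ?_ (by omega)
  intro t1 hpost
  have hq := hpost.val
  have br : ∀ r, r < 5 ∨ 100 ≤ r → t1.reg r = s.reg r := fun r hr => by
    rw [hpost.reg r hr, ar r hr]
  have b100 : t1.rreg 100 = p := by rw [hpost.rreg 100 le_rfl, aq, h.val]
  have p0 := (br 0 (by omega)).trans r0
  have p1 := (br 1 (by omega)).trans r1
  have hrat := ratio_mem_Icc D v L
  have hle : p * (1 + ratio D v L) * 2 ^ vs.length ≤ 2 ^ n := by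
    refine le_trans ?_ h.le
    rw [List.length_cons, pow_succ, mul_assoc, mul_comm ((2 : ℚ) ^ vs.length)]
    refine mul_le_mul_of_nonneg_left ?_ h.nonneg
    exact mul_le_mul_of_nonneg_right (by linarith) (by positivity)
  have hnonneg : 0 ≤ p * (1 + ratio D v L) := mul_nonneg h.nonneg (by linarith)
  have hden := den_mul_le h.den (den_one_add_le hpost.den)
  have hexp : m + N + vs.length * N = n * N := by
    rw [← h.exp, List.length_cons, Nat.add_mul, one_mul]; omega
  have hmN : m + N ≤ n * N := by omega
  have hb2 : bits (p * (1 + ratio D v L)) ≤ B := by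
    refine (bits_le_of_le_pow (a := n) hnonneg (le_trans ?_ hle) hden).trans (by omega)
    exact le_mul_of_one_le_right hnonneg (one_le_pow₀ (by norm_num))
  have hb1 : bits (1 + ratio D v L) ≤ B :=
    (bits_le_of_den_le (by linarith) (by linarith) (den_one_add_le hpost.den)).trans (by omega)
  have hb0 : bits 1 ≤ B := (bits_le_of_den_le (m := 0) (by norm_num) (by norm_num)
    (den_le_of_mem (by simp) _)).trans (by omega)
  refine Tri.seqs_blk (K₂ := 11 * T + 5) (by simp) ?_ ?_ (by simp; omega)
  · simpa [OkAll, Instr.Ok, Instr.exec, RatOp.eval, hq, b100] using ⟨hb0, hb1, hb2⟩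
  obtain ⟨s2, hs2⟩ : ∃ s2, s2 = execs [.rconst 2 1, .rop .add 1 2 1, .rop .mul 100 100 1,
    .const 20 2, .op .add 21 103 0, .const 22 2, .op .add 23 105 1, .op .add 24 1 0,
    .op .add 25 0 0] t1 := ⟨_, rfl⟩
  have c100 : s2.rreg 100 = p * (1 + ratio D v L) := by
    simp [hs2, execs, Instr.exec, RatOp.eval, hq, b100]
  have c20 : s2.reg 20 = 2 := by simp [hs2, execs, Instr.exec]
  have c21 : s2.reg 21 = s.reg 103 := by simp [hs2, execs, Instr.exec, NatOp.eval, p0, br 103]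
  have c22 : s2.reg 22 = 2 := by simp [hs2, execs, Instr.exec]
  have c23 : s2.reg 23 = v + 1 := by
    simp [hs2, execs, Instr.exec, NatOp.eval, p1, br 105, hv.1]
  have c24 : s2.reg 24 = 1 := by simp [hs2, execs, Instr.exec, NatOp.eval, p0, p1]
  have c25 : s2.reg 25 = 0 := by simp [hs2, execs, Instr.exec, NatOp.eval, p0]
  have cr : ∀ r, r < 5 ∨ 100 ≤ r → s2.reg r = s.reg r := by
    intro r hr
    have : r ≠ 20 ∧ r ≠ 21 ∧ r ≠ 22 ∧ r ≠ 23 ∧ r ≠ 24 ∧ r ≠ 25 := by omega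
    simp [hs2, execs, Instr.exec, this, br r hr]
  have cm : s2.mem = t1.mem := by simp [hs2, execs, Instr.exec]
  rw [← hs2]
  clear hs2
  have key := sieveCmd_spec (P := P) (B := B) (s := s2) (enc D) (enc_pos D)
    (by rw [cr 0 (by omega), r0]) (by rw [cr 1 (by omega), r1])
    (by
      rw [c20, cm]
      change Seg t1.mem _ (ftoks D)
      refine h.inp.congr fun i _ hi => ?_
      rw [hpost.mem i (by rw [ar 2 (by omega)]; omega), am])
    (by rw [c20, c21]; exact hlast) (by rw [c20, c22]; exact Or.inl le_rfl)
  rw [c23, c24, c25, sieve_clausesWithout, c22] at key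
  refine Tri.seqs_cons (K₂ := 2) key ?_ (by change 11 * (ftoks D).length + 3 + _ ≤ _; omega)
  rintro t2 ⟨hk, hseg, d22, -⟩
  have d22 : t2.reg 22 = 2 + (ftoks (clausesWithout D v)).length := d22
  have hlen := length_ftoks_clauses D v
  have dr : ∀ r, r < 5 ∨ 100 ≤ r → t2.reg r = s.reg r := fun r hr => by
    rw [hk.reg r (by omega), cr r hr]
  have q0 := (dr 0 (by omega)).trans r0
  have q1 := (dr 1 (by omega)).trans r1
  refine Tri.blk (by simp) (by simp [OkAll, Instr.Ok]) (by simp)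
    ⟨clausesWithout D v, p * (1 + ratio D v L), m + N, ⟨?_, ?_, ?_, ?_, ?_, ?_, ?_, ?_, hseg,
      by omega, h.read.clausesWithout v, ?_, ?_, ?_, ?_, hnonneg, hle, hden, hexp⟩⟩
  · simpa [execs, Instr.exec] using q0
  · simpa [execs, Instr.exec] using q1
  · simpa [execs, Instr.exec, dr 4] using h.gap
  · simpa [execs, Instr.exec, dr 4, dr 3] using h.frame
  · simpa [execs, Instr.exec, dr 100] using h.vars
  · simpa [execs, Instr.exec, dr 104] using h.level
  · simp [execs, Instr.exec, NatOp.eval, q0, d22]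
  · simp [execs, Instr.exec, NatOp.eval, q0, d22, dr 2]; omega
  · simp [execs, Instr.exec, NatOp.eval, q1, dr 105]; omega
  · simpa [execs, Instr.exec, NatOp.eval, q1, dr 105] using hv.2
  · simpa [execs, Instr.exec, hk.rreg] using c100
  · have := h.prod
    rw [pinProd, ← mul_assoc] at this
    exact this

/-- A bound for the number of steps of the main procedure. -/
def mainCost (n T L N : ℕ) : ℕ := 7 * T + 3 * L + n * (N + 11 * T + 19) + 27

theorem mainCmd_spec {C : MonCNF n} {ε : ℚ} (hn : 0 < n) (hC : C.ReadFive) (h0 : 0 < ε)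
    (hT : T = (ftoks C).length) (hL : L = depth n (ε : ℝ)) (hN : N = 2 * ratCost (84 * (T + 1)) T L)
    (hP0 : P[0]? = some mainCmd) (hP : P[1]? = some ratCmd)
    (hB : 40 * mainCost n T L N + 2 * bits ε ≤ B) :
    Tri P B (.call 0) (init C ε) (mainCost n T L N) (fun t => t.rreg 0 = C.estimate L) := by
  have hnN : N ≤ n * N := Nat.le_mul_of_pos_left N hn
  have hcost : 7 * T + 3 * L + n * N + 19 * n + 27 ≤ mainCost n T L N := by
    unfold mainCost
    rw [mul_add, mul_add]
    have : 0 ≤ n * (11 * T) := Nat.zero_le _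
    omega
  unfold mainCost at hB hcost ⊢
  set X := n * (N + 11 * T + 19) with hX
  refine Tri.call (K := 7 * T + 3 * L + X + 26) hP0 ?_
  refine Tri.seqs_cons (K₂ := 3 * L + X + 21) ((parseCmd_spec C ε).mono le_rfl fun _ => id) ?_
    (by omega)
  intro s1 hs1
  refine Tri.seqs_cons (K₂ := X + 11) (depthCmd_spec hn h0 hs1 (by omega)) ?_ (by omega)
  rw [← hL]
  rintro s2 ⟨hs2, h104⟩
  have hb1 : bits 1 ≤ B := (bits_le_of_den_le (m := 0) (by norm_num) (by norm_num)
    (den_le_of_mem (by simp) _)).trans (by omega)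
  have hb0 : bits 0 ≤ B := (bits_le_of_den_le (m := 0) (by norm_num) (by norm_num)
    (den_le_of_mem (by simp) _)).trans (by omega)
  refine Tri.seqs_blk (K₂ := X + 3) (by simp) (by simpa [OkAll, Instr.Ok] using hb1) ?_
    (by simp; omega)
  obtain ⟨s3, hs3⟩ : ∃ s3, s3 = execs [.op .add 103 20 0, .op .add 2 20 0, .op .add 4 20 0,
    .const 29 20, .op .add 3 20 20, .op .add 3 3 29, .rconst 100 1, .op .add 105 0 0] s2 := ⟨_, rfl⟩
  have r0 := hs2.zero
  -- The gap is `T + 2` and the frame size `2 (T + 2) + 20`, which leaves room for the header, the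
  -- formulas of a node and one formula of a child.
  have hinv : MainInv T L N (C.estimate L) (List.finRange n) C 1 0 s3 := by
    have h20 := hs2.endAddr
    refine ⟨?_, ?_, ?_, ?_, ?_, ?_, ?_, ?_, ?_, hT.ge, hC, ?_, ?_, ?_, ?_, zero_le_one, ?_, ?_, ?_⟩
    · simpa [hs3, execs, Instr.exec] using r0
    · simpa [hs3, execs, Instr.exec] using hs2.one
    · simp [hs3, execs, Instr.exec, NatOp.eval, r0, h20]; omega
    · simp [hs3, execs, Instr.exec, NatOp.eval, r0, h20]; omega
    · simpa [hs3, execs, Instr.exec] using hs2.vars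
    · simpa [hs3, execs, Instr.exec] using h104
    · simp [hs3, execs, Instr.exec, NatOp.eval, r0, h20]
    · simp [hs3, execs, Instr.exec, NatOp.eval, r0]
    · simpa [hs3, execs, Instr.exec] using hs2.inp
    · simp [hs3, execs, Instr.exec, NatOp.eval, r0]
    · simp [hs3, execs, Instr.exec, NatOp.eval, r0]
    · simp [hs3, execs, Instr.exec]
    · rw [one_mul, estimate_eq_pinProd]
    · simp
    · simp
    · simp
  rw [← hs3]
  clear hs3
  let I : List (Fin n) → State → Prop := fun vs t => ∃ D p m,
    MainInv T L N (C.estimate L) vs D p m t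
  refine Tri.seqs_cons (K₁ := 1 + X) (K₂ := 2) (R := I []) ?_ ?_ (by omega)
  · refine (Tri.while_list I (fun vs => 1 + vs.length * (N + 11 * T + 19)) ?_ (by simp) ?_
      (List.finRange n) s3 ⟨C, 1, 0, hinv⟩).mono (by simp [hX]) fun _ => id
    · rintro t ⟨D, p, m, ht⟩
      have := ht.index
      simp only [Test.holds, ht.vars]
      simp at this
      omega
    · rintro v vs t ⟨D, p, m, ht⟩
      have := ht.index
      rw [List.length_cons] at this
      refine ⟨by simp only [Test.holds, ht.vars]; omega, N + 11 * T + 18,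
        by rw [List.length_cons, add_mul, one_mul]; omega,
        factorCmd_spec ht (by omega) fun s' hs' => ?_⟩
      rw [hN]
      exact call_ratCmd_spec_root le_rfl hP (by omega) hs'
  · rintro t ⟨D, p, m, ht⟩
    have hp := ht.prod
    have hle := ht.le
    have hexp := ht.exp
    rw [pinProd, mul_one] at hp
    rw [List.length_nil, pow_zero, mul_one] at hle
    rw [List.length_nil, zero_mul, add_zero] at hexp
    have hbits := bits_le_of_le_pow ht.nonneg hle ht.den
    refine Tri.blk (by simp) ?_ (by simp) ?_
    · simpa [OkAll, Instr.Ok, Instr.exec, RatOp.eval, ht.val] using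
        ⟨hb0, hbits.trans (by omega)⟩
    · simpa [execs, Instr.exec, RatOp.eval, ht.val] using hp

/-! ### The program on the initial state -/

/-- The program. -/
def program : Program := [mainCmd, ratCmd]

theorem size_encode_le {C : MonCNF n} (a : ℕ) :
    Nat.size ((encode C).getD a 0) ≤ n + (ftoks C).length := by
  have key : ∀ v ∈ encode C, v ≤ n + (ftoks C).length := by
    intro v hv
    simp only [encode, List.mem_cons, List.mem_flatMap] at hv
    rcases hv with rfl | rfl | ⟨c, hc, rfl | hv⟩
    · omega
    · have : ∀ D : MonCNF n, D.length ≤ (ftoks D).length := fun D => by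
        induction D with
        | nil => simp
        | cons c D ih => rw [length_ftoks_cons, List.length_cons]; omega
      have := this C
      omega
    · have := length_le_of_mem hc; omega
    · obtain ⟨x, -, rfl⟩ := List.mem_map.1 hv
      omega
  have h : (encode C).getD a 0 ≤ n + (ftoks C).length := by
    rcases lt_or_ge a (encode C).length with ha | ha
    · rw [List.getD_eq_getElem _ _ ha]
      exact key _ (List.getElem_mem ha)
    · rw [List.getD_eq_default _ _ ha]; omega
  exact Nat.size_le.2 (h.trans_lt Nat.lt_two_pow_self)

/-- Input numbers have at most `n + T` digits, and eight more per step still fit below forty times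
the cost; so the run without size limits for natural numbers becomes a legal execution. -/
theorem program_computes {C : MonCNF n} {ε : ℚ} (hn : 0 < n) (hC : C.ReadFive) (h0 : 0 < ε)
    (hT : T = (ftoks C).length) (hL : L = depth n (ε : ℝ)) (hN : N = 2 * ratCost (84 * (T + 1)) T L)
    (hB : 40 * mainCost n T L N + 2 * bits ε ≤ B) :
    ∃ k, k ≤ mainCost n T L N ∧ Computes program B C ε k (C.estimate L) := by
  obtain ⟨k, t, hk, hrun, ht⟩ := mainCmd_spec (P := program)
    (B := 40 * mainCost n T L N + 2 * bits ε) hn hC h0 hT hL hN rfl rfl le_rfl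
  have hcost : n + T + 27 ≤ mainCost n T L N := by
    unfold mainCost
    have := Nat.le_mul_of_pos_right n (show 0 < N + 11 * T + 19 by omega)
    omega
  refine ⟨k, hk, t, (hrun.exec hB (n + T) ⟨fun a => ?_, fun a => ?_⟩ ⟨fun a => ?_, fun a => ?_⟩
    (by omega)).1, ht⟩
  · simp [init]
  · rw [hT]; exact size_encode_le a
  · have hb0 : bits 0 = 1 := by decide +kernel
    simp only [init]
    split_ifs <;> omega
  · have hb0 : bits 0 = 1 := by decide +kernel
    simp only [init]
    omega

end

end RAM

namespace RAM

open MonCNF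

variable {n : ℕ}

/-! ### The size of the input and the running time -/

/-- A nonempty clause with `w` variables takes `w + 1 ≤ 2 w` tokens, and the clause lengths sum to
the degrees. -/
theorem length_ftoks_le_sum_deg {C : MonCNF n} (hne : ∀ c ∈ C, c ≠ []) (hnd : ∀ c ∈ C, c.Nodup) :
    (ftoks C).length ≤ 2 * ∑ v, deg C v := by
  induction C with
  | nil => simp [ftoks, enc, toks]
  | cons c C ih =>
    have ih := ih (fun d hd => hne d (List.mem_cons_of_mem _ hd))
      fun d hd => hnd d (List.mem_cons_of_mem _ hd)
    have hc : ∑ v, (if v ∈ c then 1 else 0) = c.length := by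
      rw [← List.toFinset_card_of_nodup (hnd c List.mem_cons_self), Finset.card_eq_sum_ones,
        ← Finset.sum_filter]
      congr 1
      ext v
      simp
    have hpos : 0 < c.length := List.length_pos_of_ne_nil (hne c List.mem_cons_self)
    simp_rw [deg_cons]
    rw [Finset.sum_add_distrib, hc, length_ftoks_cons]
    omega

theorem length_ftoks_le {C : MonCNF n} (hC : C.IsRead 5) : (ftoks C).length ≤ 10 * n := by
  have h := length_ftoks_le_sum_deg hC.nonempty hC.nodup
  have : ∑ v, deg C v ≤ n * 5 := by
    simpa using Finset.sum_le_card_nsmul Finset.univ (fun v => deg C v) 5 fun v _ => hC.read v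
  omega

theorem ratCost_le (E T L : ℕ) : ratCost E T L ≤ 17 * (E * (T + 1)) * 13 ^ L := by
  unfold ratCost
  split_ifs with hL
  · subst hL
    rw [pow_zero, mul_one]
    nlinarith [Nat.zero_le (E * T)]
  · exact le_rfl

/-- With `T ≤ 10 n` a root call costs `O(n² 13 ^ L)`, where `172788 = 17 · 84 · 11²`; there are `n`
root calls. -/
theorem mainCost_le {n T : ℕ} (L : ℕ) (hn : 0 < n) (hT : T ≤ 10 * n) :
    mainCost n T L (2 * ratCost (84 * (T + 1)) T L) ≤ 400000 * (n ^ 2 * (n * 13 ^ L)) := by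
  have hX : 1 ≤ 13 ^ L := Nat.one_le_pow _ _ (by norm_num)
  have hL : L ≤ 13 ^ L := (Nat.lt_pow_self (by norm_num)).le
  have hr := ratCost_le (84 * (T + 1)) T L
  generalize ratCost (84 * (T + 1)) T L = r at *
  generalize 13 ^ L = X at *
  have hr : r ≤ 172788 * (n ^ 2 * X) := by
    refine hr.trans ?_
    calc 17 * (84 * (T + 1) * (T + 1)) * X ≤ 17 * (84 * (11 * n) * (11 * n)) * X := by
          gcongr <;> omega
      _ = 172788 * (n ^ 2 * X) := by ring
  have h1 : n * X ≤ n ^ 2 * (n * X) := Nat.le_mul_of_pos_left _ (by positivity)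
  have h2 : n ≤ n * X := Nat.le_mul_of_pos_right _ hX
  have h3 : X ≤ n * X := Nat.le_mul_of_pos_left _ hn
  have h4 : n * n ≤ n ^ 2 * (n * X) := by
    rw [sq]
    exact Nat.le_mul_of_pos_right _ (by positivity)
  have h5 : n * r ≤ 172788 * (n ^ 2 * (n * X)) := by
    calc n * r ≤ n * (172788 * (n ^ 2 * X)) := Nat.mul_le_mul_left _ hr
      _ = _ := by ring
  have h6 : n * T ≤ 10 * (n * n) := by
    calc n * T ≤ n * (10 * n) := Nat.mul_le_mul_left _ hT
      _ = _ := by ring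
  unfold mainCost
  rw [show n * (2 * r + 11 * T + 19) = 2 * (n * r) + 11 * (n * T) + 19 * n by ring]
  omega

theorem depth_le (hn : 0 < n) {ε : ℝ} (h0 : 0 < ε) (h1 : ε < 1) :
    (depth n ε : ℝ) ≤
      Real.logb (1 / 0.981) (n / ε) + (Real.logb (1 / 0.981) (10 * √6) + 1) := by
  have hn' : (1 : ℝ) ≤ n := by exact_mod_cast hn
  have h6 : 1 ≤ √6 := Real.one_le_sqrt.2 (by norm_num)
  have e : Real.logb 0.981 (ε / (10 * √6 * n)) =
      Real.logb (1 / 0.981) (n / ε) + Real.logb (1 / 0.981) (10 * √6) := by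
    rw [← Real.logb_mul (by positivity) (by positivity), one_div, Real.logb_inv_base,
      ← Real.logb_inv]
    congr 1
    field_simp
  rw [← add_assoc, ← e]
  refine (Nat.ceil_lt_add_one ?_).le
  refine Real.logb_nonneg_of_base_lt_one (by norm_num) (by norm_num) (by positivity) ?_
  rw [div_le_one (by positivity)]
  nlinarith

/-- Write `n/ε = (1/0.981) ^ u`; then `L ≤ u + c₀` and the right side is a multiple of `16 ^ u`. The
spare factor `n ≤ n/ε` raises the base `13` to `13 / 0.981 < 16`, so it is absorbed. -/
theorem exists_mul_pow_le :
    ∃ c : ℝ, 0 < c ∧ ∀ (n : ℕ), 0 < n → ∀ ε : ℝ, 0 < ε → ε < 1 →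
      (n : ℝ) * 13 ^ depth n ε ≤ c * ((n : ℝ) / ε) ^ Real.logb (1 / 0.981) 16 := by
  set c₀ := Real.logb (1 / 0.981) (10 * √6) + 1 with hc₀
  refine ⟨13 ^ c₀, by positivity, fun n hn ε h0 h1 => ?_⟩
  have hn' : (1 : ℝ) ≤ n := by exact_mod_cast hn
  have hd := depth_le hn h0 h1
  rw [← hc₀] at hd
  set y := (n : ℝ) / ε with hy
  set u := Real.logb (1 / 0.981) y with hu
  have hny : (n : ℝ) ≤ y := by rw [hy, le_div_iff₀ h0]; nlinarith
  have hy0 : 0 < y := by linarith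
  have hu0 : 0 ≤ u := Real.logb_nonneg (by norm_num) (by linarith)
  have ey : y = (1 / 0.981 : ℝ) ^ u := (Real.rpow_logb (by norm_num) (by norm_num) hy0).symm
  have e16 : y ^ Real.logb (1 / 0.981) 16 = (16 : ℝ) ^ u := by
    rw [ey, ← Real.rpow_mul (by norm_num), mul_comm, Real.rpow_mul (by norm_num),
      Real.rpow_logb (by norm_num) (by norm_num) (by norm_num)]
  rw [e16]
  calc (n : ℝ) * 13 ^ depth n ε ≤ y * 13 ^ (u + c₀) := by
        refine mul_le_mul hny ?_ (by positivity) hy0.le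
        rw [← Real.rpow_natCast]
        exact Real.rpow_le_rpow_of_exponent_le (by norm_num) hd
    _ = 13 ^ c₀ * ((1 / 0.981) ^ u * 13 ^ u) := by
        rw [Real.rpow_add (by norm_num), ← ey]; ring
    _ ≤ 13 ^ c₀ * 16 ^ u := by
        rw [← Real.mul_rpow (by norm_num) (by norm_num)]
        gcongr
        norm_num

/-- The program computes the estimate within the stated time, on numbers of polynomial length. -/
theorem exists_program : ∃ (P : Program) (K : ℕ), ∀ (n : ℕ), 0 < n → ∀ C : MonCNF n, C.IsRead 5 →
    ∀ ε : ℚ, 0 < ε → ε < 1 → ∃ k : ℕ,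
      Computes P (K * (n + ⌈1 / ε⌉₊ + bits ε) ^ K) C ε k (C.estimate (depth n (ε : ℝ))) ∧
      (k : ℝ) ≤ K * ((n : ℝ) ^ 2 * ((n : ℝ) / (ε : ℝ)) ^ Real.logb (1 / 0.981) 16) := by
  obtain ⟨c, hc, hcost⟩ := exists_mul_pow_le
  set lam := Real.logb (1 / 0.981) 16 with hlam
  have hlam0 : 0 ≤ lam := Real.logb_nonneg (by norm_num) (by norm_num)
  set M := ⌈c⌉₊ with hM
  have hcM : c ≤ M := Nat.le_ceil c
  -- One constant serves as coefficient and exponent: `16000000 = 40 · 400000` comes from the digit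
  -- bound, the `2` from the digits of `ε`, and the last summand is the degree in `S`, since `n ≤ S`
  -- and `n/ε ≤ S²`.
  set K := 16000000 * M + 2 + (2 + 2 * ⌈lam⌉₊) with hK
  refine ⟨program, K, fun n hn C hC ε h0 h1 => ?_⟩
  have h0' : (0 : ℝ) < ε := by exact_mod_cast h0
  have h1' : (ε : ℝ) < 1 := by exact_mod_cast h1
  have hn' : (1 : ℝ) ≤ n := by exact_mod_cast hn
  set L := depth n (ε : ℝ) with hL
  set T := (ftoks C).length with hT
  set y : ℝ := (n : ℝ) / (ε : ℝ) with hy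
  set S := n + ⌈1 / ε⌉₊ + bits ε with hS
  have hkey : (mainCost n T L (2 * ratCost (84 * (T + 1)) T L) : ℝ) ≤
      400000 * M * ((n : ℝ) ^ 2 * y ^ lam) := by
    have h2 : (mainCost n T L (2 * ratCost (84 * (T + 1)) T L) : ℝ) ≤
        400000 * ((n : ℝ) ^ 2 * ((n : ℝ) * 13 ^ L)) := by
      exact_mod_cast mainCost_le L hn (length_ftoks_le hC)
    have h3 := hcost n hn ε h0' h1'
    calc _ ≤ 400000 * ((n : ℝ) ^ 2 * ((n : ℝ) * 13 ^ L)) := h2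
      _ ≤ 400000 * ((n : ℝ) ^ 2 * (c * y ^ lam)) := by gcongr
      _ ≤ 400000 * ((n : ℝ) ^ 2 * (M * y ^ lam)) := by gcongr
      _ = _ := by ring
  have hS1 : 1 ≤ S := by omega
  have hB : 40 * mainCost n T L (2 * ratCost (84 * (T + 1)) T L) + 2 * bits ε ≤ K * S ^ K := by
    have hnS : (n : ℝ) ≤ S := by
      have : n ≤ S := by omega
      exact_mod_cast this
    have hS1' : (1 : ℝ) ≤ S := by exact_mod_cast hS1
    have hyS : y ≤ (S : ℝ) ^ 2 := by
      have h4 : (1 / ε : ℝ) ≤ (⌈1 / ε⌉₊ : ℝ) := by exact_mod_cast Nat.le_ceil (1 / ε)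
      have h5 : (⌈1 / ε⌉₊ : ℝ) ≤ S := by
        have : ⌈1 / ε⌉₊ ≤ S := by omega
        exact_mod_cast this
      rw [hy, div_eq_mul_one_div, sq]
      exact mul_le_mul hnS (h4.trans h5) (by positivity) (by positivity)
    have hpow : y ^ lam ≤ (S : ℝ) ^ (2 * ⌈lam⌉₊) := by
      rw [pow_mul, ← Real.rpow_natCast]
      calc y ^ lam ≤ ((S : ℝ) ^ 2) ^ lam := Real.rpow_le_rpow (by positivity) hyS hlam0
        _ ≤ _ := Real.rpow_le_rpow_of_exponent_le (one_le_pow₀ hS1') (Nat.le_ceil _)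
    have hkey' : mainCost n T L (2 * ratCost (84 * (T + 1)) T L) ≤
        400000 * M * S ^ (2 + 2 * ⌈lam⌉₊) := by
      have : (mainCost n T L (2 * ratCost (84 * (T + 1)) T L) : ℝ) ≤
          400000 * M * (S : ℝ) ^ (2 + 2 * ⌈lam⌉₊) := by
        refine hkey.trans ?_
        rw [pow_add]
        gcongr
      exact_mod_cast this
    have hSK : S ^ (2 + 2 * ⌈lam⌉₊) ≤ S ^ K := Nat.pow_le_pow_right hS1 (by omega)
    have hSK' : S ≤ S ^ K := Nat.le_self_pow (by omega) S
    have hb : bits ε ≤ S := by omega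
    calc 40 * mainCost n T L (2 * ratCost (84 * (T + 1)) T L) + 2 * bits ε
        ≤ 40 * (400000 * M * S ^ K) + 2 * S ^ K := by
          gcongr
          · exact hkey'.trans (Nat.mul_le_mul_left _ hSK)
          · exact hb.trans hSK'
      _ = (16000000 * M + 2) * S ^ K := by ring
      _ ≤ K * S ^ K := Nat.mul_le_mul_right _ (by omega)
  obtain ⟨k, hk, hcomp⟩ := program_computes hn hC.readFive h0 hT hL rfl hB
  refine ⟨k, hcomp, ?_⟩
  have hk' : (k : ℝ) ≤ (mainCost n T L (2 * ratCost (84 * (T + 1)) T L) : ℝ) := by exact_mod_cast hk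
  refine (hk'.trans hkey).trans ?_
  have : (400000 * M : ℝ) ≤ K := by
    have : 400000 * M ≤ K := by omega
    exact_mod_cast this
  gcongr

end RAM

theorem mainTheorem1 :
    -- the estimator is within a factor `1 ± ε` of the number of satisfying assignments
    (∀ (n : ℕ), 0 < n → ∀ C : MonCNF n, C.IsRead 5 → ∀ ε : ℝ, 0 < ε → ε < 1 →
      (1 - ε) * (C.numSat : ℝ) ≤ (C.estimate (MonCNF.depth n ε) : ℝ) ∧
        (C.estimate (MonCNF.depth n ε) : ℝ) ≤ (1 + ε) * (C.numSat : ℝ)) ∧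
    -- one deterministic program computes it within the stated time, on numbers of polynomial length
    (∃ (P : RAM.Program) (K : ℕ), ∀ (n : ℕ), 0 < n → ∀ C : MonCNF n, C.IsRead 5 →
      ∀ ε : ℚ, 0 < ε → ε < 1 →
        ∃ k : ℕ,
          RAM.Computes P (K * (n + ⌈1 / ε⌉₊ + RAM.bits ε) ^ K) C ε k
            (C.estimate (MonCNF.depth n (ε : ℝ))) ∧
          (k : ℝ) ≤ K * ((n : ℝ) ^ 2 *
            ((n : ℝ) / (ε : ℝ)) ^ Real.logb (1 / 0.981) 16)) ∧
    -- counting set covers by sets of at most `5` elements is an instance of the problem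
    (∀ (n m : ℕ) (S : Fin n → Finset (Fin m)), (∀ i, (S i).card ≤ 5) → (∀ e, ∃ i, e ∈ S i) →
      (MonCNF.ofSets S).IsRead 5 ∧
        (MonCNF.ofSets S).numSat = Nat.card {T : Finset (Fin n) // ∀ e, ∃ i ∈ T, e ∈ S i}) := by
  refine ⟨fun n hn C hC ε h0 h1 => C.estimate_mem_Icc hn hC ε h0 h1, RAM.exists_program,
    fun n m S h5 hS => ⟨MonCNF.ofSets_isRead S h5 hS, MonCNF.numSat_ofSets S⟩⟩
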